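/- **Setting.** An equilateral pentagon is a 5-tuple $(z_1,\dots,z_5)\in\mathbb C^5$ (indices mod 5) with $|z_{i+1}-z_i|=1$ for all $i$. Its relative angles are $\psi_i=-\operatorname{Arg}\bigl(-\frac{z_{i+1}-z_i}{z_i-z_{i-1}}\bigr)$ mod $2\pi$. The labelled shape space $S\subset(\mathbb R/2\pi\mathbb Z)^5$ is the space of all tuples $\psi=(\psi_1,\dots,\psi_5)$ so obtained (equivalently, equilateral pentagons modulo $SE(2)$). On $S$ act $(R\psi)_i=\psi_{i+1}$ (vertex rotation), $(V\psi)_i=-\psi_{6-i}$ (vertex reflection) and $M\psi=-\psi$ (mirror reflection). Let $D_5^+=\langle R,MV\rangle$ and $D_{10}=\langle R,V,M\rangle$. An oriented shape is a $D_5^+$-orbit in $S$, an unoriented shape is a $D_{10}$-orbit. Reals $(\alpha_1,\alpha_2,\alpha_3)$ are $\alpha$-coordinates of $\psi\in S$ if $\psi_2=\pi-\alpha_2-\alpha_3$, $\psi_3=\alpha_2-\alpha_1-\pi$, $\psi_4=\pi-\alpha_2+\alpha_3$ mod $2\pi$; they are reduced if $\alpha_1,\alpha_2\in(-\pi,\pi]$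 and $\alpha_3\in(0,\pi]$. The regular shapes are those with all $\psi_i=\theta$, where $\theta=\pm\pi/5$ (pentagrams) or $\theta=\pm3\pi/5$ (regular convex pentagons). A shape is reflection symmetric if some power of $R$ maps it to a shape of the form $(\psi_1,\psi_2,\psi_3,\psi_2,\psi_1)$. The symmetry curves are $R^k\{\alpha_3=0\}$, $k=0,\dots,4$. Let $b_1$ be the arc of shapes with $\alpha$-coordinates $\bigl(t,\arccos[-\tfrac18(3+4\cos t)\sec^2(t/2)],0\bigr)$, $t\in[-\frac{2\pi}5,\frac{4\pi}5]$, and let $b_2,b_3,b_4$ be obtained from it by turning the plane $\alpha_3=0$ by $-\frac\pi2$, $\pi$, $\frac\pi2$ respectively. **Statement.** 1. $R^5=(MV)^2=1$ and $(MV)R=R^{-1}(MV)$; $D_5^+$ is isomorphic to the dihedral group of order 10 and $D_{10}$ to the dihedral group of order 20. 2. All four regular shapes exist. Regular shapes have $D_5^+$-isotropy group $D_5^+$ and orbit length 1. A reflection symmetric shape that is not regular has isotropy group generated by one of the involutions $R^kMVR^{-k}$, $0\le k<5$, which is isomorphic to $\mathbb Z_2$, and orbit length 5. All other shapes have trivial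 isotropy and orbit length 10. 3. For $0\le k<5$ the symmetry curve $R^k\{\alpha_3=0\}$ is the fixed set of $R^kMVR^{-k}$; these five curves are distinct, a shape is reflection symmetric if and only if it lies on one of them, and $\{\alpha_3=0\}=b_1\cup b_2\cup b_3\cup b_4$. 4. The complement in $S$ of the five symmetry curves has exactly 10 connected components (the regions); each is open and simply connected. 5. The arcs $R(b_4)$, $R^3(b_1)$, $R^4(b_2)$, $R^2(b_3)$ form a quadrilateral: cyclically consecutive arcs meet in exactly one point, namely in the regular shape with $\theta=\frac\pi5,\frac{3\pi}5,-\frac\pi5,-\frac{3\pi}5$ respectively (for the pairs $R(b_4)\cap R^3(b_1)$, $R^3(b_1)\cap R^4(b_2)$, $R^4(b_2)\cap R^2(b_3)$, $R^2(b_3)\cap R(b_4)$), and opposite arcs are disjoint. 6. There is exactly one set $\phi\subset S$ that is the closure of a region and whose boundary is $R(b_4)\cup R^3(b_1)\cup R^4(b_2)\cup R^2(b_3)$. It contains every oriented shape exactly once, and for every region $C$ there is exactly one $g\in D_5^+$ with $\overline C=g\phi$. Every shape in $\phi$ has reduced $\alpha$-coordinates, and among the shapes in $\phi$ it is determined by $(\alpha_1,\alpha_2)$.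 7. $V\phi=\phi$. A shape in $\phi$ is fixed by $V$ if and only if it has $\alpha$-coordinates $(0,0,\pi-\arccos\frac78)$, and $\phi$ contains such a shape. The $D_{10}$-orbit of a shape in $\phi$ has length 2 if it is regular, 10 if it lies on the boundary of $\phi$ and is not regular, 10 if it is fixed by $V$, and 20 if it is in the interior of $\phi$ and not fixed by $V$. 8. Let $\phi^+$ be the half of $\phi$ consisting of the shapes whose reduced $\alpha$-coordinates satisfy $\alpha_1>\alpha_2$, together with one half of the cut $\alpha_1=\alpha_2$, including its midpoint: either the part with $\alpha_1=\alpha_2\ge0$ or the part with $\alpha_1=\alpha_2\le0$. For both choices, $\phi^+$ contains every unoriented shape exactly once, $\phi=\phi^+\cup V\phi^+$, and a shape in $\phi$ with $\alpha_1\neq\alpha_2$ lies in $\phi^+$ if and only if its angle sum $\sum\psi_i$ (representatives in $(-\pi,\pi]$) is positive. -/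

import Mathlib

open Real Set

noncomputable section

namespace EquilateralPentagon

/-! ### Labelled shapes

Vertices are indexed by `ZMod 5`, so that the vertex `z₅` is `z 0`. -/

/-- The closed pentagon with vertices `z` has all five edges of length one. -/
def IsEquilateral (z : ZMod 5 → ℂ) : Prop :=
  ∀ i, ‖z (i + 1) - z i‖ = 1

/-- The relative angle `ψ i = -Arg (-(z (i+1) - z i) / (z i - z (i-1)))`, modulo `2π`. -/
def relAngle (z : ZMod 5 → ℂ) (i : ZMod 5) : Real.Angle :=
  ((-Complex.arg (-((z (i + 1) - z i) / (z i - z (i - 1)))) : ℝ) : Real.Angle)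

/-- The labelled shape space: the tuples of relative angles of equilateral pentagons, as a
subspace of the torus. By `relAngle_eq_iff` below, its points are the labelled equilateral
pentagons up to orientation preserving rigid motions. -/
abbrev LabelledShape : Type :=
  {ψ : ZMod 5 → Real.Angle // ∃ z : ZMod 5 → ℂ, IsEquilateral z ∧ relAngle z = ψ}

theorem isEquilateral_sub_one {z : ZMod 5 → ℂ} (hz : IsEquilateral z) (i : ZMod 5) :
    ‖z i - z (i - 1)‖ = 1 := by
  have h := hz (i - 1)
  rwa [sub_add_cancel] at h

/-- Two equilateral pentagons have the same relative angles exactly if some orientation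
preserving rigid motion of the plane maps one to the other, respecting labels. -/
theorem relAngle_eq_iff {z w : ZMod 5 → ℂ} (hz : IsEquilateral z) (hw : IsEquilateral w) :
    relAngle z = relAngle w ↔ ∃ u v : ℂ, ‖u‖ = 1 ∧ ∀ i, w i = u * z i + v := by
  have hne : ∀ {x : ZMod 5 → ℂ}, IsEquilateral x → ∀ i, x (i + 1) - x i ≠ 0 := by
    intro x hx i h
    have := hx i
    rw [h] at this
    simp at this
  have hne' : ∀ {x : ZMod 5 → ℂ}, IsEquilateral x → ∀ i, x i - x (i - 1) ≠ 0 := by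
    intro x hx i h
    have := isEquilateral_sub_one hx i
    rw [h] at this
    simp at this
  have hconst : ∀ f : ZMod 5 → ℂ, (∀ i, f (i + 1) = f i) → ∀ i, f i = f 0 := by
    intro f hf i
    have h1 := hf 0
    have h2 := hf 1
    have h3 := hf 2
    have h4 := hf 3
    norm_num at h1 h2 h3 h4
    have e2 : (1 + 1 : ZMod 5) = 2 := by decide
    have e3 : (2 + 1 : ZMod 5) = 3 := by decide
    have e4 : (3 + 1 : ZMod 5) = 4 := by decide
    fin_cases i
    · rfl
    · exact h1
    · exact h2.trans h1
    · exact h3.trans (h2.trans h1)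
    · exact h4.trans (h3.trans (h2.trans h1))
  constructor
  · intro h
    have key : ∀ i, (z (i + 1) - z i) / (z i - z (i - 1))
        = (w (i + 1) - w i) / (w i - w (i - 1)) := by
      intro i
      have hi := congrFun h i
      unfold relAngle at hi
      rw [Real.Angle.coe_neg, Real.Angle.coe_neg, neg_inj, Complex.arg_coe_angle_eq_iff] at hi
      have hn : ‖-((z (i + 1) - z i) / (z i - z (i - 1)))‖
          = ‖-((w (i + 1) - w i) / (w i - w (i - 1)))‖ := by
        rw [norm_neg, norm_neg, norm_div, norm_div, hz i, hw i, isEquilateral_sub_one hz,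
          isEquilateral_sub_one hw]
      exact neg_injective (Complex.ext_norm_arg hn hi)
    have hq := hconst (fun i => (w i - w (i - 1)) / (z i - z (i - 1))) (by
      intro i
      have hk := key i
      have a := hne hz i
      have b := hne' hz i
      have c := hne' hw i
      show (w (i + 1) - w (i + 1 - 1)) / (z (i + 1) - z (i + 1 - 1))
        = (w i - w (i - 1)) / (z i - z (i - 1))
      rw [add_sub_cancel_right]
      rw [div_eq_div_iff b c] at hk
      rw [div_eq_div_iff a b]
      linear_combination -hk)
    set u := (w 0 - w (0 - 1)) / (z 0 - z (0 - 1)) with hu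
    have hstep : ∀ i, w (i + 1) - u * z (i + 1) = w i - u * z i := by
      intro i
      have h1 := hq (i + 1)
      simp only [add_sub_cancel_right] at h1
      rw [div_eq_iff (hne hz i)] at h1
      linear_combination h1
    refine ⟨u, w 0 - u * z 0, ?_, ?_⟩
    · rw [hu, norm_div, isEquilateral_sub_one hw, isEquilateral_sub_one hz, div_one]
    · intro i
      have := hconst (fun i => w i - u * z i) hstep i
      linear_combination this
  · rintro ⟨u, v, hu, h⟩
    have hu0 : u ≠ 0 := by
      rintro rfl
      simp at hu
    funext i
    unfold relAngle
    rw [h (i + 1), h i, h (i - 1)]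
    have e : (u * z (i + 1) + v - (u * z i + v)) / (u * z i + v - (u * z (i - 1) + v))
        = (z (i + 1) - z i) / (z i - z (i - 1)) := by
      rw [← mul_div_mul_left (z (i + 1) - z i) (z i - z (i - 1)) hu0]
      congr 1 <;> ring
    rw [e]

/-! ### Discrete symmetries -/

theorem relAngle_rot (z : ZMod 5 → ℂ) (k i : ZMod 5) :
    relAngle (fun j => z (j + k)) i = relAngle z (i + k) := by
  simp only [relAngle]
  rw [show i + 1 + k = i + k + 1 by ring, show i - 1 + k = i + k - 1 by ring]

theorem relAngle_refl (z : ZMod 5 → ℂ) (i : ZMod 5) :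
    relAngle (fun j => z (6 - j)) i = -relAngle z (6 - i) := by
  simp only [relAngle]
  rw [show (6 - (i + 1) : ZMod 5) = 6 - i - 1 by ring,
    show (6 - (i - 1) : ZMod 5) = 6 - i + 1 by ring, Real.Angle.coe_neg, Real.Angle.coe_neg,
    ← Complex.arg_inv_coe_angle, neg_neg, inv_neg, inv_div]
  congr 3
  rw [← neg_div_neg_eq, neg_sub, neg_sub]

theorem relAngle_mirror (z : ZMod 5 → ℂ) (i : ZMod 5) :
    relAngle (fun j => (starRingEnd ℂ) (z j)) i = -relAngle z i := by
  simp only [relAngle]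
  rw [Real.Angle.coe_neg, Real.Angle.coe_neg, ← Complex.arg_conj_coe_angle]
  simp

/-- The vertex rotation `R (z₁, …, z₅) = (z₂, z₃, z₄, z₅, z₁)`, in relative angles
`(R ψ) i = ψ (i + 1)`. -/
def vertexRot : Equiv.Perm LabelledShape where
  toFun s := ⟨fun i => s.1 (i + 1), by
    obtain ⟨z, hz, h⟩ := s.2
    refine ⟨fun j => z (j + 1), fun i => hz (i + 1), ?_⟩
    funext i
    rw [relAngle_rot, h]⟩
  invFun s := ⟨fun i => s.1 (i + -1), by
    obtain ⟨z, hz, h⟩ := s.2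
    refine ⟨fun j => z (j + -1), fun i => ?_, ?_⟩
    · have := hz (i + -1)
      rwa [add_right_comm] at this
    · funext i
      rw [relAngle_rot, h]⟩
  left_inv s := by
    apply Subtype.ext
    funext i
    simp
  right_inv s := by
    apply Subtype.ext
    funext i
    simp

/-- The vertex reflection `V (z₁, …, z₅) = (z₅, z₄, z₃, z₂, z₁)`, in relative angles
`(V ψ) i = -ψ (6 - i)`. -/
def vertexRefl : Equiv.Perm LabelledShape where
  toFun s := ⟨fun i => -s.1 (6 - i), by
    obtain ⟨z, hz, h⟩ := s.2
    refine ⟨fun j => z (6 - j), fun i => ?_, ?_⟩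
    · have := hz (6 - (i + 1))
      rw [show (6 - (i + 1) + 1 : ZMod 5) = 6 - i by ring, norm_sub_rev] at this
      exact this
    · funext i
      rw [relAngle_refl, h]⟩
  invFun s := ⟨fun i => -s.1 (6 - i), by
    obtain ⟨z, hz, h⟩ := s.2
    refine ⟨fun j => z (6 - j), fun i => ?_, ?_⟩
    · have := hz (6 - (i + 1))
      rw [show (6 - (i + 1) + 1 : ZMod 5) = 6 - i by ring, norm_sub_rev] at this
      exact this
    · funext i
      rw [relAngle_refl, h]⟩
  left_inv s := by
    apply Subtype.ext
    funext i
    simp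
  right_inv s := by
    apply Subtype.ext
    funext i
    simp

/-- The mirror reflection `M (z₁, …, z₅) = (conj z₁, …, conj z₅)`, in relative angles
`M ψ = -ψ`. -/
def mirror : Equiv.Perm LabelledShape where
  toFun s := ⟨fun i => -s.1 i, by
    obtain ⟨z, hz, h⟩ := s.2
    refine ⟨fun j => (starRingEnd ℂ) (z j), fun i => ?_, ?_⟩
    · rw [← map_sub, Complex.norm_conj]
      exact hz i
    · funext i
      rw [relAngle_mirror, h]⟩
  invFun s := ⟨fun i => -s.1 i, by
    obtain ⟨z, hz, h⟩ := s.2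
    refine ⟨fun j => (starRingEnd ℂ) (z j), fun i => ?_, ?_⟩
    · rw [← map_sub, Complex.norm_conj]
      exact hz i
    · funext i
      rw [relAngle_mirror, h]⟩
  left_inv s := by
    apply Subtype.ext
    funext i
    simp
  right_inv s := by
    apply Subtype.ext
    funext i
    simp

/-- The orientation preserving symmetry group `D₅⁺ = ⟨R, MV⟩`. -/
def D5plus : Subgroup (Equiv.Perm LabelledShape) :=
  Subgroup.closure {vertexRot, mirror * vertexRefl}

/-- The full discrete symmetry group `⟨R, V, M⟩`. -/
def D10 : Subgroup (Equiv.Perm LabelledShape) :=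
  Subgroup.closure {vertexRot, vertexRefl, mirror}

/-- The involution `R^k MV R^{-k}`. -/
def involution (k : ℕ) : Equiv.Perm LabelledShape :=
  vertexRot ^ k * (mirror * vertexRefl) * (vertexRot ^ k)⁻¹

/-- An (unlabelled) oriented shape: a labelled shape up to `D₅⁺`. -/
abbrev OrientedShape : Type := MulAction.orbitRel.Quotient D5plus LabelledShape

/-- An (unlabelled) unoriented shape: a labelled shape up to `⟨R, V, M⟩`. -/
abbrev UnorientedShape : Type := MulAction.orbitRel.Quotient D10 LabelledShape

/-- The oriented shape of a labelled shape. -/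
def toOriented (s : LabelledShape) : OrientedShape :=
  Quotient.mk (MulAction.orbitRel D5plus LabelledShape) s

/-- The unoriented shape of a labelled shape. -/
def toUnoriented (s : LabelledShape) : UnorientedShape :=
  Quotient.mk (MulAction.orbitRel D10 LabelledShape) s

/-! ### Special shapes -/

/-- All relative angles are equal to `θ`: a regular pentagram for `θ = ±π/5`, a regular convex
pentagon for `θ = ±3π/5`. -/
def HasConstAngle (s : LabelledShape) (θ : ℝ) : Prop :=
  ∀ i, s.1 i = (θ : Real.Angle)

/-- The pentagrams and the regular convex pentagons, of either orientation. -/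
def IsRegular (s : LabelledShape) : Prop :=
  HasConstAngle s (π / 5) ∨ HasConstAngle s (-(π / 5)) ∨
    HasConstAngle s (3 * π / 5) ∨ HasConstAngle s (-(3 * π / 5))

/-- Up to a power of `R` the relative angles are `(ψ₁, ψ₂, ψ₃, ψ₂, ψ₁)`. -/
def IsReflectionSymmetric (s : LabelledShape) : Prop :=
  ∃ k : ℕ, ((vertexRot ^ k) s).1 1 = ((vertexRot ^ k) s).1 5 ∧ ((vertexRot ^ k) s).1 2 = ((vertexRot ^ k) s).1 4

/-! ### The coordinates `α` -/

/-- `(a₁, a₂, a₃)` are `α`-coordinates of `s`, that is (modulo `2π`)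
`ψ₂ = -(a₂ - π) - a₃`, `ψ₃ = -a₁ + (a₂ - π)`, `ψ₄ = -(a₂ - π) + a₃`. -/
def HasAlpha (s : LabelledShape) (a₁ a₂ a₃ : ℝ) : Prop :=
  s.1 2 = ((-(a₂ - π) - a₃ : ℝ) : Real.Angle) ∧
  s.1 3 = ((-a₁ + (a₂ - π) : ℝ) : Real.Angle) ∧
  s.1 4 = ((-(a₂ - π) + a₃ : ℝ) : Real.Angle)

/-- The `α`-coordinates normalized by `a₁, a₂ ∈ (-π, π]` and `a₃ ∈ (0, π]`. -/
def HasReducedAlpha (s : LabelledShape) (a₁ a₂ a₃ : ℝ) : Prop :=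
  HasAlpha s a₁ a₂ a₃ ∧ a₁ ∈ Ioc (-π) π ∧ a₂ ∈ Ioc (-π) π ∧ a₃ ∈ Ioc 0 π

/-! ### Symmetry curves and regions -/

/-- The symmetry curve `R^k {α₃ = 0}`. -/
def symCurve (k : ℕ) : Set LabelledShape :=
  ⇑(vertexRot ^ k) '' {s | ∃ a₁ a₂ : ℝ, HasAlpha s a₁ a₂ 0}

/-- The complement of the five symmetry curves. -/
def offCurves : Set LabelledShape :=
  (⋃ k ∈ Finset.range 5, symCurve k)ᶜ

/-- The regions into which the symmetry curves cut the labelled shape space. -/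
def regions : Set (Set LabelledShape) :=
  {C | ∃ s ∈ offCurves, C = connectedComponentIn offCurves s}

/-- The second coordinate of the quarter `b₁` of the basic symmetry curve. -/
def bHeight (t : ℝ) : ℝ :=
  arccos (-(1 / 8) * (3 + 4 * cos t) * (1 / cos (t / 2)) ^ 2)

/-- The quarter `b₁` of the curve `α₃ = 0`, with both end points. -/
def b₁ : Set LabelledShape :=
  {s | ∃ t ∈ Icc (-(2 * π / 5)) (4 * π / 5), HasAlpha s t (bHeight t) 0}

/-- The quarter `b₂`: `b₁` turned by `-π/2` in the plane `α₃ = 0`. -/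
def b₂ : Set LabelledShape :=
  {s | ∃ t ∈ Icc (-(2 * π / 5)) (4 * π / 5), HasAlpha s (bHeight t) (-t) 0}

/-- The quarter `b₃`: `b₁` turned by `π` in the plane `α₃ = 0`. -/
def b₃ : Set LabelledShape :=
  {s | ∃ t ∈ Icc (-(2 * π / 5)) (4 * π / 5), HasAlpha s (-t) (-bHeight t) 0}

/-- The quarter `b₄`: `b₁` turned by `π/2` in the plane `α₃ = 0`. -/
def b₄ : Set LabelledShape :=
  {s | ∃ t ∈ Icc (-(2 * π / 5)) (4 * π / 5), HasAlpha s (-bHeight t) t 0}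

/-- `φ` is a closed region of the subdivision by the symmetry curves, bounded by the four arcs
`R(b₄)`, `R³(b₁)`, `R⁴(b₂)`, `R²(b₃)`. -/
def IsBoundedByArcs (φ : Set LabelledShape) : Prop :=
  (∃ C ∈ regions, φ = closure C) ∧
    frontier φ = ⇑(vertexRot ^ 1) '' b₄ ∪ ⇑(vertexRot ^ 3) '' b₁ ∪ ⇑(vertexRot ^ 4) '' b₂ ∪ ⇑(vertexRot ^ 2) '' b₃

/-- The half `α₁ ≥ α₂` of `φ`, with only the part `σ α₁ ≥ 0` of the cut `α₁ = α₂`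
(`σ = ±1` selects which of the two halves of the cut is kept). -/
def halfRegion (φ : Set LabelledShape) (σ : ℝ) : Set LabelledShape :=
  {s | s ∈ φ ∧ ∃ a₁ a₂ a₃ : ℝ, HasReducedAlpha s a₁ a₂ a₃ ∧
    (a₂ < a₁ ∨ a₁ = a₂ ∧ 0 ≤ σ * a₁)}

/-- The angle sum `∑ ψ i`, with representatives `ψ i ∈ (-π, π]`. -/
def angleSum (s : LabelledShape) : ℝ :=
  ∑ i, (s.1 i).toReal

end EquilateralPentagon

end

open Real Set

noncomputable section

namespace EquilateralPentagon

/-! ### Labelled shapes in terms of edge directions -/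

/-! Put x = α₁ + α₂ and y = α₁ - α₂. In α-coordinates the four edges other than the one from z₅ to
z₁ pair up: the two edges at z₃ add to a vector of length 2|cos (y/2)|, the other two to one of
length 2|cos (x/2)|, and α₃ measures the angle between the sums. The fifth edge has length one, so
the pentagon closes exactly when a law of cosines holds (`HasAlpha.equation`). Hence, with α₃
normalized to (0, π], a shape is determined by (x, y) wherever cos (x/2) cos (y/2) ≠ 0
(`eq_of_planeCoord_eq`). Over the set `lens`, which is cut out by triangle inequalities, `ofPlane`
is a continuous section.

The fundamental region is drawn in this plane. Its sides are graphs built from `kap`, where cos (kap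
t) = -1 / (4 cos (t/2)); the equation 1 + 4 cos w cos h = 0 is the closing condition of a reflection
symmetric pentagon (`five_cos`). `cell` and `tile` are the shapes over the open and the closed
quadrilateral. The planar work shows that the sides meet only in the corners (`arc_lt_strict`), that
the quadrilateral lies in the lens (`abs_cos_sub_cos_le`), and that its interior is contractible, by
a shear onto the axis x = 0 followed by shrinking. These estimates are delicate because adjacent
sides are tangent at the corners (`slope_mul`).

The topology then goes as follows. `cell` is open, connected and disjoint from the five symmetry
curves, its closure `tile` is compact, and `tile` minus `cell` lies on the curves. So each g(`cell`)
is a component of the complement (`connectedComponentIn_offCurves`). If g(`cell`) meets `cell` the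
two coincide, so g maps `center` into `cell`, which explicit values exclude unless g = 1
(`eq_one_of_map_center`). For covering, consider the union `tiled` of all images of `tile`. It is
closed. Near a non-regular point of a side every shape lies in `tile` or in its reflection across
that side (`eventually_mem_tile_or`), so `tiled` is a neighbourhood of each of its non-regular
points. The shapes over the open lens form a connected set without regular shapes, hence lie in
`tiled`. A generic shape, or its image under MV, lies over the open lens. In the exceptional shapes
two edges cancel and the other three form an equilateral triangle; a rotation of labels makes them
generic. The local picture along the sides also gives uniqueness of representatives
(`eq_one_or_eq_involution`, `map_eq_of_mem_tile`).

Isotropy is elementary: a nontrivial rotation, or two different reflections, force all angles to be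
equal, and then the angle sum and the closing condition leave the four regular shapes. V acts on the
plane as -1, so it fixes only the shape over the origin, and a half plane y > 0 with half of the
line y = 0 represents unoriented shapes. For y ≠ 0 the angle sum is an odd multiple of π, and
excluding bad wraps of ψ₅ + ψ₁ (`wrap_sum`) shows that its sign is that of y. -/

theorem exists_directions (s : LabelledShape) : ∃ β : ZMod 5 → Real.Angle,
    (∀ φ : Real.Angle, ∑ i, (β i + φ).cos = 0) ∧ ∀ i, s.1 i = β (i - 1) - β i + (π : ℝ) := by
  obtain ⟨z, hz, h⟩ := s.2
  have hne : ∀ i, z (i + 1) - z i ≠ 0 := fun i h0 => by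
    have := hz i
    rw [h0] at this
    simp at this
  refine ⟨fun i => ((z (i + 1) - z i).arg : ℝ), fun φ => ?_, fun i => ?_⟩
  · have key : ∀ i, (((z (i + 1) - z i).arg : Real.Angle) + φ).cos
        = ((z (i + 1) - z i) * (φ.toCircle : ℂ)).re := by
      intro i
      rw [Real.Angle.cos_add, Real.Angle.coe_toCircle, Complex.mul_re, Real.Angle.cos_coe,
        Real.Angle.sin_coe, Complex.cos_arg (hne i), Complex.sin_arg, hz i]
      simp
    simp only [key]
    rw [← Complex.re_sum, ← Finset.sum_mul]
    have : ∑ i, (z (i + 1) - z i) = 0 := by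
      rw [Finset.sum_sub_distrib, sub_eq_zero]
      exact Equiv.sum_comp (Equiv.addRight (1 : ZMod 5)) z
    rw [this]
    simp
  · rw [← h]
    simp only [relAngle]
    have h1 := hne (i - 1)
    rw [sub_add_cancel] at h1 ⊢
    have e : -((z (i + 1) - z i) / (z i - z (i - 1)))
        = (z (i + 1) - z i) * ((z i - z (i - 1))⁻¹ * (-1)) := by
      field_simp
    rw [Real.Angle.coe_neg, e, Complex.arg_mul_coe_angle (hne i) (by simpa using h1),
      Complex.arg_mul_coe_angle (by simpa using h1) (by norm_num), Complex.arg_inv_coe_angle,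
      Complex.arg_neg_one]
    rw [neg_add, neg_add, neg_neg, Real.Angle.neg_coe_pi]
    abel

/-- The vertices are partial sums of the unit vectors with directions β. The family of real
conditions says that every projection of the edge sum vanishes; φ = 0 and φ = π/2 recover its real
and imaginary part. -/
theorem exists_pentagon {β : ZMod 5 → Real.Angle}
    (hβ : ∀ φ : Real.Angle, ∑ i, (β i + φ).cos = 0) :
    ∃ z : ZMod 5 → ℂ, IsEquilateral z ∧
      relAngle z = fun i => β (i - 1) - β i + ((π : ℝ) : Real.Angle) := by
  set e : ZMod 5 → ℂ := fun i => ((β i).toCircle : ℂ) with he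
  have hsum : ∑ i, e i = 0 := by
    apply Complex.ext
    · rw [Complex.re_sum, Complex.zero_re, ← hβ 0]
      refine Finset.sum_congr rfl fun i _ => ?_
      simp [he, Real.Angle.coe_toCircle]
    · rw [Complex.im_sum, Complex.zero_im, ← neg_zero, ← hβ (π / 2 : ℝ), ← Finset.sum_neg_distrib]
      refine Finset.sum_congr rfl fun i _ => ?_
      simp [he, Real.Angle.coe_toCircle, Real.Angle.cos_add_pi_div_two]
  have hsum' : e 0 + e 1 + e 2 + e 3 + e 4 = 0 := by
    rw [← hsum]
    exact (Fin.sum_univ_five e).symm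
  set z : ZMod 5 → ℂ :=
    (![0, e 0, e 0 + e 1, e 0 + e 1 + e 2, e 0 + e 1 + e 2 + e 3] : Fin 5 → ℂ) with hz
  have hstep : ∀ i, z (i + 1) - z i = e i := by
    intro i
    fin_cases i
    · show e 0 - 0 = e 0
      ring
    · show e 0 + e 1 - e 0 = e 1
      ring
    · show e 0 + e 1 + e 2 - (e 0 + e 1) = e 2
      ring
    · show e 0 + e 1 + e 2 + e 3 - (e 0 + e 1 + e 2) = e 3
      ring
    · show 0 - (e 0 + e 1 + e 2 + e 3) = e 4
      linear_combination -hsum'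
  refine ⟨z, fun i => ?_, funext fun i => ?_⟩
  · rw [hstep]
    exact Circle.norm_coe _
  · have h1 := hstep (i - 1)
    rw [sub_add_cancel] at h1
    have e1 : -(e i / e (i - 1)) = ((β i - β (i - 1) + (π : ℝ)).toCircle : ℂ) := by
      rw [Real.Angle.toCircle_add, sub_eq_add_neg (β i), Real.Angle.toCircle_add,
        Real.Angle.toCircle_neg]
      simp [he, div_eq_mul_inv]
    simp only [relAngle]
    rw [hstep, h1, e1, Real.Angle.coe_neg, Real.Angle.arg_toCircle, neg_add, neg_sub,
      Real.Angle.neg_coe_pi]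

/-- The labelled shape with edge directions `β`. -/
def ofDirections (β : ZMod 5 → Real.Angle) (hβ : ∀ φ : Real.Angle, ∑ i, (β i + φ).cos = 0) :
    LabelledShape :=
  ⟨fun i => β (i - 1) - β i + ((π : ℝ) : Real.Angle), exists_pentagon hβ⟩

theorem sum_univ_zmod_five {M : Type*} [AddCommMonoid M] (f : ZMod 5 → M) :
    ∑ i, f i = f 0 + f 1 + f 2 + f 3 + f 4 :=
  Fin.sum_univ_five f

theorem forall_zmod_five {P : ZMod 5 → Prop} (h0 : P 0) (h1 : P 1) (h2 : P 2) (h3 : P 3)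
    (h4 : P 4) : ∀ i, P i := by
  intro i
  fin_cases i <;> assumption

theorem directions_apply {s : LabelledShape} {β : ZMod 5 → Real.Angle}
    (h : ∀ i, s.1 i = β (i - 1) - β i + (π : ℝ)) :
    s.1 0 = β 4 - β 0 + (π : ℝ) ∧ s.1 1 = β 0 - β 1 + (π : ℝ) ∧ s.1 2 = β 1 - β 2 + (π : ℝ) ∧
      s.1 3 = β 2 - β 3 + (π : ℝ) ∧ s.1 4 = β 3 - β 4 + (π : ℝ) :=
  ⟨h 0, h 1, h 2, h 3, h 4⟩

/-- The direction differences telescope around the pentagon, leaving 5π, which is π modulo 2π. -/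
theorem sum_relAngle (s : LabelledShape) :
    s.1 0 + s.1 1 + s.1 2 + s.1 3 + s.1 4 = ((π : ℝ) : Real.Angle) := by
  obtain ⟨β, -, h⟩ := exists_directions s
  obtain ⟨h0, h1, h2, h3, h4⟩ := directions_apply h
  have hp := Real.Angle.coe_pi_add_coe_pi
  rw [h0, h1, h2, h3, h4]
  linear_combination (norm := module) (2 : ℤ) • hp

/-- The edge vectors of a closed pentagon add up to zero. -/
theorem closing (s : LabelledShape) (φ : Real.Angle) :
    φ.cos - (φ + s.1 2).cos + (φ + s.1 2 + s.1 3).cos - (φ + s.1 2 + s.1 3 + s.1 4).cos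
      - (φ - s.1 1).cos = 0 := by
  obtain ⟨β, hβ, h⟩ := exists_directions s
  obtain ⟨h0, h1, h2, h3, h4⟩ := directions_apply h
  have hp := Real.Angle.coe_pi_add_coe_pi
  have := hβ (-φ - β 1)
  rw [sum_univ_zmod_five] at this
  have e1 : (β 1 + (-φ - β 1)).cos = φ.cos := by
    rw [← Real.Angle.cos_neg]; congr 1; abel
  have e2 : (β 2 + (-φ - β 1)).cos = -(φ + s.1 2).cos := by
    rw [← Real.Angle.cos_neg, ← Real.Angle.cos_add_pi, h2]; congr 1
    linear_combination (norm := module) -hp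
  have e3 : (β 3 + (-φ - β 1)).cos = (φ + s.1 2 + s.1 3).cos := by
    rw [← Real.Angle.cos_neg, h2, h3]; congr 1
    linear_combination (norm := module) -hp
  have e4 : (β 4 + (-φ - β 1)).cos = -(φ + s.1 2 + s.1 3 + s.1 4).cos := by
    rw [← Real.Angle.cos_neg, ← Real.Angle.cos_add_pi, h2, h3, h4]; congr 1
    linear_combination (norm := module) (-2 : ℤ) • hp
  have e0 : (β 0 + (-φ - β 1)).cos = -(φ - s.1 1).cos := by
    rw [← Real.Angle.cos_neg, ← Real.Angle.cos_add_pi, h1]; congr 1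
    abel
  rw [e0, e1, e2, e3, e4] at this
  linarith

/-! ### The coordinates `α` -/

/-- The edges pair up into two vectors of signed lengths 2 cos ((a₁ - a₂) / 2) and 2 cos ((a₁ + a₂)
/ 2), enclosing the angle a₃. Together they balance the fifth, unit edge; x is the direction onto
which this is projected. -/
theorem HasAlpha.cos_closing {s : LabelledShape} {a₁ a₂ a₃ : ℝ} (h : HasAlpha s a₁ a₂ a₃) (x : ℝ) :
    2 * cos ((a₁ - a₂) / 2) * cos x + 2 * cos ((a₁ + a₂) / 2) * cos (x + a₃)
      = ((((a₁ + a₂) / 2 + a₃ + x : ℝ) : Real.Angle) - s.1 1).cos := by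
  obtain ⟨h2, h3, h4⟩ := h
  have := closing s (((a₁ + a₂) / 2 + a₃ + x : ℝ))
  rw [h2, h3, h4] at this
  simp only [← Real.Angle.coe_add, Real.Angle.cos_coe] at this
  have e1 : cos ((a₁ + a₂) / 2 + a₃ + x + (-(a₂ - π) - a₃)) = -cos ((a₁ - a₂) / 2 + x) := by
    rw [← cos_add_pi]; congr 1; ring
  have e2 : cos ((a₁ + a₂) / 2 + a₃ + x + (-(a₂ - π) - a₃) + (-a₁ + (a₂ - π)))
      = cos (x - (a₁ - a₂) / 2) := by
    congr 1; ring
  have e3 : cos ((a₁ + a₂) / 2 + a₃ + x + (-(a₂ - π) - a₃) + (-a₁ + (a₂ - π)) + (-(a₂ - π) + a₃))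
      = - cos (x + a₃ - (a₁ + a₂) / 2) := by
    rw [← cos_add_pi]; congr 1; ring
  have e4 : cos ((a₁ + a₂) / 2 + a₃ + x) = cos (x + a₃ + (a₁ + a₂) / 2) := by
    congr 1; ring
  rw [e1, e2, e3, e4] at this
  rw [← sub_eq_zero, ← this, cos_add _ x, cos_sub x, cos_add (x + a₃), cos_sub (x + a₃)]
  ring

/-- The law of cosines for the triangle formed by the two pair sums and the fifth edge: square and
add two orthogonal projections. -/
theorem HasAlpha.equation {s : LabelledShape} {a₁ a₂ a₃ : ℝ} (h : HasAlpha s a₁ a₂ a₃) :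
    4 * (cos ((a₁ + a₂) / 2) ^ 2 + cos ((a₁ - a₂) / 2) ^ 2
      + 2 * cos ((a₁ + a₂) / 2) * cos ((a₁ - a₂) / 2) * cos a₃) = 1 := by
  have k0 := h.cos_closing 0
  have k1 := h.cos_closing (π / 2)
  rw [add_zero] at k0
  rw [Real.Angle.coe_add _ (π / 2), add_sub_right_comm, Real.Angle.cos_add_pi_div_two, cos_pi_div_two,
    add_comm (π / 2), cos_add_pi_div_two] at k1
  rw [cos_zero, zero_add] at k0
  have h1 := Real.Angle.cos_sq_add_sin_sq ((((a₁ + a₂) / 2 + a₃ : ℝ) : Real.Angle) - s.1 1)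
  rw [← k0, ← neg_sq (Real.Angle.sin _), ← k1] at h1
  have h5 := sin_sq_add_cos_sq a₃
  linear_combination h1 - 4 * cos ((a₁ + a₂) / 2) ^ 2 * h5

/-- The fourth relative angles determine the shape: `ψ 5` and `ψ 1` follow from the others. -/
theorem HasAlpha.unique {s t : LabelledShape} {a₁ a₂ a₃ : ℝ} (h : HasAlpha s a₁ a₂ a₃)
    (h' : HasAlpha t a₁ a₂ a₃) : s = t := by
  obtain ⟨h2, h3, h4⟩ := h
  obtain ⟨h2', h3', h4'⟩ := h'
  have e2 := h2.trans h2'.symm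
  have e3 := h3.trans h3'.symm
  have e4 := h4.trans h4'.symm
  have key : ∀ φ : Real.Angle, (φ - s.1 1).cos = (φ - t.1 1).cos := by
    intro φ
    have a := closing s φ
    have b := closing t φ
    rw [e2, e3, e4] at a
    linarith
  have e1 : s.1 1 = t.1 1 := by
    have := key (s.1 1)
    rw [sub_self, Real.Angle.cos_zero] at this
    have h2 : (s.1 1 - t.1 1).cos = (0 : Real.Angle).cos := by rw [← this, Real.Angle.cos_zero]
    rcases Real.Angle.cos_eq_iff_eq_or_eq_neg.1 h2 with h | h
    · exact sub_eq_zero.1 h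
    · rw [neg_zero] at h
      exact sub_eq_zero.1 h
  have e0 : s.1 0 = t.1 0 := by
    have a := sum_relAngle s
    rw [← sum_relAngle t, e1, e2, e3, e4] at a
    simpa using a
  exact Subtype.ext (funext (forall_zmod_five e0 e1 e2 e3 e4))

/-- The shapes with given `α`-coordinates satisfying the closing condition. -/
abbrev AlphaSurface : Type :=
  {p : ℝ × ℝ × ℝ // 4 * (cos ((p.1 + p.2.1) / 2) ^ 2 + cos ((p.1 - p.2.1) / 2) ^ 2
      + 2 * cos ((p.1 + p.2.1) / 2) * cos ((p.1 - p.2.1) / 2) * cos p.2.2) = 1}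

/-- The sum of the first four edges, in the normalization used by `alphaDirections`. -/
def alphaSum (p : ℝ × ℝ × ℝ) : ℂ :=
  ⟨2 * cos ((p.1 - p.2.1) / 2) + 2 * cos ((p.1 + p.2.1) / 2) * cos p.2.2,
    -(2 * cos ((p.1 + p.2.1) / 2) * sin p.2.2)⟩

theorem norm_alphaSum (p : AlphaSurface) : ‖alphaSum p.1‖ = 1 := by
  obtain ⟨⟨a₁, a₂, a₃⟩, h⟩ := p
  have : ‖alphaSum (a₁, a₂, a₃)‖ ^ 2 = 1 := by
    rw [← Complex.normSq_eq_norm_sq, Complex.normSq_apply]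
    simp only [alphaSum]
    simp only at h
    have h5 := sin_sq_add_cos_sq a₃
    linear_combination h + 4 * cos ((a₁ + a₂) / 2) ^ 2 * h5
  exact (pow_eq_one_iff_of_nonneg (norm_nonneg _) two_ne_zero).1 this

/-- Edge directions of the shape with given `α`-coordinates. -/
def alphaDirections (p : ℝ × ℝ × ℝ) : ZMod 5 → Real.Angle :=
  (![((-alphaSum p).arg : ℝ), ((-((p.1 + p.2.1) / 2) - p.2.2 : ℝ) : Real.Angle),
    ((-((p.1 - p.2.1) / 2) : ℝ) : Real.Angle), (((p.1 - p.2.1) / 2 : ℝ) : Real.Angle),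
    (((p.1 + p.2.1) / 2 - p.2.2 : ℝ) : Real.Angle)] : Fin 5 → Real.Angle)

theorem sum_cos_alphaDirections (p : AlphaSurface) (φ : Real.Angle) :
    ∑ i, (alphaDirections p.1 i + φ).cos = 0 := by
  have hn := norm_alphaSum p
  obtain ⟨⟨a₁, a₂, a₃⟩, h⟩ := p
  simp only at hn
  have h0 : -alphaSum (a₁, a₂, a₃) ≠ 0 := by
    rw [neg_ne_zero]
    intro h0
    rw [h0] at hn
    simp at hn
  rw [sum_univ_zmod_five]
  show ((((-alphaSum (a₁, a₂, a₃)).arg : ℝ) : Real.Angle) + φ).cos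
    + (((-((a₁ + a₂) / 2) - a₃ : ℝ) : Real.Angle) + φ).cos
    + (((-((a₁ - a₂) / 2) : ℝ) : Real.Angle) + φ).cos
    + ((((a₁ - a₂) / 2 : ℝ) : Real.Angle) + φ).cos
    + ((((a₁ + a₂) / 2 - a₃ : ℝ) : Real.Angle) + φ).cos = 0
  simp only [Real.Angle.cos_add, Real.Angle.cos_coe, Real.Angle.sin_coe]
  rw [Complex.cos_arg h0, Complex.sin_arg, norm_neg, hn]
  simp only [cos_sub, sin_sub, cos_neg, sin_neg, alphaSum, Complex.neg_re, Complex.neg_im]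
  ring

/-- The shape with given `α`-coordinates. -/
def ofAlpha (p : AlphaSurface) : LabelledShape :=
  ofDirections (alphaDirections p.1) (sum_cos_alphaDirections p)

theorem hasAlpha_ofAlpha (p : AlphaSurface) : HasAlpha (ofAlpha p) p.1.1 p.1.2.1 p.1.2.2 := by
  obtain ⟨⟨a₁, a₂, a₃⟩, h⟩ := p
  have hp := Real.Angle.coe_pi_add_coe_pi
  refine ⟨?_, ?_, ?_⟩
  · show ((-((a₁ + a₂) / 2) - a₃ : ℝ) : Real.Angle) - ((-((a₁ - a₂) / 2) : ℝ) : Real.Angle)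
      + (π : ℝ) = _
    rw [← Real.Angle.coe_sub, ← Real.Angle.coe_add]
    congr 1; ring
  · show ((-((a₁ - a₂) / 2) : ℝ) : Real.Angle) - (((a₁ - a₂) / 2 : ℝ) : Real.Angle) + (π : ℝ) = _
    rw [← Real.Angle.coe_sub, ← sub_eq_zero, ← Real.Angle.coe_add, ← Real.Angle.coe_sub,
      ← Real.Angle.coe_two_pi]
    congr 1; ring
  · show (((a₁ - a₂) / 2 : ℝ) : Real.Angle) - (((a₁ + a₂) / 2 - a₃ : ℝ) : Real.Angle) + (π : ℝ) = _
    rw [← Real.Angle.coe_sub, ← Real.Angle.coe_add]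
    congr 1; ring

/-- The only critical direction is that of the fifth edge; the argument modulo 2π is continuous away
from 0, and that edge has norm one. -/
theorem continuous_ofAlpha : Continuous ofAlpha := by
  refine Continuous.subtype_mk (continuous_pi fun i => ?_) _
  have hβ : ∀ i, Continuous fun p : AlphaSurface => alphaDirections p.1 i := by
    refine forall_zmod_five ?_ ?_ ?_ ?_ ?_
    · show Continuous fun p : AlphaSurface => (((-alphaSum p.1).arg : ℝ) : Real.Angle)
      rw [continuous_iff_continuousAt]
      intro p
      have h0 : -alphaSum p.1 ≠ 0 := by
        rw [neg_ne_zero]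
        intro h0
        have hn := norm_alphaSum p
        rw [h0] at hn
        simp at hn
      refine ContinuousAt.comp (f := fun p : AlphaSurface => -alphaSum p.1)
        (g := fun z : ℂ => ((z.arg : ℝ) : Real.Angle)) (Complex.continuousAt_arg_coe_angle h0) ?_
      have : Continuous fun p : AlphaSurface => alphaSum p.1 := by
        have : (fun p : AlphaSurface => alphaSum p.1) = fun p : AlphaSurface =>
            ((2 * cos ((p.1.1 - p.1.2.1) / 2)
              + 2 * cos ((p.1.1 + p.1.2.1) / 2) * cos p.1.2.2 : ℝ) : ℂ)
            + ((-(2 * cos ((p.1.1 + p.1.2.1) / 2) * sin p.1.2.2) : ℝ) : ℂ) * Complex.I := by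
          funext p
          exact (Complex.mk_eq_add_mul_I _ _)
        rw [this]
        fun_prop
      exact this.neg.continuousAt
    all_goals
      refine Real.Angle.continuous_coe.comp ?_
      fun_prop
  exact ((hβ _).sub (hβ _)).add continuous_const

/-! ### Reduced `α`-coordinates -/

/-- The reduced coordinate `α₃`. -/
def red₃ (s : LabelledShape) : ℝ := ((s.1 4 - s.1 2 + ((π : ℝ) : Real.Angle)).toReal + π) / 2

/-- The reduced coordinate `α₂`. -/
def red₂ (s : LabelledShape) : ℝ := (((π - red₃ s : ℝ) : Real.Angle) - s.1 2).toReal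

/-- The reduced coordinate `α₁`. -/
def red₁ (s : LabelledShape) : ℝ := (((red₂ s - π : ℝ) : Real.Angle) - s.1 3).toReal

/-- Since ψ₄ - ψ₂ = 2α₃, the coordinate α₃ is fixed only modulo π, whence the range (0, π]; then ψ₂
fixes α₂ and ψ₃ fixes α₁, each modulo 2π. -/
theorem hasReducedAlpha_red (s : LabelledShape) :
    HasReducedAlpha s (red₁ s) (red₂ s) (red₃ s) := by
  have h2 : ((red₂ s : ℝ) : Real.Angle) = ((π - red₃ s : ℝ) : Real.Angle) - s.1 2 :=
    Real.Angle.coe_toReal _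
  have h1 : ((red₁ s : ℝ) : Real.Angle) = ((red₂ s - π : ℝ) : Real.Angle) - s.1 3 :=
    Real.Angle.coe_toReal _
  have h3 : ((2 * red₃ s : ℝ) : Real.Angle) = s.1 4 - s.1 2 := by
    have : 2 * red₃ s = (s.1 4 - s.1 2 + ((π : ℝ) : Real.Angle)).toReal + π := by
      simp only [red₃]; ring
    rw [this, Real.Angle.coe_add, Real.Angle.coe_toReal, add_assoc, Real.Angle.coe_pi_add_coe_pi,
      add_zero]
  have e2 : s.1 2 = ((-(red₂ s - π) - red₃ s : ℝ) : Real.Angle) := by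
    rw [show -(red₂ s - π) - red₃ s = (π - red₃ s) - red₂ s by ring, Real.Angle.coe_sub, h2]
    abel
  refine ⟨⟨e2, ?_, ?_⟩, Real.Angle.toReal_mem_Ioc _, Real.Angle.toReal_mem_Ioc _, ?_⟩
  · rw [Real.Angle.coe_add, Real.Angle.coe_neg, h1]
    abel
  · rw [show -(red₂ s - π) + red₃ s = (-(red₂ s - π) - red₃ s) + 2 * red₃ s by ring,
      Real.Angle.coe_add, ← e2, h3]
    abel
  · obtain ⟨ha, hb⟩ := Real.Angle.toReal_mem_Ioc (s.1 4 - s.1 2 + ((π : ℝ) : Real.Angle))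
    simp only [red₃]
    constructor <;> linarith

theorem eq_of_coe_eq_of_mem_Ioc {x y : ℝ} (h : (x : Real.Angle) = y) (hx : x ∈ Ioc (-π) π)
    (hy : y ∈ Ioc (-π) π) : x = y := by
  rw [← Real.Angle.toReal_coe_eq_self_iff_mem_Ioc.2 hx, h,
    Real.Angle.toReal_coe_eq_self_iff_mem_Ioc.2 hy]

theorem HasReducedAlpha.eq_red {s : LabelledShape} {a₁ a₂ a₃ : ℝ}
    (h : HasReducedAlpha s a₁ a₂ a₃) : a₁ = red₁ s ∧ a₂ = red₂ s ∧ a₃ = red₃ s := by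
  obtain ⟨⟨e2, e3, e4⟩, h1, h2, h3⟩ := h
  obtain ⟨⟨f2, f3, f4⟩, g1, g2, g3⟩ := hasReducedAlpha_red s
  have k3 : a₃ = red₃ s := by
    have hd : ((2 * a₃ - π : ℝ) : Real.Angle) = ((2 * red₃ s - π : ℝ) : Real.Angle) := by
      have u1 : ((2 * a₃ - π : ℝ) : Real.Angle) = s.1 4 - s.1 2 - (π : ℝ) := by
        rw [e2, e4, ← Real.Angle.coe_sub, ← Real.Angle.coe_sub]
        congr 1; ring
      have u2 : ((2 * red₃ s - π : ℝ) : Real.Angle) = s.1 4 - s.1 2 - (π : ℝ) := by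
        rw [f2, f4, ← Real.Angle.coe_sub, ← Real.Angle.coe_sub]
        congr 1; ring
      rw [u1, u2]
    have := eq_of_coe_eq_of_mem_Ioc hd ⟨by linarith [h3.1], by linarith [h3.2]⟩
      ⟨by linarith [g3.1], by linarith [g3.2]⟩
    linarith
  have k2 : a₂ = red₂ s := by
    refine eq_of_coe_eq_of_mem_Ioc ?_ h2 g2
    rw [e2, k3] at f2
    rw [← sub_eq_zero, ← Real.Angle.coe_sub] at f2 ⊢
    rw [← neg_eq_zero, ← Real.Angle.coe_neg, ← f2]
    congr 1; ring
  refine ⟨?_, k2, k3⟩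
  refine eq_of_coe_eq_of_mem_Ioc ?_ h1 g1
  rw [e3, k2] at f3
  rw [← sub_eq_zero, ← Real.Angle.coe_sub] at f3 ⊢
  rw [← neg_eq_zero, ← Real.Angle.coe_neg, ← f3]
  congr 1; ring

theorem eq_of_red_eq {s t : LabelledShape} (h1 : red₁ s = red₁ t) (h2 : red₂ s = red₂ t)
    (h3 : red₃ s = red₃ t) : s = t := by
  refine (hasReducedAlpha_red s).1.unique ?_
  rw [h1, h2, h3]
  exact (hasReducedAlpha_red t).1

theorem continuousAt_toReal {θ : Real.Angle} (h : θ ≠ (π : ℝ)) :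
    ContinuousAt Real.Angle.toReal θ := by
  have e : Real.Angle.toReal = fun θ : Real.Angle => ((θ.cos : ℂ) + θ.sin * Complex.I).arg := by
    funext θ
    rw [← Real.Angle.coe_toCircle]
    nth_rewrite 1 [← Real.Angle.arg_toCircle θ]
    exact Real.Angle.toReal_coe_eq_self_iff_mem_Ioc.2 (Complex.arg_mem_Ioc _)
  rw [e]
  refine ContinuousAt.comp (g := Complex.arg)
    (f := fun θ : Real.Angle => (θ.cos : ℂ) + θ.sin * Complex.I) (Complex.continuousAt_arg ?_) ?_
  · rw [Complex.mem_slitPlane_iff]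
    by_cases hs : θ.sin = 0
    · rcases Real.Angle.sin_eq_zero_iff.1 hs with h0 | h0
      · left
        simp [h0]
      · exact absurd h0 h
    · right
      simpa using hs
  · have h1 := Real.Angle.continuous_cos
    have h2 := Real.Angle.continuous_sin
    exact ((Complex.continuous_ofReal.comp h1).add
      ((Complex.continuous_ofReal.comp h2).mul continuous_const)).continuousAt

theorem continuous_eval (i : ZMod 5) : Continuous fun s : LabelledShape => s.1 i :=
  (continuous_apply i).comp continuous_subtype_val

/-- Representatives jump only at the upper end of their interval, so each reduced coordinate is
continuous where it, and those it is computed from, stay below π. -/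
theorem continuousAt_red₃ {s : LabelledShape} (h : red₃ s < π) : ContinuousAt red₃ s := by
  have h' : (s.1 4 - s.1 2 + ((π : ℝ) : Real.Angle)) ≠ (π : ℝ) := by
    intro h0
    simp only [red₃, h0, Real.Angle.toReal_pi] at h
    linarith
  have := ContinuousAt.comp (g := Real.Angle.toReal)
    (f := fun s : LabelledShape => s.1 4 - s.1 2 + ((π : ℝ) : Real.Angle)) (continuousAt_toReal h')
    (((continuous_eval 4).sub (continuous_eval 2)).add continuous_const).continuousAt
  exact (this.add continuousAt_const).div_const 2

theorem continuousAt_red₂ {s : LabelledShape} (h : red₃ s < π) (h2 : red₂ s < π) :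
    ContinuousAt red₂ s := by
  have h' : ((π - red₃ s : ℝ) : Real.Angle) - s.1 2 ≠ (π : ℝ) := by
    intro h0
    simp only [red₂, h0, Real.Angle.toReal_pi] at h2
    linarith
  exact ContinuousAt.comp (g := Real.Angle.toReal)
    (f := fun s : LabelledShape => ((π - red₃ s : ℝ) : Real.Angle) - s.1 2)
    (continuousAt_toReal h')
    ((Real.Angle.continuous_coe.continuousAt.comp
      (continuousAt_const.sub (continuousAt_red₃ h))).sub (continuous_eval 2).continuousAt)

theorem continuousAt_red₁ {s : LabelledShape} (h : red₃ s < π) (h2 : red₂ s < π)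
    (h1 : red₁ s < π) : ContinuousAt red₁ s := by
  have h' : ((red₂ s - π : ℝ) : Real.Angle) - s.1 3 ≠ (π : ℝ) := by
    intro h0
    simp only [red₁, h0, Real.Angle.toReal_pi] at h1
    linarith
  exact ContinuousAt.comp (g := Real.Angle.toReal)
    (f := fun s : LabelledShape => ((red₂ s - π : ℝ) : Real.Angle) - s.1 3)
    (continuousAt_toReal h')
    ((Real.Angle.continuous_coe.continuousAt.comp
      ((continuousAt_red₂ h h2).sub continuousAt_const)).sub (continuous_eval 3).continuousAt)

end EquilateralPentagon

/-! ### Dihedral subgroups -/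

section Dihedral

variable {G : Type*} [Group G] {n : ℕ} [NeZero n] {r s : G}

theorem pow_val_add (hr : r ^ n = 1) (i j : ZMod n) :
    r ^ (i + j).val = r ^ i.val * r ^ j.val := by
  rw [ZMod.val_add, ← pow_add, ← pow_eq_pow_mod _ hr]

theorem pow_val_neg (hr : r ^ n = 1) (i : ZMod n) : r ^ (-i).val = (r ^ i.val)⁻¹ := by
  rw [eq_inv_iff_mul_eq_one, ← pow_val_add hr, neg_add_cancel, ZMod.val_zero, pow_zero]

theorem pow_mul_reflection (hsr : s * r = r⁻¹ * s) (k : ℕ) : s * r ^ k = (r ^ k)⁻¹ * s := by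
  induction k with
  | zero => simp
  | succ k ih =>
    rw [pow_succ, ← mul_assoc, ih, mul_assoc, hsr, ← pow_succ, pow_succ', mul_inv_rev, mul_assoc]

/-- The homomorphism from a dihedral group given by a rotation and a reflection. -/
def dihedralHom (hr : r ^ n = 1) (hs : s ^ 2 = 1) (hsr : s * r = r⁻¹ * s) :
    DihedralGroup n →* G where
  toFun
    | .r i => r ^ i.val
    | .sr i => s * r ^ i.val
  map_one' := by
    rw [DihedralGroup.one_def]
    simp
  map_mul' x y := by
    have h1 := pow_val_add hr
    have h2 := pow_val_neg hr
    have h3 := pow_mul_reflection hsr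
    have hs' : s * s = 1 := by rw [← pow_two, hs]
    rcases x with i | i <;> rcases y with j | j
    · exact h1 i j
    · show s * r ^ (j - i).val = r ^ i.val * (s * r ^ j.val)
      rw [sub_eq_add_neg, add_comm, h1, ← mul_assoc, h3 (-i).val, h2, inv_inv, mul_assoc]
    · show s * r ^ (i + j).val = s * r ^ i.val * r ^ j.val
      rw [h1, mul_assoc]
    · show r ^ (j - i).val = s * r ^ i.val * (s * r ^ j.val)
      rw [sub_eq_add_neg, add_comm, h1, h2, ← mul_assoc (s * _), h3, mul_assoc _ s s, hs', mul_one]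

theorem range_dihedralHom (hn : 1 < n) (hr : r ^ n = 1) (hs : s ^ 2 = 1)
    (hsr : s * r = r⁻¹ * s) :
    (dihedralHom hr hs hsr).range = Subgroup.closure {r, s} := by
  have : Fact (1 < n) := ⟨hn⟩
  apply le_antisymm
  · rintro _ ⟨i | i, rfl⟩
    · exact pow_mem (Subgroup.subset_closure (by simp)) _
    · exact mul_mem (Subgroup.subset_closure (by simp))
        (pow_mem (Subgroup.subset_closure (by simp)) _)
  · rw [Subgroup.closure_le]
    rintro x (rfl | rfl)
    · refine ⟨.r 1, ?_⟩
      show x ^ (1 : ZMod n).val = x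
      rw [ZMod.val_one, pow_one]
    · refine ⟨.sr 0, ?_⟩
      show x * r ^ (0 : ZMod n).val = x
      rw [ZMod.val_zero, pow_zero, mul_one]

/-- The relations give a surjection from the dihedral group; the last two hypotheses say that its
kernel is trivial. -/
theorem nonempty_closure_mulEquiv_dihedralGroup (hn : 1 < n) (hr : r ^ n = 1) (hs : s ^ 2 = 1)
    (hsr : s * r = r⁻¹ * s) (h1 : ∀ k, 0 < k → k < n → r ^ k ≠ 1)
    (h2 : ∀ k < n, s * r ^ k ≠ 1) :
    Nonempty (Subgroup.closure {r, s} ≃* DihedralGroup n) := by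
  rw [← range_dihedralHom hn hr hs hsr]
  refine ⟨(MonoidHom.ofInjective ((injective_iff_map_eq_one _).2 ?_)).symm⟩
  rintro (i | i) h
  · by_contra h0
    refine h1 i.val (Nat.pos_of_ne_zero fun hi => h0 ?_) (ZMod.val_lt i) h
    rw [(ZMod.val_eq_zero i).1 hi, DihedralGroup.r_zero]
  · exact absurd h (h2 i.val (ZMod.val_lt i))

theorem mem_closure_dihedral (hn : 1 < n) (hr : r ^ n = 1) (hs : s ^ 2 = 1)
    (hsr : s * r = r⁻¹ * s) {g : G} (hg : g ∈ Subgroup.closure {r, s}) :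
    ∃ k < n, g = r ^ k ∨ g = s * r ^ k := by
  rw [← range_dihedralHom hn hr hs hsr] at hg
  obtain ⟨i | i, rfl⟩ := hg
  · exact ⟨i.val, ZMod.val_lt i, Or.inl rfl⟩
  · exact ⟨i.val, ZMod.val_lt i, Or.inr rfl⟩

end Dihedral

namespace EquilateralPentagon

/-! ### Action on indices and relations between R, V and M -/

theorem vertexRot_pow_apply (k : ℕ) (s : LabelledShape) (i : ZMod 5) :
    ((vertexRot ^ k) s).1 i = s.1 (i + k) := by
  induction k generalizing i with
  | zero => simp
  | succ k ih =>
    rw [pow_succ', Equiv.Perm.mul_apply]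
    show ((vertexRot ^ k) s).1 (i + 1) = _
    rw [ih]
    push_cast
    ring_nf

theorem mirror_apply (s : LabelledShape) (i : ZMod 5) : (mirror s).1 i = -s.1 i := rfl

theorem vertexRefl_apply (s : LabelledShape) (i : ZMod 5) :
    (vertexRefl s).1 i = -s.1 (6 - i) := rfl

theorem vertexRot_apply (s : LabelledShape) (i : ZMod 5) : (vertexRot s).1 i = s.1 (i + 1) := rfl

theorem mirror_mul_vertexRefl_apply (s : LabelledShape) (i : ZMod 5) :
    ((mirror * vertexRefl) s).1 i = s.1 (6 - i) := by
  rw [Equiv.Perm.mul_apply, mirror_apply, vertexRefl_apply, neg_neg]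

theorem shape_ext {s t : LabelledShape} (h : ∀ i, s.1 i = t.1 i) : s = t :=
  Subtype.ext (funext h)

theorem perm_ext {g h : Equiv.Perm LabelledShape} (H : ∀ s i, (g s).1 i = (h s).1 i) : g = h :=
  Equiv.ext fun s => shape_ext (H s)

theorem vertexRot_pow_five : vertexRot ^ 5 = 1 :=
  perm_ext fun s i => by
    rw [vertexRot_pow_apply, show ((5 : ℕ) : ZMod 5) = 0 by decide, add_zero]
    rfl

theorem mirror_sq : mirror * mirror = 1 :=
  perm_ext fun s i => by
    rw [Equiv.Perm.mul_apply, mirror_apply, mirror_apply, neg_neg]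
    rfl

theorem vertexRefl_sq : vertexRefl * vertexRefl = 1 :=
  perm_ext fun s i => by
    rw [Equiv.Perm.mul_apply, vertexRefl_apply, vertexRefl_apply, neg_neg, sub_sub_cancel]
    rfl

theorem vertexRefl_vertexRefl (s : LabelledShape) : vertexRefl (vertexRefl s) = s := by
  rw [← Equiv.Perm.mul_apply, vertexRefl_sq]
  rfl

theorem mirror_comm_vertexRot : mirror * vertexRot = vertexRot * mirror :=
  perm_ext fun _ _ => rfl

theorem axial_sq : (mirror * vertexRefl) ^ 2 = 1 :=
  perm_ext fun s i => by
    rw [pow_two, Equiv.Perm.mul_apply, mirror_mul_vertexRefl_apply, mirror_mul_vertexRefl_apply,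
      sub_sub_cancel]
    rfl

theorem axial_mul_vertexRot :
    (mirror * vertexRefl) * vertexRot = vertexRot⁻¹ * (mirror * vertexRefl) := by
  rw [eq_inv_mul_iff_mul_eq]
  refine perm_ext fun s i => ?_
  rw [Equiv.Perm.mul_apply, Equiv.Perm.mul_apply, vertexRot_apply, mirror_mul_vertexRefl_apply,
    vertexRot_apply, mirror_mul_vertexRefl_apply]
  ring_nf

theorem vertexRot_pow_inv_apply (k : ℕ) (s : LabelledShape) (i : ZMod 5) :
    ((vertexRot ^ k)⁻¹ s).1 i = s.1 (i - k) := by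
  have h := vertexRot_pow_apply k ((vertexRot ^ k)⁻¹ s) (i - k)
  rw [← Equiv.Perm.mul_apply, mul_inv_cancel, Equiv.Perm.one_apply, sub_add_cancel] at h
  exact h.symm

theorem involution_apply (k : ℕ) (s : LabelledShape) (i : ZMod 5) :
    (involution k s).1 i = s.1 (1 - i - 2 * k) := by
  rw [involution, Equiv.Perm.mul_apply, Equiv.Perm.mul_apply, vertexRot_pow_apply,
    mirror_mul_vertexRefl_apply, vertexRot_pow_inv_apply]
  rw [show (6 : ZMod 5) = 1 by decide]
  ring_nf

theorem involution_involution (k : ℕ) (s : LabelledShape) : involution k (involution k s) = s :=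
  shape_ext fun i => by
    rw [involution_apply, involution_apply]
    ring_nf

/-! ### Regular shapes -/

/-- The angle sum gives 5θ = π modulo 2π, which has five solutions; four of them are regular. -/
theorem isRegular_of_forall_eq {s : LabelledShape} (h : ∀ i, s.1 i = s.1 0) : IsRegular s := by
  have hs := sum_relAngle s
  rw [h 1, h 2, h 3, h 4] at hs
  have h5 : (5 : ℕ) • s.1 0 = (5 : ℕ) • ((π / 5 : ℝ) : Real.Angle) := by
    rw [← Real.Angle.coe_nsmul, nsmul_eq_mul, show ((5 : ℕ) : ℝ) * (π / 5) = π by push_cast; ring,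
      ← hs]
    abel
  obtain ⟨k, hk⟩ := (Real.Angle.nsmul_eq_iff (by norm_num)).1 h5
  rw [← Real.Angle.coe_nsmul, ← Real.Angle.coe_add] at hk
  have hmod : ∀ x y : ℝ, x = y + 2 * π → (x : Real.Angle) = y := by
    rintro x y rfl
    rw [Real.Angle.coe_add, Real.Angle.coe_two_pi, add_zero]
  fin_cases k
  · refine Or.inl fun i => ?_
    rw [h i, hk]
    congr 1; simp
  · refine Or.inr (Or.inr (Or.inl fun i => ?_))
    rw [h i, hk]
    congr 1; simp; ring
  -- The fifth solution θ = π would make all edges parallel, so their sum would have length 5.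
  · exfalso
    have hk' : s.1 0 = (π : ℝ) := by
      rw [hk]
      congr 1; simp; ring
    have := closing s 0
    rw [h 1, h 2, h 3, h 4, hk'] at this
    simp only [zero_add, zero_sub, Real.Angle.coe_pi_add_coe_pi, Real.Angle.cos_neg,
      Real.Angle.cos_coe_pi, Real.Angle.cos_zero] at this
    norm_num at this
  · refine Or.inr (Or.inr (Or.inr fun i => ?_))
    rw [h i, hk]
    refine hmod _ _ ?_
    simp; ring
  · refine Or.inr (Or.inl fun i => ?_)
    rw [h i, hk]
    refine hmod _ _ ?_
    simp; ring

/-- Five is prime, so multiples of c reach every index and all angles agree. -/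
theorem isRegular_of_shift {s : LabelledShape} {c : ZMod 5} (hc : c ≠ 0)
    (h : ∀ i, s.1 (i + c) = s.1 i) : IsRegular s := by
  have h2 : ∀ n : ℕ, s.1 (n * c) = s.1 0 := by
    intro n
    induction n with
    | zero => simp
    | succ n ih =>
      rw [← ih, ← h (n * c)]
      push_cast
      ring_nf
  refine isRegular_of_forall_eq fun i => ?_
  have hc' : ∃ n : ℕ, (n : ZMod 5) * c = i := by
    have : Fact (Nat.Prime 5) := ⟨by norm_num⟩
    refine ⟨(i / c).val, ?_⟩
    rw [ZMod.natCast_zmod_val]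
    exact div_mul_cancel₀ _ hc
  obtain ⟨n, rfl⟩ := hc'
  exact h2 n

theorem IsRegular.eq_const {s : LabelledShape} (h : IsRegular s) (i j : ZMod 5) :
    s.1 i = s.1 j := by
  rcases h with h | h | h | h <;> rw [h i, h j]

theorem natCast_zmod_five_inj {k l : ℕ} (hk : k < 5) (hl : l < 5) (h : (k : ZMod 5) = l) :
    k = l := by
  have := congrArg ZMod.val h
  rwa [ZMod.val_cast_of_lt hk, ZMod.val_cast_of_lt hl] at this

/-- The product of two different reflections is a nontrivial rotation, since 2 is invertible modulo
5. -/
theorem isRegular_of_two_involutions {s : LabelledShape} {k l : ℕ} (hk : k < 5) (hl : l < 5)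
    (hkl : k ≠ l) (h1 : involution k s = s) (h2 : involution l s = s) : IsRegular s := by
  refine isRegular_of_shift (c := 2 * (l - k)) ?_ fun i => ?_
  · intro h0
    apply hkl
    apply natCast_zmod_five_inj hk hl
    have : (3 * (2 * ((l : ZMod 5) - k))) = 0 := by rw [h0, mul_zero]
    rw [← mul_assoc, show (3 * 2 : ZMod 5) = 1 by decide, one_mul] at this
    exact (sub_eq_zero.1 this).symm
  · have a := involution_apply k s (i + 2 * (l - k))
    have b := involution_apply l s i
    rw [h1] at a
    rw [h2] at b
    rw [a, b]
    ring_nf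

/-- The directions are the multiples of the turning angle η = π - θ, written symmetrically as 0, ±η,
±2η so that the sine parts cancel and only `hc` remains. -/
theorem exists_hasConstAngle {θ : ℝ} (h5 : ((5 * (π - θ) : ℝ) : Real.Angle) = 0)
    (hc : 1 + 2 * cos (π - θ) + 2 * cos (2 * (π - θ)) = 0) : ∃ s, HasConstAngle s θ := by
  set η : ℝ := π - θ with hη
  set β : ZMod 5 → Real.Angle := (![0, (η : Real.Angle), ((2 * η : ℝ) : Real.Angle),
    ((-(2 * η) : ℝ) : Real.Angle), ((-η : ℝ) : Real.Angle)] : Fin 5 → Real.Angle) with hβ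
  have hsum : ∀ φ : Real.Angle, ∑ i, (β i + φ).cos = 0 := by
    intro φ
    rw [sum_univ_zmod_five]
    show ((0 : Real.Angle) + φ).cos + ((η : Real.Angle) + φ).cos
      + (((2 * η : ℝ) : Real.Angle) + φ).cos + (((-(2 * η) : ℝ) : Real.Angle) + φ).cos
      + (((-η : ℝ) : Real.Angle) + φ).cos = 0
    rw [zero_add]
    simp only [Real.Angle.cos_add, Real.Angle.cos_coe, Real.Angle.sin_coe, cos_neg, sin_neg]
    linear_combination φ.cos * hc
  have hθ : (θ : Real.Angle) = ((π - η : ℝ) : Real.Angle) := by rw [hη]; congr 1; ring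
  refine ⟨ofDirections β hsum, fun i => ?_⟩
  rw [hθ]
  revert i
  refine forall_zmod_five ?_ ?_ ?_ ?_ ?_
  · show ((-η : ℝ) : Real.Angle) - 0 + (π : ℝ) = _
    rw [sub_zero, ← Real.Angle.coe_add]
    congr 1; ring
  · show 0 - (η : Real.Angle) + (π : ℝ) = _
    rw [zero_sub, ← Real.Angle.coe_neg, ← Real.Angle.coe_add]
    congr 1; ring
  · show (η : Real.Angle) - ((2 * η : ℝ) : Real.Angle) + (π : ℝ) = _
    rw [← Real.Angle.coe_sub, ← Real.Angle.coe_add]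
    congr 1; ring
  · show ((2 * η : ℝ) : Real.Angle) - ((-(2 * η) : ℝ) : Real.Angle) + (π : ℝ) = _
    rw [← Real.Angle.coe_sub, ← Real.Angle.coe_add, ← sub_eq_zero, ← Real.Angle.coe_sub, ← h5]
    congr 1; ring
  · show ((-(2 * η) : ℝ) : Real.Angle) - ((-η : ℝ) : Real.Angle) + (π : ℝ) = _
    rw [← Real.Angle.coe_sub, ← Real.Angle.coe_add]
    congr 1; ring

theorem cos_two_pi_div_five : cos (2 * π / 5) = (√5 - 1) / 4 := by
  rw [show 2 * π / 5 = 2 * (π / 5) by ring, cos_two_mul, cos_pi_div_five]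
  have := Real.sq_sqrt (show (0 : ℝ) ≤ 5 by norm_num)
  linear_combination this / 8

theorem cos_three_pi_div_five : cos (3 * π / 5) = -((√5 - 1) / 4) := by
  rw [← cos_two_pi_div_five, ← cos_pi_sub]
  congr 1; ring

theorem cos_four_pi_div_five : cos (4 * π / 5) = -((1 + √5) / 4) := by
  rw [← cos_pi_div_five, ← cos_pi_sub]
  congr 1; ring

theorem HasConstAngle.mirror {s : LabelledShape} {θ : ℝ} (h : HasConstAngle s θ) :
    HasConstAngle (mirror s) (-θ) := fun i => by
  rw [mirror_apply, h i, Real.Angle.coe_neg]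

theorem exists_const_three : ∃ s, HasConstAngle s (3 * π / 5) := by
  refine exists_hasConstAngle ?_ ?_
  · rw [← Real.Angle.coe_two_pi]
    congr 1; ring
  · rw [show π - 3 * π / 5 = 2 * π / 5 by ring, cos_two_pi_div_five,
      show 2 * (2 * π / 5) = 4 * π / 5 by ring, cos_four_pi_div_five]
    ring

theorem exists_const_one : ∃ s, HasConstAngle s (π / 5) := by
  refine exists_hasConstAngle ?_ ?_
  · rw [show 5 * (π - π / 5) = 2 * π + 2 * π by ring, Real.Angle.coe_add, Real.Angle.coe_two_pi,
      add_zero]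
  · rw [show π - π / 5 = 4 * π / 5 by ring, cos_four_pi_div_five,
      show 2 * (4 * π / 5) = 2 * π - 2 * π / 5 by ring, cos_two_pi_sub, cos_two_pi_div_five]
    ring

theorem exists_const_neg_three : ∃ s, HasConstAngle s (-(3 * π / 5)) :=
  let ⟨s, h⟩ := exists_const_three
  ⟨mirror s, h.mirror⟩

theorem exists_const_neg_one : ∃ s, HasConstAngle s (-(π / 5)) :=
  let ⟨s, h⟩ := exists_const_one
  ⟨mirror s, h.mirror⟩

/-! ### The groups `D₅⁺` and `D₁₀` -/

/-- This involution acts on indices by i ↦ 1 - i - 2k: it fixes 3 - k and swaps the two pairs named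
here. -/
theorem involution_eq_self_iff {k : ℕ} {s : LabelledShape} :
    involution k s = s ↔ s.1 (1 - k) = s.1 (5 - k) ∧ s.1 (2 - k) = s.1 (4 - k) := by
  constructor
  · intro h
    have h1 := involution_apply k s (1 - k)
    have h2 := involution_apply k s (2 - k)
    rw [h] at h1 h2
    rw [h1, h2, show (5 : ZMod 5) = 0 by decide, show (4 : ZMod 5) = -1 by decide]
    constructor <;> ring_nf
  · rintro ⟨h1, h2⟩
    have key : ∀ i, (involution k s).1 (i - k) = s.1 (i - k) := by
      intro i
      rw [involution_apply, show 1 - (i - k) - 2 * (k : ZMod 5) = (1 - i) - k by ring]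
      revert i
      refine forall_zmod_five ?_ ?_ ?_ ?_ ?_
      · rw [sub_zero, h1]; rfl
      · rw [sub_self, h1]; rfl
      · rw [h2]; rfl
      · rfl
      · rw [← h2]; rfl
    refine shape_ext fun i => ?_
    have := key (i + k)
    rwa [add_sub_cancel_right] at this

theorem isReflectionSymmetric_iff {s : LabelledShape} :
    IsReflectionSymmetric s ↔ ∃ k < 5, involution k s = s := by
  constructor
  · rintro ⟨k, h1, h2⟩
    refine ⟨(-(k : ZMod 5)).val, ZMod.val_lt _, ?_⟩
    simp only [vertexRot_pow_apply] at h1 h2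
    rw [involution_eq_self_iff, ZMod.natCast_zmod_val, sub_neg_eq_add, sub_neg_eq_add,
      sub_neg_eq_add, sub_neg_eq_add]
    exact ⟨h1, h2⟩
  · rintro ⟨k, -, h⟩
    refine ⟨(-(k : ZMod 5)).val, ?_⟩
    rw [involution_eq_self_iff] at h
    simp only [vertexRot_pow_apply, ZMod.natCast_zmod_val, ← sub_eq_add_neg]
    exact h

theorem involution_mem (k : ℕ) : involution k ∈ D5plus := by
  have h1 : vertexRot ∈ D5plus := Subgroup.subset_closure (by simp)
  have h2 : mirror * vertexRefl ∈ D5plus := Subgroup.subset_closure (by simp)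
  exact mul_mem (mul_mem (pow_mem h1 k) h2) (inv_mem (pow_mem h1 k))

/-- For odd order all reflections of a dihedral group are conjugate. The exponent l must satisfy -2l
= k modulo 5, that is l = 2k. -/
theorem axial_mul_pow_eq_involution (k : ℕ) :
    ∃ l < 5, mirror * vertexRefl * vertexRot ^ k = involution l := by
  refine ⟨(2 * (k : ZMod 5)).val, ZMod.val_lt _, perm_ext fun s i => ?_⟩
  rw [Equiv.Perm.mul_apply, mirror_mul_vertexRefl_apply, vertexRot_pow_apply, involution_apply,
    ZMod.natCast_zmod_val, ← mul_assoc, show (2 * 2 : ZMod 5) = -1 by decide,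
    show (6 : ZMod 5) = 1 by decide]
  ring_nf

theorem mem_D5plus_cases {g : Equiv.Perm LabelledShape} (hg : g ∈ D5plus) :
    (∃ k < 5, g = vertexRot ^ k) ∨ ∃ k < 5, g = involution k := by
  obtain ⟨k, hk, rfl | rfl⟩ := mem_closure_dihedral (by norm_num) vertexRot_pow_five axial_sq
    axial_mul_vertexRot hg
  · exact Or.inl ⟨k, hk, rfl⟩
  · exact Or.inr (axial_mul_pow_eq_involution k)

theorem eq_one_or_involution_of_fixed {g : Equiv.Perm LabelledShape} (hg : g ∈ D5plus)
    {s : LabelledShape} (hs : ¬ IsRegular s) (h : g s = s) :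
    g = 1 ∨ ∃ k < 5, g = involution k := by
  rcases mem_D5plus_cases hg with ⟨k, hk, rfl⟩ | h'
  · left
    by_contra h0
    refine hs (isRegular_of_shift (c := k) (fun hk0 => h0 ?_) fun i => ?_)
    · rw [natCast_zmod_five_inj hk (by norm_num) (hk0.trans Nat.cast_zero.symm), pow_zero]
    · rw [← vertexRot_pow_apply, h]
  · exact Or.inr h'

/-- The shape with `α`-coordinates `(0, 0, π - arccos (7 / 8))`. -/
def center : LabelledShape :=
  ofAlpha ⟨(0, 0, π - arccos (7 / 8)), by
    simp only [add_zero, sub_zero, zero_div, cos_zero, cos_pi_sub]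
    rw [cos_arccos (by norm_num) (by norm_num)]
    norm_num⟩

theorem hasAlpha_center : HasAlpha center 0 0 (π - arccos (7 / 8)) := hasAlpha_ofAlpha _

theorem center_relAngle : center.1 2 = (arccos (7 / 8) : ℝ) ∧ center.1 3 = (π : ℝ) ∧
    center.1 4 = ((-arccos (7 / 8) : ℝ) : Real.Angle) ∧ center.1 1 + center.1 0 = 0 := by
  obtain ⟨h2, h3, h4⟩ := hasAlpha_center
  have e2 : center.1 2 = (arccos (7 / 8) : ℝ) := by rw [h2]; congr 1; ring
  have e3 : center.1 3 = (π : ℝ) := by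
    rw [h3, ← Real.Angle.neg_coe_pi, ← Real.Angle.coe_neg]; congr 1; ring
  have e4 : center.1 4 = ((-arccos (7 / 8) : ℝ) : Real.Angle) := by
    rw [h4, show -(0 - π) + (π - arccos (7 / 8)) = 2 * π + -arccos (7 / 8) by ring,
      Real.Angle.coe_add, Real.Angle.coe_two_pi, zero_add]
  refine ⟨e2, e3, e4, ?_⟩
  have h := sum_relAngle center
  rw [e2, e3, e4, Real.Angle.coe_neg] at h
  rw [← sub_eq_zero] at h
  rw [← h]
  abel

theorem sin_arccos_seven_eighths_pos : 0 < sin (arccos (7 / 8)) := by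
  rw [sin_arccos]
  exact Real.sqrt_pos.2 (by norm_num)

theorem arccos_ne_pi : ((arccos (7 / 8) : ℝ) : Real.Angle) ≠ (π : ℝ) := by
  intro h
  have := congrArg Real.Angle.sin h
  rw [Real.Angle.sin_coe, Real.Angle.sin_coe, sin_pi] at this
  exact sin_arccos_seven_eighths_pos.ne' this

theorem neg_arccos_ne_pi : ((-arccos (7 / 8) : ℝ) : Real.Angle) ≠ (π : ℝ) := by
  intro h
  have := congrArg Real.Angle.sin h
  rw [Real.Angle.sin_coe, Real.Angle.sin_coe, sin_pi, sin_neg, neg_eq_zero] at this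
  exact sin_arccos_seven_eighths_pos.ne' this

theorem center_not_isRegular : ¬ IsRegular center := fun h => by
  obtain ⟨h2, h3, -, -⟩ := center_relAngle
  exact arccos_ne_pi (h2.symm.trans ((h.eq_const 2 3).trans h3))

/-- With δ = arccos (7/8), the angles here satisfy ψ₂ = δ, ψ₃ = π, ψ₄ = -δ and ψ₁ + ψ₅ = 0; each
symmetry would force δ or -δ to equal π, or δ = -δ. This shape serves as the free point which shows
that group elements are nontrivial. -/
theorem center_not_fixed {k : ℕ} (hk : k < 5) : involution k center ≠ center := by
  obtain ⟨h2, h3, h4, h10⟩ := center_relAngle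
  intro h
  obtain ⟨a, b⟩ := involution_eq_self_iff.1 h
  interval_cases k
  · have b' : center.1 2 = center.1 4 := b
    rw [h2, h4] at b'
    have := congrArg Real.Angle.sin b'
    rw [Real.Angle.sin_coe, Real.Angle.sin_coe, sin_neg] at this
    linarith [sin_arccos_seven_eighths_pos]
  · have a' : center.1 0 = center.1 4 := a
    have b' : center.1 1 = center.1 3 := b
    rw [b', h3, a', h4, ← Real.Angle.neg_coe_pi, neg_add_eq_zero] at h10
    exact neg_arccos_ne_pi h10.symm
  · have a' : center.1 4 = center.1 3 := a
    rw [h3, h4] at a'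
    exact neg_arccos_ne_pi a'
  · have a' : center.1 3 = center.1 2 := a
    rw [h3, h2] at a'
    exact arccos_ne_pi a'.symm
  · have a' : center.1 2 = center.1 1 := a
    have b' : center.1 3 = center.1 0 := b
    rw [← b', h3, ← a', h2, ← Real.Angle.neg_coe_pi, add_neg_eq_zero] at h10
    exact arccos_ne_pi h10

theorem involution_ne_one {k : ℕ} (hk : k < 5) : involution k ≠ 1 := fun h =>
  center_not_fixed hk (by rw [h]; rfl)

theorem vertexRot_pow_ne_one {k : ℕ} (h0 : 0 < k) (hk : k < 5) : vertexRot ^ k ≠ 1 := fun h =>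
  center_not_isRegular <| isRegular_of_shift (c := k)
    (fun hk0 => h0.ne' (natCast_zmod_five_inj hk (by norm_num) (hk0.trans Nat.cast_zero.symm)))
    fun i => by rw [← vertexRot_pow_apply, h]; rfl

theorem involution_injOn {k l : ℕ} (hk : k < 5) (hl : l < 5) (h : involution k = involution l) :
    k = l := by
  by_contra hkl
  refine center_not_isRegular (isRegular_of_shift (c := 2 * (l - k)) ?_ fun i => ?_)
  · intro h0
    apply hkl
    apply natCast_zmod_five_inj hk hl
    have : (3 * (2 * ((l : ZMod 5) - k))) = 0 := by rw [h0, mul_zero]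
    rw [← mul_assoc, show (3 * 2 : ZMod 5) = 1 by decide, one_mul] at this
    exact (sub_eq_zero.1 this).symm
  · have a := involution_apply k center (1 - i - 2 * l)
    have b := involution_apply l center (1 - i - 2 * l)
    rw [h, b] at a
    rw [show 1 - (1 - i - 2 * (l : ZMod 5)) - 2 * l = i by ring] at a
    rw [a]
    ring_nf

theorem nonempty_D5plus_mulEquiv : Nonempty (D5plus ≃* DihedralGroup 5) := by
  refine nonempty_closure_mulEquiv_dihedralGroup (by norm_num) vertexRot_pow_five axial_sq
    axial_mul_vertexRot (fun k h0 hk => vertexRot_pow_ne_one h0 hk) fun k _ => ?_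
  obtain ⟨l, hl, h⟩ := axial_mul_pow_eq_involution k
  rw [h]
  exact involution_ne_one hl

/-- M is central of order two and R has odd order, so MR generates both: (MR)⁵ = M. This exhibits a
rotation of order 10 together with the reflection V. -/
theorem D10_eq : D10 = Subgroup.closure {mirror * vertexRot, vertexRefl} := by
  have hM : mirror * mirror = 1 := mirror_sq
  have hc : Commute mirror vertexRot := mirror_comm_vertexRot
  apply le_antisymm
  · have h1 : mirror * vertexRot ∈ Subgroup.closure {mirror * vertexRot, vertexRefl} :=
      Subgroup.subset_closure (by simp)
    have h2 : vertexRefl ∈ Subgroup.closure {mirror * vertexRot, vertexRefl} :=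
      Subgroup.subset_closure (by simp)
    have h3 : mirror ∈ Subgroup.closure {mirror * vertexRot, vertexRefl} := by
      have h5 := pow_mem h1 5
      rwa [hc.mul_pow, vertexRot_pow_five, mul_one, show mirror ^ 5 = mirror * mirror *
        (mirror * mirror) * mirror by simp only [pow_succ, pow_zero, one_mul, mul_assoc], hM, one_mul, one_mul] at h5
    rw [D10, Subgroup.closure_le]
    rintro x (rfl | rfl | rfl)
    · have := mul_mem h3 h1
      rwa [← mul_assoc, hM, one_mul] at this
    · exact h2
    · exact h3
  · rw [Subgroup.closure_le]
    rintro x (rfl | rfl)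
    · exact mul_mem (Subgroup.subset_closure (by simp)) (Subgroup.subset_closure (by simp))
    · exact Subgroup.subset_closure (by simp)

theorem mirror_mul_vertexRot_pow (k : ℕ) (s : LabelledShape) (i : ZMod 5) :
    (((mirror * vertexRot) ^ k) s).1 i = (-1 : ℤ) ^ k • s.1 (i + k) := by
  have hc : Commute mirror vertexRot := mirror_comm_vertexRot
  rw [hc.mul_pow, Equiv.Perm.mul_apply]
  have : ∀ t : LabelledShape, ((mirror ^ k) t).1 i = (-1 : ℤ) ^ k • t.1 i := by
    intro t
    induction k with
    | zero => simp
    | succ k ih =>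
      rw [pow_succ', Equiv.Perm.mul_apply, mirror_apply, ih, pow_succ, mul_neg_one, neg_smul]
  rw [this, vertexRot_pow_apply]

theorem vertexRefl_mul_vertexRot :
    vertexRefl * (mirror * vertexRot) = (mirror * vertexRot)⁻¹ * vertexRefl := by
  rw [eq_inv_mul_iff_mul_eq]
  refine perm_ext fun s i => ?_
  show -(-(-s.1 (6 - (i + 1) + 1))) = -s.1 (6 - i)
  rw [neg_neg]
  ring_nf

theorem const_one_ne_neg {s : LabelledShape} (h : HasConstAngle s (π / 5)) (i j : ZMod 5) :
    -s.1 i ≠ s.1 j := by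
  rw [h i, h j]
  intro h
  have := congrArg Real.Angle.sin h
  rw [Real.Angle.sin_neg, Real.Angle.sin_coe] at this
  have : 0 < sin (π / 5) := sin_pos_of_pos_of_lt_pi (by positivity) (by linarith [pi_pos])
  linarith

/-- Nontriviality is tested on two shapes. Elements that negate the angles move the pentagram with θ
= π/5; the others lie in D₅⁺ and move `center`. -/
theorem nonempty_D10_mulEquiv : Nonempty (D10 ≃* DihedralGroup 10) := by
  rw [D10_eq]
  obtain ⟨p, hp⟩ := exists_const_one
  refine nonempty_closure_mulEquiv_dihedralGroup (by norm_num) ?_ ?_ vertexRefl_mul_vertexRot ?_ ?_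
  · refine perm_ext fun s i => ?_
    rw [mirror_mul_vertexRot_pow, show ((10 : ℕ) : ZMod 5) = 0 by decide]
    simp
  · rw [pow_two, vertexRefl_sq]
  · intro k h0 hk h
    have hs : ∀ s : LabelledShape, ∀ i, (-1 : ℤ) ^ k • s.1 (i + k) = s.1 i := fun s i => by
      rw [← mirror_mul_vertexRot_pow, h]; rfl
    rcases Nat.even_or_odd k with hk2 | hk2
    · rw [hk2.neg_one_pow] at hs
      simp only [one_smul] at hs
      refine center_not_isRegular (isRegular_of_shift (c := k) ?_ (hs center))
      intro h5
      rw [ZMod.natCast_eq_zero_iff] at h5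
      obtain ⟨m, rfl⟩ := h5
      have : m = 1 := by omega
      subst this
      revert hk2
      decide
    · rw [hk2.neg_one_pow] at hs
      simp only [neg_smul, one_smul] at hs
      exact const_one_ne_neg hp _ _ (hs p 0)
  · intro k hk h
    have hs : ∀ s : LabelledShape, ∀ i, -((-1 : ℤ) ^ k • s.1 (6 - i + k)) = s.1 i := fun s i => by
      rw [← mirror_mul_vertexRot_pow, ← vertexRefl_apply, ← Equiv.Perm.mul_apply, h]; rfl
    rcases Nat.even_or_odd k with hk2 | hk2
    · rw [hk2.neg_one_pow] at hs
      simp only [one_smul] at hs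
      exact const_one_ne_neg hp _ _ (hs p 0)
    · rw [hk2.neg_one_pow] at hs
      simp only [neg_smul, one_smul, neg_neg] at hs
      obtain ⟨l, hl, hl'⟩ := axial_mul_pow_eq_involution k
      refine center_not_fixed hl ?_
      rw [← hl']
      refine shape_ext fun i => ?_
      rw [Equiv.Perm.mul_apply, mirror_mul_vertexRefl_apply, vertexRot_pow_apply, hs]

/-! ### Isotropy groups and orbit lengths -/

theorem card_D5plus : Nat.card D5plus = 10 := by
  obtain ⟨e⟩ := nonempty_D5plus_mulEquiv
  rw [Nat.card_congr e.toEquiv, DihedralGroup.nat_card]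

theorem ncard_orbit_mul {G X : Type*} [Group G] [MulAction G X] (x : X) :
    (MulAction.orbit G x).ncard * Nat.card (MulAction.stabilizer G x) = Nat.card G := by
  rw [← MulAction.index_stabilizer, Subgroup.index_mul_card]

theorem mem_stabilizer_D5plus {s : LabelledShape} {g : D5plus} :
    g ∈ MulAction.stabilizer D5plus s ↔ (g : Equiv.Perm LabelledShape) s = s := Iff.rfl

theorem IsRegular.fixed {s : LabelledShape} (h : IsRegular s) {g : Equiv.Perm LabelledShape}
    (hg : g ∈ D5plus) : g s = s := by
  refine shape_ext fun i => ?_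
  rcases mem_D5plus_cases hg with ⟨k, -, rfl⟩ | ⟨k, -, rfl⟩
  · rw [vertexRot_pow_apply]
    exact h.eq_const _ _
  · rw [involution_apply]
    exact h.eq_const _ _

theorem isotropy_regular {s : LabelledShape} (h : IsRegular s) :
    MulAction.stabilizer D5plus s = ⊤ ∧ (MulAction.orbit D5plus s).ncard = 1 := by
  have h1 : MulAction.stabilizer D5plus s = ⊤ :=
    eq_top_iff.2 fun g _ => h.fixed g.2
  refine ⟨h1, ?_⟩
  have := ncard_orbit_mul (G := D5plus) s
  rw [h1, Subgroup.card_top, card_D5plus] at this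
  omega

theorem isotropy_generic {s : LabelledShape} (h1 : ¬ IsReflectionSymmetric s)
    (h2 : ¬ IsRegular s) :
    MulAction.stabilizer D5plus s = ⊥ ∧ (MulAction.orbit D5plus s).ncard = 10 := by
  have h3 : MulAction.stabilizer D5plus s = ⊥ := by
    refine eq_bot_iff.2 fun g hg => ?_
    rw [mem_stabilizer_D5plus] at hg
    rcases eq_one_or_involution_of_fixed g.2 h2 hg with h | ⟨k, hk, h⟩
    · exact Subgroup.mem_bot.2 (Subtype.ext h)
    · exact absurd (isReflectionSymmetric_iff.2 ⟨k, hk, by rwa [h] at hg⟩) h1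
  refine ⟨h3, ?_⟩
  have := ncard_orbit_mul (G := D5plus) s
  rw [h3, Subgroup.card_bot, card_D5plus] at this
  omega

theorem isotropy_symmetric {s : LabelledShape} (h1 : IsReflectionSymmetric s)
    (h2 : ¬ IsRegular s) :
    (∃ k < 5, ∃ g : D5plus, (g : Equiv.Perm LabelledShape) = involution k ∧
      MulAction.stabilizer D5plus s = Subgroup.zpowers g) ∧
    Nonempty (MulAction.stabilizer D5plus s ≃* Multiplicative (ZMod 2)) ∧
    (MulAction.orbit D5plus s).ncard = 5 := by
  obtain ⟨k, hk, hks⟩ := isReflectionSymmetric_iff.1 h1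
  set g : D5plus := ⟨involution k, involution_mem k⟩ with hg
  have hst : MulAction.stabilizer D5plus s = Subgroup.zpowers g := by
    apply le_antisymm
    · intro x hx
      rw [mem_stabilizer_D5plus] at hx
      rcases eq_one_or_involution_of_fixed x.2 h2 hx with h | ⟨l, hl, h⟩
      · rw [show x = 1 from Subtype.ext h]
        exact one_mem _
      · have hkl : k = l := by
          by_contra hkl
          exact h2 (isRegular_of_two_involutions hk hl hkl hks (by rwa [h] at hx))
        rw [show x = g from Subtype.ext (by rw [h, hg, hkl])]
        exact Subgroup.mem_zpowers g
    · rw [Subgroup.zpowers_le]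
      exact hks
  have hord : orderOf g = 2 := by
    refine orderOf_eq_prime ?_ fun h => involution_ne_one hk (congrArg Subtype.val h)
    refine Subtype.ext (Equiv.ext fun t => ?_)
    rw [pow_two]
    exact involution_involution k t
  have hcard : Nat.card (MulAction.stabilizer D5plus s) = 2 := by
    rw [hst, Nat.card_zpowers, hord]
  refine ⟨⟨k, hk, g, rfl, hst⟩, ?_, ?_⟩
  · have : Fact (Nat.Prime 2) := ⟨Nat.prime_two⟩
    exact ⟨mulEquivOfPrimeCardEq (p := 2) hcard (by simp)⟩
  · have := ncard_orbit_mul (G := D5plus) s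
    rw [hcard, card_D5plus] at this
    omega

/-! ### Symmetry curves as fixed sets -/

theorem mem_symCurve_zero {s : LabelledShape} :
    (∃ a₁ a₂ : ℝ, HasAlpha s a₁ a₂ 0) ↔ s.1 2 = s.1 4 := by
  constructor
  · rintro ⟨a₁, a₂, h2, -, h4⟩
    rw [h2, h4, sub_zero, add_zero]
  · intro h
    refine ⟨((π : ℝ) - s.1 2 - (π : ℝ) - s.1 3).toReal, ((π : ℝ) - s.1 2).toReal, ?_, ?_, ?_⟩
    · rw [sub_zero, neg_sub, Real.Angle.coe_sub, Real.Angle.coe_toReal]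
      abel
    · rw [Real.Angle.coe_add, Real.Angle.coe_neg, Real.Angle.coe_sub, Real.Angle.coe_toReal,
        Real.Angle.coe_toReal]
      abel
    · rw [add_zero, neg_sub, Real.Angle.coe_sub, Real.Angle.coe_toReal, ← h]
      abel

theorem eq_or_of_cos_add_eq {β γ : Real.Angle}
    (h : ∀ φ : Real.Angle, (φ + β).cos = (φ + γ).cos) : β = γ := by
  have h0 := h (-β)
  rw [neg_add_cancel, Real.Angle.cos_zero] at h0
  have h2 : (-β + γ).cos = (0 : Real.Angle).cos := by rw [← h0, Real.Angle.cos_zero]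
  rcases Real.Angle.cos_eq_iff_eq_or_eq_neg.1 h2 with h | h
  · exact (neg_add_eq_zero.1 h)
  · rw [neg_zero] at h
    exact (neg_add_eq_zero.1 h)

/-- If two of the angles agree then the pentagon is symmetric about the perpendicular bisector of
the edge which is opposite to the vertex between them. -/
theorem relAngle_one_eq_five {s : LabelledShape} (h : s.1 2 = s.1 4) : s.1 1 = s.1 0 := by
  have hs := sum_relAngle s
  have key : ∀ φ : Real.Angle, (φ + -s.1 1).cos = (φ + -s.1 0).cos := by
    intro φ
    have c1 := closing s φ
    -- The closing relation read backwards: in the reflected direction the four inner terms are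
    -- permuted because ψ₂ = ψ₄, so comparison isolates ψ₁ and ψ₅.
    have c2 := closing s (-φ - s.1 2 - s.1 3 - s.1 4)
    have a1 : (-φ - s.1 2 - s.1 3 - s.1 4).cos = (φ + s.1 2 + s.1 3 + s.1 4).cos := by
      rw [← Real.Angle.cos_neg]; congr 1; abel
    have a2 : (-φ - s.1 2 - s.1 3 - s.1 4 + s.1 2).cos = (φ + s.1 2 + s.1 3).cos := by
      rw [← Real.Angle.cos_neg, h]; congr 1; abel
    have a3 : (-φ - s.1 2 - s.1 3 - s.1 4 + s.1 2 + s.1 3).cos = (φ + s.1 2).cos := by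
      rw [← Real.Angle.cos_neg, h]; congr 1; abel
    have a4 : (-φ - s.1 2 - s.1 3 - s.1 4 + s.1 2 + s.1 3 + s.1 4).cos = φ.cos := by
      rw [← Real.Angle.cos_neg]; congr 1; abel
    have a5 : (-φ - s.1 2 - s.1 3 - s.1 4 - s.1 1).cos = -(φ + -s.1 0).cos := by
      rw [← Real.Angle.cos_neg, ← Real.Angle.cos_add_pi, ← hs]; congr 1; abel
    rw [a1, a2, a3, a4, a5] at c2
    rw [← sub_eq_add_neg]
    linarith
  exact neg_injective (eq_or_of_cos_add_eq key)

theorem mem_symCurve_iff {k : ℕ} {s : LabelledShape} :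
    s ∈ symCurve k ↔ s.1 (2 - k) = s.1 (4 - k) := by
  have h2 := vertexRot_pow_inv_apply k s 2
  have h4 := vertexRot_pow_inv_apply k s 4
  rw [← h2, ← h4, ← mem_symCurve_zero, symCurve, Equiv.image_eq_preimage_symm]
  rfl

/-- The equation α₃ = 0 only says that one pair of angles agrees; by `relAngle_one_eq_five` the
other pair then agrees automatically. -/
theorem symCurve_eq (k : ℕ) : symCurve k = {s | involution k s = s} := by
  ext s
  rw [mem_symCurve_iff, mem_ofPred_eq, involution_eq_self_iff]
  refine ⟨fun h => ⟨?_, h⟩, fun h => h.2⟩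
  have h1 := vertexRot_pow_inv_apply k s 1
  have h0 := vertexRot_pow_inv_apply k s 0
  have h2 := vertexRot_pow_inv_apply k s 2
  have h4 := vertexRot_pow_inv_apply k s 4
  rw [show (5 : ZMod 5) = 0 by decide, ← h1, ← h0]
  exact relAngle_one_eq_five (by rw [h2, h4, h])

theorem isReflectionSymmetric_iff_mem_symCurve {s : LabelledShape} :
    IsReflectionSymmetric s ↔ ∃ k < 5, s ∈ symCurve k := by
  rw [isReflectionSymmetric_iff]
  simp only [symCurve_eq, mem_ofPred_eq]

theorem isRegular_of_two_symCurves {s : LabelledShape} {k l : ℕ} (hk : k < 5) (hl : l < 5)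
    (hkl : k ≠ l) (h1 : s ∈ symCurve k) (h2 : s ∈ symCurve l) : IsRegular s := by
  rw [symCurve_eq] at h1 h2
  exact isRegular_of_two_involutions hk hl hkl h1 h2

theorem mem_offCurves_iff {s : LabelledShape} : s ∈ offCurves ↔ ∀ k < 5, involution k s ≠ s := by
  simp [offCurves, symCurve_eq]

theorem IsRegular.mem_symCurve {s : LabelledShape} (h : IsRegular s) (k : ℕ) : s ∈ symCurve k :=
  mem_symCurve_iff.2 (h.eq_const _ _)

/-! ### Continuity of the symmetries -/

theorem continuous_shape_map {f : LabelledShape → LabelledShape}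
    (h : ∀ i, Continuous fun s => (f s).1 i) : Continuous f :=
  continuous_induced_rng.2 (continuous_pi h)

theorem continuous_of_mem_D5plus {g : Equiv.Perm LabelledShape} (hg : g ∈ D5plus) :
    Continuous g := by
  refine continuous_shape_map fun i => ?_
  rcases mem_D5plus_cases hg with ⟨k, -, rfl⟩ | ⟨k, -, rfl⟩
  · simp only [vertexRot_pow_apply]
    exact continuous_eval _
  · simp only [involution_apply]
    exact continuous_eval _

/-- The elements of `D₅⁺` act by homeomorphisms. -/
def symmHomeo (g : D5plus) : LabelledShape ≃ₜ LabelledShape where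
  toEquiv := g
  continuous_toFun := continuous_of_mem_D5plus g.2
  continuous_invFun := continuous_of_mem_D5plus (inv_mem g.2)

/-! ### The function describing the arcs -/

/-- The profile of the arcs bounding the fundamental region. -/
def kap (t : ℝ) : ℝ := arccos (-(1 / (4 * cos (t / 2))))

theorem cos_half_ge {t : ℝ} (h : |t| ≤ 4 * π / 5) : (√5 - 1) / 4 ≤ cos (t / 2) := by
  rw [← cos_two_pi_div_five, ← cos_abs (t / 2), abs_div, abs_of_pos (by norm_num : (0 : ℝ) < 2)]
  refine cos_le_cos_of_nonneg_of_le_pi (by positivity) ?_ ?_ <;> linarith [pi_pos]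

theorem sqrt_five_bounds : 2.236 < √5 ∧ √5 < 2.237 := by
  constructor
  · exact Real.lt_sqrt_of_sq_lt (by norm_num)
  · rw [Real.sqrt_lt' (by norm_num)]
    norm_num

/-- Keeps the argument of the arccosine in `kap` inside (-1, 0), so that `kap` is smooth on the
whole interval in use. -/
theorem cos_half_gt {t : ℝ} (h : |t| ≤ 4 * π / 5) : 1 / 4 < cos (t / 2) := by
  have := cos_half_ge h
  linarith [sqrt_five_bounds.1]

theorem cos_kap {t : ℝ} (h : |t| ≤ 4 * π / 5) : cos (kap t) = -(1 / (4 * cos (t / 2))) := by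
  have h1 := cos_half_gt h
  have h2 : 1 / (4 * cos (t / 2)) ≤ 1 := by
    rw [div_le_one (by linarith)]
    linarith
  have h3 : 0 < 1 / (4 * cos (t / 2)) := by
    have : 0 < cos (t / 2) := by linarith
    positivity
  exact cos_arccos (by linarith) (by linarith)

theorem kap_neg (t : ℝ) : kap (-t) = kap t := by
  rw [kap, neg_div, cos_neg, kap]

theorem kap_abs (t : ℝ) : kap |t| = kap t := by
  rcases abs_choice t with h | h <;> rw [h]
  exact kap_neg t

theorem pi_div_two_lt_kap {t : ℝ} (h : |t| ≤ 4 * π / 5) : π / 2 < kap t := by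
  have h1 := cos_half_gt h
  have h3 : 0 < 1 / (4 * cos (t / 2)) := by
    have : 0 < cos (t / 2) := by linarith
    positivity
  rw [kap, arccos_neg]
  have := (arccos_lt_pi_div_two (x := 1 / (4 * cos (t / 2)))).2 h3
  linarith

theorem kap_mono {s t : ℝ} (h0 : 0 ≤ s) (h : s ≤ t) (ht : t ≤ 4 * π / 5) : kap s ≤ kap t := by
  have h1 := cos_half_gt (t := t) (abs_le.2 ⟨by linarith [pi_pos], ht⟩)
  have h2 : cos (t / 2) ≤ cos (s / 2) :=
    cos_le_cos_of_nonneg_of_le_pi (by linarith) (by linarith [pi_pos]) (by linarith)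
  refine arccos_le_arccos ?_
  rw [neg_le_neg_iff]
  exact one_div_le_one_div_of_le (by linarith) (by linarith)

theorem kap_mono_abs {s t : ℝ} (h : |s| ≤ |t|) (ht : |t| ≤ 4 * π / 5) : kap s ≤ kap t := by
  rw [← kap_abs s, ← kap_abs t]
  exact kap_mono (abs_nonneg _) h ht

theorem kap_eq_of_cos {t x : ℝ} (h0 : 0 ≤ x) (h1 : x ≤ π)
    (h : cos x = -(1 / (4 * cos (t / 2)))) : kap t = x := by
  rw [kap, ← h, arccos_cos h0 h1]

theorem kap_two : kap (2 * π / 5) = 3 * π / 5 := by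
  refine kap_eq_of_cos (by positivity) (by linarith [pi_pos]) ?_
  rw [cos_three_pi_div_five, show 2 * π / 5 / 2 = π / 5 by ring, cos_pi_div_five]
  have h := Real.sq_sqrt (show (0 : ℝ) ≤ 5 by norm_num)
  have h2 := sqrt_five_bounds.1
  field_simp
  linear_combination -h

theorem kap_four : kap (4 * π / 5) = 4 * π / 5 := by
  refine kap_eq_of_cos (by positivity) (by linarith [pi_pos]) ?_
  rw [cos_four_pi_div_five, show 4 * π / 5 / 2 = 2 * π / 5 by ring, cos_two_pi_div_five]
  have h := Real.sq_sqrt (show (0 : ℝ) ≤ 5 by norm_num)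
  have h2 := sqrt_five_bounds.1
  have : √5 - 1 ≠ 0 := by linarith
  field_simp
  linear_combination -h

theorem kap_le {t : ℝ} (h : |t| ≤ 4 * π / 5) : kap t ≤ 4 * π / 5 := by
  rw [← kap_abs, ← kap_four]
  exact kap_mono (abs_nonneg _) h le_rfl

theorem continuousOn_kap : ContinuousOn kap (Icc (-(4 * π / 5)) (4 * π / 5)) := by
  refine continuous_arccos.comp_continuousOn (ContinuousOn.neg (ContinuousOn.div continuousOn_const
    (by fun_prop) fun t ht => ?_))
  have := cos_half_gt (abs_le.2 ht)
  linarith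

/-- The derivative of `kap`. -/
def kap' (t : ℝ) : ℝ := sin (t / 2) / (2 * cos (t / 2) * √(16 * cos (t / 2) ^ 2 - 1))

/-! ### Slope estimates for `kap` -/

theorem hasDerivAt_kap {t : ℝ} (h : |t| ≤ 4 * π / 5) : HasDerivAt kap (kap' t) t := by
  have hc := cos_half_gt h
  have hc0 : 0 < cos (t / 2) := by linarith
  have hpos : 0 < 16 * cos (t / 2) ^ 2 - 1 := by nlinarith
  have hx : -(1 / (4 * cos (t / 2))) ≠ -1 := by
    intro h0
    rw [neg_inj, div_eq_one_iff_eq (by positivity)] at h0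
    linarith
  have hx' : -(1 / (4 * cos (t / 2))) ≠ 1 := by
    have : 0 < 1 / (4 * cos (t / 2)) := by positivity
    linarith
  have h1 : HasDerivAt (fun t : ℝ => -(1 / (4 * cos (t / 2))))
      (-(sin (t / 2) / (8 * cos (t / 2) ^ 2))) t := by
    have h2 : HasDerivAt (fun t : ℝ => 4 * cos (t / 2)) (4 * (-sin (t / 2) * (1 / 2))) t :=
      (((hasDerivAt_id t).div_const 2).cos).const_mul 4
    have h3 := (h2.inv (by positivity)).neg
    refine (h3.congr_deriv ?_).congr_of_eventuallyEq ?_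
    · field_simp
      ring
    · exact Filter.Eventually.of_forall fun x => by simp
  refine ((hasDerivAt_arccos hx hx').comp t h1).congr_deriv ?_
  have e : 1 - (-(1 / (4 * cos (t / 2)))) ^ 2
      = (16 * cos (t / 2) ^ 2 - 1) / (4 * cos (t / 2)) ^ 2 := by
    field_simp
    ring
  rw [e, Real.sqrt_div hpos.le, Real.sqrt_sq (by positivity), kap']
  have := Real.sqrt_pos.2 hpos
  field_simp
  ring

/-- In terms of c = cos² (t/2), the squared slope is (1 - c) / (4c(16c - 1)), decreasing in c; `hMC`
says that it equals M² at c = C. For t ≤ 0 the slope is not positive. -/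
theorem kap'_lt {t M C : ℝ} (h : |t| ≤ 4 * π / 5) (hM : 0 < M) (hC : 1 / 16 < C)
    (hMC : 1 - C = 4 * M ^ 2 * C * (16 * C - 1)) (ht : t ≤ 0 ∨ C < cos (t / 2) ^ 2) :
    kap' t < M := by
  have hc := cos_half_gt h
  have hc0 : 0 < cos (t / 2) := by linarith
  have hpos : 0 < 16 * cos (t / 2) ^ 2 - 1 := by nlinarith
  have hden : 0 < 2 * cos (t / 2) * √(16 * cos (t / 2) ^ 2 - 1) := by
    have := Real.sqrt_pos.2 hpos
    positivity
  rw [kap', div_lt_iff₀ hden]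
  rcases ht with ht | ht
  · have : sin (t / 2) ≤ 0 :=
      sin_nonpos_of_nonpos_of_neg_pi_le (by linarith) (by linarith [(abs_le.1 h).1, pi_pos])
    have : 0 < M * (2 * cos (t / 2) * √(16 * cos (t / 2) ^ 2 - 1)) := mul_pos hM hden
    linarith
  · refine lt_of_pow_lt_pow_left₀ 2 (by positivity) ?_
    rw [mul_pow, mul_pow, Real.sq_sqrt hpos.le, sin_sq]
    have h1 : C * (16 * C - 1) < cos (t / 2) ^ 2 * (16 * cos (t / 2) ^ 2 - 1) :=
      mul_lt_mul'' ht (by linarith) (by linarith) (by linarith)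
    have h2 : 4 * M ^ 2 * (C * (16 * C - 1))
        < 4 * M ^ 2 * (cos (t / 2) ^ 2 * (16 * cos (t / 2) ^ 2 - 1)) :=
      mul_lt_mul_of_pos_left h1 (by positivity)
    linarith

theorem lt_kap' {t M C : ℝ} (h : |t| ≤ 4 * π / 5) (h0 : 0 < t) (hM : 0 < M)
    (hMC : 1 - C = 4 * M ^ 2 * C * (16 * C - 1)) (ht : cos (t / 2) ^ 2 < C) :
    M < kap' t := by
  have hc := cos_half_gt h
  have hc0 : 0 < cos (t / 2) := by linarith
  have hpos : 0 < 16 * cos (t / 2) ^ 2 - 1 := by nlinarith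
  have hden : 0 < 2 * cos (t / 2) * √(16 * cos (t / 2) ^ 2 - 1) := by
    have := Real.sqrt_pos.2 hpos
    positivity
  have hs : 0 < sin (t / 2) :=
    sin_pos_of_pos_of_lt_pi (by linarith) (by linarith [(abs_le.1 h).2, pi_pos])
  rw [kap', lt_div_iff₀ hden]
  refine lt_of_pow_lt_pow_left₀ 2 hs.le ?_
  rw [mul_pow, mul_pow, Real.sq_sqrt hpos.le, sin_sq]
  have h1 : cos (t / 2) ^ 2 * (16 * cos (t / 2) ^ 2 - 1) < C * (16 * C - 1) :=
    mul_lt_mul'' ht (by linarith) (by positivity) hpos.le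
  have h2 : 4 * M ^ 2 * (cos (t / 2) ^ 2 * (16 * cos (t / 2) ^ 2 - 1))
      < 4 * M ^ 2 * (C * (16 * C - 1)) :=
    mul_lt_mul_of_pos_left h1 (by positivity)
  linarith

theorem exists_slope {s t : ℝ} (hs : -(4 * π / 5) ≤ s) (hst : s < t) (ht : t ≤ 4 * π / 5) :
    ∃ x ∈ Ioo s t, kap t - kap s = kap' x * (t - s) := by
  obtain ⟨x, hx, h⟩ := exists_hasDerivAt_eq_slope kap kap' hst
    (continuousOn_kap.mono (Icc_subset_Icc hs ht))
    fun x hx => hasDerivAt_kap (abs_le.2 ⟨by linarith [hx.1], by linarith [hx.2]⟩)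
  refine ⟨x, hx, ?_⟩
  rw [h, div_mul_cancel₀ _ (by linarith)]

/-- Mean value theorem, with M the slope of `kap` at the right end B, which the slope does not reach
before B. -/
theorem slope_lt {s t B M : ℝ} (hs : -(4 * π / 5) ≤ s) (hst : s < t) (ht : t ≤ B)
    (hB : B ≤ 4 * π / 5) (hM : 0 < M) (hC : 1 / 16 < cos (B / 2) ^ 2)
    (hMC : 1 - cos (B / 2) ^ 2 = 4 * M ^ 2 * cos (B / 2) ^ 2 * (16 * cos (B / 2) ^ 2 - 1)) :
    kap t - kap s < M * (t - s) := by
  obtain ⟨x, hx, h⟩ := exists_slope hs hst (ht.trans hB)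
  have hx1 := hx.1
  have hx2 := hx.2
  rw [h]
  refine mul_lt_mul_of_pos_right (kap'_lt (abs_le.2 ⟨by linarith, by linarith⟩) hM hC hMC ?_)
    (by linarith)
  rcases le_or_gt x 0 with h0 | h0
  · exact Or.inl h0
  · right
    have hB0 := cos_half_gt (t := B) (abs_le.2 ⟨by linarith [pi_pos], hB⟩)
    have := cos_lt_cos_of_nonneg_of_le_pi (x := x / 2) (y := B / 2) (by linarith)
      (by linarith [pi_pos]) (by linarith)
    exact pow_lt_pow_left₀ this (by linarith) two_ne_zero

/-- The slope of `kap` at `2π/5`. -/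
def slopeA : ℝ := (√5 - 2) / 2

/-- The slope of `kap` at `4π/5`. -/
def slopeB : ℝ := (√5 + 2) / 2

/-- At the corner (2π/5, 4π/5) the upper side has dy/dx = `slopeA` + 1/2 and the right side dx/dy =
`slopeB` - 1/2. The product 1 says that the two sides are tangent there, so chord estimates along
both sides just fit together. -/
theorem slope_mul : (slopeA + 1 / 2) * (slopeB - 1 / 2) = 1 := by
  have h := Real.sq_sqrt (show (0 : ℝ) ≤ 5 by norm_num)
  rw [slopeA, slopeB]
  linear_combination h / 4

theorem slopeA_pos : 0 < slopeA := by
  rw [slopeA]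
  linarith [sqrt_five_bounds.1]

theorem slopeB_gt : 2 < slopeB := by
  rw [slopeB]
  linarith [sqrt_five_bounds.1]

/-- At 2π/3 the slope of `kap` is exactly 1/2; this is where `arc` changes from decreasing to
increasing. -/
theorem slope_half {s t : ℝ} (hs : -(4 * π / 5) ≤ s) (hst : s < t) (ht : t ≤ 2 * π / 3) :
    kap t - kap s < 1 / 2 * (t - s) := by
  refine slope_lt hs hst ht (by linarith [pi_pos]) (by norm_num) ?_ ?_ <;>
  · rw [show 2 * π / 3 / 2 = π / 3 by ring, cos_pi_div_three]
    norm_num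

theorem slope_A {s t : ℝ} (hs : -(4 * π / 5) ≤ s) (hst : s < t) (ht : t ≤ 2 * π / 5) :
    kap t - kap s < slopeA * (t - s) := by
  have h := Real.sq_sqrt (show (0 : ℝ) ≤ 5 by norm_num)
  have h4 : √5 ^ 4 = 25 := by rw [show √5 ^ 4 = (√5 ^ 2) ^ 2 by ring, h]; norm_num
  have h3 : √5 ^ 3 = 5 * √5 := by rw [pow_succ, h]
  have e : cos (2 * π / 5 / 2) ^ 2 = (3 + √5) / 8 := by
    rw [show 2 * π / 5 / 2 = π / 5 by ring, cos_pi_div_five]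
    linear_combination h / 16
  refine slope_lt hs hst ht (by linarith [pi_pos]) slopeA_pos ?_ ?_ <;> rw [e]
  · linarith [sqrt_five_bounds.1]
  · rw [slopeA]
    ring_nf
    rw [h4, h3, h]
    ring

theorem slope_B {s t : ℝ} (hs : -(4 * π / 5) ≤ s) (hst : s < t) (ht : t ≤ 4 * π / 5) :
    kap t - kap s < slopeB * (t - s) := by
  have h := Real.sq_sqrt (show (0 : ℝ) ≤ 5 by norm_num)
  have h4 : √5 ^ 4 = 25 := by rw [show √5 ^ 4 = (√5 ^ 2) ^ 2 by ring, h]; norm_num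
  have h3 : √5 ^ 3 = 5 * √5 := by rw [pow_succ, h]
  have e : cos (4 * π / 5 / 2) ^ 2 = (3 - √5) / 8 := by
    rw [show 4 * π / 5 / 2 = 2 * π / 5 by ring, cos_two_pi_div_five]
    linear_combination h / 16
  refine slope_lt hs hst ht le_rfl (by linarith [slopeB_gt]) ?_ ?_ <;> rw [e]
  · linarith [sqrt_five_bounds.2]
  · rw [slopeB]
    ring_nf
    rw [h4, h3, h]
    ring

theorem half_slope {s t : ℝ} (hs : 2 * π / 3 ≤ s) (hst : s < t) (ht : t ≤ 4 * π / 5) :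
    1 / 2 * (t - s) < kap t - kap s := by
  obtain ⟨x, hx, h⟩ := exists_slope (by linarith [pi_pos]) hst ht
  have hx1 := hx.1
  have hx2 := hx.2
  rw [h]
  have hx0 : 0 < x := by linarith [pi_pos]
  have hc := cos_half_gt (t := x) (abs_le.2 ⟨by linarith [pi_pos], by linarith⟩)
  refine mul_lt_mul_of_pos_right (lt_kap' (C := 1 / 4) (abs_le.2 ⟨by linarith, by linarith⟩) hx0
    (by norm_num) (by norm_num) ?_) (by linarith)
  have := cos_lt_cos_of_nonneg_of_le_pi (x := π / 3) (y := x / 2) (by positivity)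
    (by linarith [pi_pos]) (by linarith)
  rw [cos_pi_div_three] at this
  nlinarith

theorem slope_half_le {s t : ℝ} (hs : -(4 * π / 5) ≤ s) (hst : s ≤ t) (ht : t ≤ 2 * π / 3) :
    kap t - kap s ≤ 1 / 2 * (t - s) := by
  rcases hst.eq_or_lt with rfl | h
  · simp
  · exact (slope_half hs h ht).le

theorem slope_A_le {s t : ℝ} (hs : -(4 * π / 5) ≤ s) (hst : s ≤ t) (ht : t ≤ 2 * π / 5) :
    kap t - kap s ≤ slopeA * (t - s) := by
  rcases hst.eq_or_lt with rfl | h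
  · simp
  · exact (slope_A hs h ht).le

theorem slope_B_le {s t : ℝ} (hs : -(4 * π / 5) ≤ s) (hst : s ≤ t) (ht : t ≤ 4 * π / 5) :
    kap t - kap s ≤ slopeB * (t - s) := by
  rcases hst.eq_or_lt with rfl | h
  · simp
  · exact (slope_B hs h ht).le

theorem half_slope_le {s t : ℝ} (hs : 2 * π / 3 ≤ s) (hst : s ≤ t) (ht : t ≤ 4 * π / 5) :
    1 / 2 * (t - s) ≤ kap t - kap s := by
  rcases hst.eq_or_lt with rfl | h
  · simp
  · exact (half_slope hs h ht).le

/-! ### The planar quadrilateral -/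

/-- The arc bounding the quadrilateral on the right, as a graph over the vertical axis. -/
def arc (t : ℝ) : ℝ := kap t - t / 2

/-- The quadrilateral parametrizing the closed fundamental region by
`(α₁ + α₂, α₁ - α₂)`. -/
def quad : Set (ℝ × ℝ) :=
  {p | |p.1| ≤ 4 * π / 5 ∧ |p.2| ≤ 4 * π / 5 ∧ |p.1 + p.2 / 2| ≤ kap p.2 ∧
    |p.2 - p.1 / 2| ≤ kap p.1}

/-- The interior of the quadrilateral. -/
def quadInt : Set (ℝ × ℝ) :=
  {p | |p.1| < 4 * π / 5 ∧ |p.2| < 4 * π / 5 ∧ |p.1 + p.2 / 2| < kap p.2 ∧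
    |p.2 - p.1 / 2| < kap p.1}

theorem quadInt_subset_quad : quadInt ⊆ quad := fun _ h => ⟨h.1.le, h.2.1.le, h.2.2.1.le, h.2.2.2.le⟩

/-- The quarter turn exchanges the two pairs of inequalities because `kap` is even. It reduces
statements about four sides to the right one. -/
theorem rot_mem_quad {x y : ℝ} : (-y, x) ∈ quad ↔ (x, y) ∈ quad := by
  simp only [quad, mem_ofPred_eq, abs_neg, kap_neg]
  rw [show x - -y / 2 = x + y / 2 by ring, show -y + x / 2 = -(y - x / 2) by ring, abs_neg]
  tauto

theorem rot_mem_quadInt {x y : ℝ} : (-y, x) ∈ quadInt ↔ (x, y) ∈ quadInt := by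
  simp only [quadInt, mem_ofPred_eq, abs_neg, kap_neg]
  rw [show x - -y / 2 = x + y / 2 by ring, show -y + x / 2 = -(y - x / 2) by ring, abs_neg]
  tauto

theorem neg_mem_quad {x y : ℝ} : (-x, -y) ∈ quad ↔ (x, y) ∈ quad := by
  rw [← rot_mem_quad (x := x), ← rot_mem_quad (x := -y)]

theorem neg_mem_quadInt {x y : ℝ} : (-x, -y) ∈ quadInt ↔ (x, y) ∈ quadInt := by
  rw [← rot_mem_quadInt (x := x), ← rot_mem_quadInt (x := -y)]

theorem arc_start : arc (-(2 * π / 5)) = 4 * π / 5 := by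
  rw [arc, kap_neg, kap_two]; ring

theorem arc_end : arc (4 * π / 5) = 2 * π / 5 := by
  rw [arc, kap_four]; ring

theorem arc_le_of_ge {t : ℝ} (h : 2 * π / 3 ≤ t) (ht : t ≤ 4 * π / 5) : arc t ≤ 2 * π / 5 := by
  have := half_slope_le h ht le_rfl
  rw [kap_four] at this
  rw [arc]
  linarith

theorem arc_lt {t : ℝ} (h : -(2 * π / 5) < t) (ht : t ≤ 4 * π / 5) : arc t < 4 * π / 5 := by
  rcases le_total t (2 * π / 3) with h1 | h1
  · have := slope_half (by linarith [pi_pos]) h h1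
    rw [kap_neg, kap_two] at this
    rw [arc]
    linarith
  · have := arc_le_of_ge h1 ht
    linarith [pi_pos]

theorem arc_le_kap_zero {t : ℝ} (h : 0 ≤ t) (ht : t ≤ 4 * π / 5) : arc t ≤ kap 0 := by
  rcases le_total t (2 * π / 3) with h1 | h1
  · have := slope_half_le (by linarith [pi_pos]) h h1
    rw [arc]
    linarith
  · have := arc_le_of_ge h1 ht
    have := pi_div_two_lt_kap (t := 0) (by rw [abs_zero]; positivity)
    linarith [pi_pos]

theorem arc_pos {t : ℝ} (h : |t| ≤ 4 * π / 5) : 0 < arc t := by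
  have := pi_div_two_lt_kap h
  rw [arc]
  linarith [(abs_le.1 h).2, pi_pos]

/-- Inner points of the right side stay strictly off the upper and lower sides. Towards either
corner, the chord bounds with `slopeA` on one side and `slopeB` on the other are chained; by
`slope_mul` their factors cancel, so the strictness of the bounds decides. -/
theorem arc_lt_strict {t : ℝ} (h : -(2 * π / 5) < t) (ht : t < 4 * π / 5) :
    |t - arc t / 2| < kap (arc t) := by
  have habs : |t| ≤ 4 * π / 5 := abs_le.2 ⟨by linarith [pi_pos], ht.le⟩
  have hx0 := arc_pos habs
  have hx1 := arc_lt h ht.le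
  have hm := slope_mul
  have hA := slopeA_pos
  have hB := slopeB_gt
  set x := arc t with hx
  have hxt : x = kap t - t / 2 := rfl
  rw [abs_lt]
  constructor
  · have h1 := slope_B (s := x) (by linarith) hx1 le_rfl
    rw [kap_four] at h1
    have h2 := slope_A (s := -t) (t := 2 * π / 5) (by linarith) (by linarith) le_rfl
    rw [kap_two, kap_neg] at h2
    have h3 : 4 * π / 5 - x < (slopeA + 1 / 2) * (2 * π / 5 + t) := by linarith
    have h4 := mul_lt_mul_of_pos_left h3 (show 0 < slopeB - 1 / 2 by linarith)
    rw [← mul_assoc, mul_comm (slopeB - 1 / 2) (slopeA + 1 / 2), hm] at h4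
    linarith
  · rcases le_or_gt (2 * π / 5) x with h1 | h1
    · have := kap_mono (by positivity) h1 hx1.le
      rw [kap_two] at this
      linarith
    · have h2 := slope_A (s := x) (by linarith [pi_pos]) h1 le_rfl
      rw [kap_two] at h2
      have h3 := slope_B (s := t) (abs_le.1 habs).1 ht le_rfl
      rw [kap_four] at h3
      have h4 : 2 * π / 5 - x < (slopeB - 1 / 2) * (4 * π / 5 - t) := by linarith
      have h5 := mul_lt_mul_of_pos_left h4 (show 0 < slopeA + 1 / 2 by linarith)
      rw [← mul_assoc, hm] at h5
      linarith

theorem arc_mem_Icc {t : ℝ} (h : t ∈ Icc (-(2 * π / 5)) (4 * π / 5)) :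
    0 < arc t ∧ arc t ≤ 4 * π / 5 := by
  refine ⟨arc_pos (abs_le.2 ⟨by linarith [h.1, pi_pos], h.2⟩), ?_⟩
  rcases h.1.eq_or_lt with h1 | h1
  · rw [← h1, arc_start]
  · exact (arc_lt h1 h.2).le

theorem arc_mem_quad {t : ℝ} (h : t ∈ Icc (-(2 * π / 5)) (4 * π / 5)) : (arc t, t) ∈ quad := by
  have habs : |t| ≤ 4 * π / 5 := abs_le.2 ⟨by linarith [h.1, pi_pos], h.2⟩
  obtain ⟨h1, h2⟩ := arc_mem_Icc h
  refine ⟨by rwa [abs_of_pos h1], habs, ?_, ?_⟩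
  · rw [show arc t + t / 2 = kap t by rw [arc]; ring, abs_of_pos]
    linarith [pi_div_two_lt_kap habs, pi_pos]
  · show |t - arc t / 2| ≤ kap (arc t)
    rcases h.1.eq_or_lt with h3 | h3
    · rw [← h3, arc_start, kap_four, abs_le]
      constructor <;> linarith [pi_pos]
    · rcases h.2.eq_or_lt with h4 | h4
      · rw [h4, arc_end, kap_two, abs_le]
        constructor <;> linarith [pi_pos]
      · exact (arc_lt_strict h3 h4).le

/-- A point of the closed quadrilateral is an interior point or lies on one of the four arcs. -/
theorem quad_cases {p : ℝ × ℝ} (hp : p ∈ quad) : p ∈ quadInt ∨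
    ∃ t ∈ Icc (-(2 * π / 5)) (4 * π / 5),
      p = (arc t, t) ∨ p = (-t, arc t) ∨ p = (-arc t, -t) ∨ p = (t, -arc t) := by
  have right : ∀ x y : ℝ, (x, y) ∈ quad → x + y / 2 = kap y →
      ∃ t ∈ Icc (-(2 * π / 5)) (4 * π / 5), (x, y) = (arc t, t) := by
    intro x y h e
    obtain ⟨h1, h2, -, -⟩ := h
    simp only at h1 h2
    refine ⟨y, ⟨?_, (abs_le.1 h2).2⟩, ?_⟩
    -- Below -2π/5 one has kap y ≥ 3π/5, which would push x = kap y - y/2 beyond 4π/5.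
    · by_contra! hlt
      have := kap_mono_abs (s := 2 * π / 5) (t := y)
        (by rw [abs_of_pos (by positivity), abs_of_neg (by linarith [pi_pos])]; linarith) h2
      rw [kap_two] at this
      linarith [(abs_le.1 h1).2]
    · rw [arc, ← e]
      ring_nf
  -- The bounding box touches the quadrilateral on this edge only in a corner, so the box
  -- constraints add no further boundary.
  have edge : ∀ x y : ℝ, (x, y) ∈ quad → x = 4 * π / 5 →
      ∃ t ∈ Icc (-(2 * π / 5)) (4 * π / 5), (x, y) = (arc t, t) := by
    rintro x y h rfl
    obtain ⟨-, h2, h3, h4⟩ := h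
    simp only [kap_four] at h2 h3 h4
    have hy : -(2 * π / 5) ≤ y := by linarith [(abs_le.1 h4).1]
    refine ⟨-(2 * π / 5), ⟨le_rfl, by linarith [pi_pos]⟩, ?_⟩
    have hy' : y = -(2 * π / 5) := by
      by_contra hne
      have := arc_lt (lt_of_le_of_ne hy (Ne.symm hne)) (abs_le.1 h2).2
      rw [arc] at this
      linarith [(abs_le.1 h3).2]
    rw [arc_start, hy']
  by_contra! hcon
  obtain ⟨hn, hcon⟩ := hcon
  apply hn
  obtain ⟨x, y⟩ := p
  have right' : ∀ x y : ℝ, (x, y) ∈ quad →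
      (∀ t ∈ Icc (-(2 * π / 5)) (4 * π / 5), (x, y) ≠ (arc t, t)) →
      x < 4 * π / 5 ∧ x + y / 2 < kap y := by
    intro x y h hne
    constructor
    · refine lt_of_le_of_ne (abs_le.1 h.1).2 fun e => ?_
      obtain ⟨t, ht, h'⟩ := edge x y h e
      exact hne t ht h'
    · refine lt_of_le_of_ne (abs_le.1 h.2.2.1).2 fun e => ?_
      obtain ⟨t, ht, h'⟩ := right x y h e
      exact hne t ht h'
  have a1 := right' x y hp fun t ht => (hcon t ht).1
  have a2 := right' y (-x) (by rw [← rot_mem_quad, neg_neg]; exact hp) fun t ht h => by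
    simp only [Prod.mk.injEq] at h
    exact (hcon t ht).2.1 (by rw [← h.1, ← h.2, neg_neg])
  have a3 := right' (-x) (-y) (neg_mem_quad.2 hp) fun t ht h => by
    simp only [Prod.mk.injEq] at h
    exact (hcon t ht).2.2.1 (by rw [← h.1, ← h.2, neg_neg, neg_neg])
  have a4 := right' (-y) x (rot_mem_quad.2 hp) fun t ht h => by
    simp only [Prod.mk.injEq] at h
    exact (hcon t ht).2.2.2 (by rw [← h.1, ← h.2, neg_neg])
  rw [kap_neg] at a2 a3
  exact ⟨abs_lt.2 ⟨by linarith [a3.1], a1.1⟩, abs_lt.2 ⟨by linarith [a4.1], a2.1⟩,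
    abs_lt.2 ⟨by linarith [a3.2], a1.2⟩, abs_lt.2 ⟨by linarith [a4.2], by linarith [a2.2]⟩⟩

/-- An inner point of the side becomes interior when moved slightly to the left: the right-hand
constraint turns strict, the others already are strict. -/
theorem arc_mem_closure_aux {t : ℝ} (h : -(2 * π / 5) < t) (ht : t < 4 * π / 5) :
    (arc t, t) ∈ closure quadInt := by
  have habs : |t| < 4 * π / 5 := abs_lt.2 ⟨by linarith [pi_pos], ht⟩
  have h0 := arc_pos habs.le
  have h1 := arc_lt h ht.le
  have hk := pi_div_two_lt_kap habs.le
  have key := arc_lt_strict h ht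
  have hc : ContinuousAt (fun ε : ℝ => kap (arc t - ε) - |t - (arc t - ε) / 2|) 0 := by
    refine ContinuousAt.sub (ContinuousAt.comp (g := kap) (f := fun ε => arc t - ε) ?_ (by fun_prop))
      (by fun_prop)
    rw [sub_zero]
    exact (hasDerivAt_kap (by rw [abs_of_pos h0]; exact h1.le)).continuousAt
  have ev : ∀ᶠ ε in nhds (0 : ℝ), 0 < kap (arc t - ε) - |t - (arc t - ε) / 2| := by
    refine hc.eventually (lt_mem_nhds ?_)
    simp only [sub_zero]
    linarith
  have ev2 : ∀ᶠ ε in nhds (0 : ℝ), ε < arc t := gt_mem_nhds h0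
  refine mem_closure_of_tendsto (b := nhdsWithin (0 : ℝ) (Ioi 0)) (f := fun ε => (arc t - ε, t)) ?_ ?_
  · have : Continuous fun ε : ℝ => (arc t - ε, t) := by fun_prop
    have h := this.tendsto 0
    rw [sub_zero] at h
    exact h.mono_left nhdsWithin_le_nhds
  · filter_upwards [nhdsWithin_le_nhds ev, nhdsWithin_le_nhds ev2, self_mem_nhdsWithin]
      with ε e1 e2 e3
    have e3' : 0 < ε := e3
    have ha : arc t = kap t - t / 2 := rfl
    refine ⟨abs_lt.2 ⟨by linarith [pi_pos], by linarith⟩, habs, abs_lt.2 ⟨?_, ?_⟩, by linarith⟩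
    · show -kap t < arc t - ε + t / 2
      linarith [pi_pos, (abs_lt.1 habs).1]
    · show arc t - ε + t / 2 < kap t
      linarith

theorem continuousOn_arc : ContinuousOn arc (Icc (-(2 * π / 5)) (4 * π / 5)) :=
  (continuousOn_kap.mono (Icc_subset_Icc (by linarith [pi_pos]) le_rfl)).sub (by fun_prop)

theorem arc_mem_closure {t : ℝ} (h : t ∈ Icc (-(2 * π / 5)) (4 * π / 5)) :
    (arc t, t) ∈ closure quadInt := by
  have hne : (-(2 * π / 5)) ≠ 4 * π / 5 := by linarith [pi_pos]
  have hc : ContinuousOn (fun t => (arc t, t)) (closure (Ioo (-(2 * π / 5)) (4 * π / 5))) := by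
    rw [closure_Ioo hne]
    exact continuousOn_arc.prodMk continuousOn_id
  rw [← closure_Ioo hne] at h
  have := hc.image_closure (mem_image_of_mem _ h)
  refine closure_minimal ?_ isClosed_closure this
  rintro _ ⟨x, hx, rfl⟩
  exact arc_mem_closure_aux hx.1 hx.2

theorem rot_mem_closure_quadInt {x y : ℝ} (h : (x, y) ∈ closure quadInt) :
    (-y, x) ∈ closure quadInt := by
  have hc : Continuous fun p : ℝ × ℝ => (-p.2, p.1) := by fun_prop
  exact map_mem_closure (f := fun p : ℝ × ℝ => (-p.2, p.1)) hc h fun p hp => rot_mem_quadInt.2 hp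

theorem quad_subset_closure : quad ⊆ closure quadInt := by
  intro p hp
  rcases quad_cases hp with h | ⟨t, ht, h⟩
  · exact subset_closure h
  · have h1 := arc_mem_closure ht
    have h2 := rot_mem_closure_quadInt h1
    have h3 := rot_mem_closure_quadInt h2
    have h4 := rot_mem_closure_quadInt h3
    rw [neg_neg] at h4
    rcases h with rfl | rfl | rfl | rfl <;> assumption

/-! ### The cosines of the half coordinates -/

/-- The triangle inequality that makes α₃ exist; equality would mean α₃ = π, that is, a point of
symmetry curve 0. The worst case is |y| = |x|/2 + kap x, after which everything is algebra in a =
cos (x/2). -/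
theorem cos_sub_cos_aux {x y : ℝ} (hp : (x, y) ∈ quad) (hx : |x| < 2 * π / 5) :
    cos (x / 2) - cos (y / 2) < 1 / 2 := by
  obtain ⟨h1, h2, -, h4⟩ := hp
  simp only at h1 h2 h4
  rw [← cos_abs (x / 2), ← cos_abs (y / 2), abs_div, abs_div, abs_two]
  have hk := kap_abs x
  have hy : |y| ≤ |x| / 2 + kap |x| := by
    have := abs_sub_abs_le_abs_sub y (x / 2)
    rw [abs_div, abs_two] at this
    linarith
  set X := |x| with hX
  have hX0 : 0 ≤ X := abs_nonneg x
  have hXa : |X| ≤ 4 * π / 5 := by rw [abs_of_nonneg hX0]; exact h1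
  have hkl := kap_le hXa
  have hkp := pi_div_two_lt_kap hXa
  have hck := cos_kap hXa
  set a := cos (X / 2) with ha
  have ha1 : (1 + √5) / 4 < a := by
    rw [← cos_pi_div_five]
    exact cos_lt_cos_of_nonneg_of_le_pi (by linarith) (by linarith [pi_pos]) (by linarith)
  have hs5 := Real.sq_sqrt (show (0 : ℝ) ≤ 5 by norm_num)
  have hs5b := sqrt_five_bounds.1
  have ha2 : a ≤ 1 := cos_le_one _
  have ha0 : 0 < a := by linarith
  have hcos : cos (X / 4 + kap X / 2) ≤ cos (|y| / 2) := by
    refine cos_le_cos_of_nonneg_of_le_pi (by positivity) ?_ ?_ <;> linarith [pi_pos]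
  have hpos : 0 ≤ cos (X / 4 + kap X / 2) :=
    cos_nonneg_of_neg_pi_div_two_le_of_le (by linarith [pi_pos]) (by linarith [pi_pos])
  have hdouble : 2 * cos (X / 4 + kap X / 2) ^ 2 - 1 = -(1 / 4) - sin (X / 2) * sin (kap X) := by
    rw [← cos_two_mul, show 2 * (X / 4 + kap X / 2) = X / 2 + kap X by ring, cos_add, hck, ← ha]
    field_simp
  have hP : (sin (X / 2) * sin (kap X)) ^ 2 * (16 * a ^ 2) = (1 - a ^ 2) * (16 * a ^ 2 - 1) := by
    rw [mul_pow, sin_sq, sin_sq, hck, ← ha]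
    field_simp
    ring
  -- The difference of the two squared sides of `hL`, times 16a², is this perfect square. Among its
  -- roots is a = cos (π/5), the value at |x| = 2π/5.
  have hq : 0 < (8 * a ^ 3 - 8 * a ^ 2 + 1) ^ 2 := by
    have : 0 < (2 * a - 1) * (4 * a ^ 2 - 2 * a - 1) := mul_pos (by linarith) (by nlinarith)
    rw [show 8 * a ^ 3 - 8 * a ^ 2 + 1 = (2 * a - 1) * (4 * a ^ 2 - 2 * a - 1) by ring]
    positivity
  have hL : sin (X / 2) * sin (kap X) < 1 / 4 + 2 * a - 2 * a ^ 2 := by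
    refine lt_of_pow_lt_pow_left₀ 2 (by nlinarith) ?_
    have : 0 < 16 * a ^ 2 := by positivity
    refine lt_of_mul_lt_mul_right ?_ this.le
    rw [hP]
    nlinarith
  have : a - 1 / 2 < cos (X / 4 + kap X / 2) := by
    refine lt_of_pow_lt_pow_left₀ 2 hpos ?_
    nlinarith
  linarith

theorem cos_sub_cos_le {x y : ℝ} (hp : (x, y) ∈ quad) :
    cos (x / 2) - cos (y / 2) ≤ 1 / 2 ∧
      (cos (x / 2) - cos (y / 2) = 1 / 2 → |y| = 4 * π / 5) := by
  rcases lt_or_ge |x| (2 * π / 5) with h | h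
  · have := cos_sub_cos_aux hp h
    exact ⟨this.le, fun h => absurd h this.ne⟩
  · have h1 : cos (x / 2) ≤ (1 + √5) / 4 := by
      rw [← cos_pi_div_five, ← cos_abs (x / 2), abs_div, abs_two]
      refine cos_le_cos_of_nonneg_of_le_pi (by positivity) ?_ ?_ <;> linarith [hp.1, pi_pos]
    have h2 := cos_half_ge hp.2.1
    refine ⟨by simp only at h2; linarith, fun h3 => ?_⟩
    by_contra hne
    have h4 : |y| < 4 * π / 5 := lt_of_le_of_ne hp.2.1 hne
    have : cos (2 * π / 5) < cos (y / 2) := by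
      rw [← cos_abs (y / 2), abs_div, abs_two]
      refine cos_lt_cos_of_nonneg_of_le_pi (by positivity) ?_ ?_ <;> linarith [pi_pos]
    rw [cos_two_pi_div_five] at this
    linarith

theorem abs_cos_sub_cos_le {x y : ℝ} (hp : (x, y) ∈ quad) :
    |cos (x / 2) - cos (y / 2)| ≤ 1 / 2 ∧
      (|cos (x / 2) - cos (y / 2)| = 1 / 2 → (x, y) ∉ quadInt) := by
  have h1 := cos_sub_cos_le hp
  have h2 := cos_sub_cos_le (rot_mem_quad.2 hp)
  rw [neg_div, cos_neg] at h2
  refine ⟨abs_le.2 ⟨by linarith [h2.1], h1.1⟩, fun h hi => ?_⟩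
  rcases abs_choice (cos (x / 2) - cos (y / 2)) with h3 | h3
  · exact hi.2.1.ne (h1.2 (by rw [← h3, h]))
  · exact hi.1.ne (h2.2 (by linarith))

theorem half_lt_cos_add_cos {x y : ℝ} (hp : (x, y) ∈ quad) : 1 / 2 < cos (x / 2) + cos (y / 2) := by
  have h1 := cos_half_gt hp.1
  have h2 := cos_half_gt hp.2.1
  simp only at h1 h2
  linarith

/-- Since (x + y)/2 = α₁ and (x - y)/2 = α₂, this is the input for the bound |α₂| < α₃ needed in the
angle sum. -/
theorem cos_sq_lt_aux {x y : ℝ} (hp : (x, y) ∈ quad) (hx : 0 ≤ x) (hy : 0 ≤ y) :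
    cos ((x + y) / 2) ^ 2 < 4 * (cos (x / 2) * cos (y / 2)) ^ 2 + 3 / 4 ∧
      cos ((x - y) / 2) ^ 2 < 4 * (cos (x / 2) * cos (y / 2)) ^ 2 + 3 / 4 := by
  obtain ⟨h1, h2, h3, -⟩ := hp
  simp only at h1 h2 h3
  have hb := cos_half_gt h2
  have hk := cos_kap h2
  have hf : 0 ≤ 1 + 4 * cos (x + y / 2) * cos (y / 2) := by
    have h5 : cos (kap y) ≤ cos (x + y / 2) :=
      cos_le_cos_of_nonneg_of_le_pi (by linarith) (by linarith [kap_le h2, pi_pos])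
        (by linarith [(abs_le.1 h3).2])
    rw [hk] at h5
    have h6 := mul_le_mul_of_nonneg_right h5 (show 0 ≤ 4 * cos (y / 2) by linarith)
    rw [neg_mul, one_div_mul_cancel (by linarith)] at h6
    linarith
  have e1 : 4 * cos (x + y / 2) * cos (y / 2) = 2 * cos x + 2 * cos (x + y) := by
    have a := cos_add (x + y / 2) (y / 2)
    have b := cos_sub (x + y / 2) (y / 2)
    rw [show x + y / 2 + y / 2 = x + y by ring] at a
    rw [show x + y / 2 - y / 2 = x by ring] at b
    linear_combination (-2) * a - 2 * b
  have hkx : x + y / 2 ≤ kap y := (abs_le.1 h3).2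
  rw [abs_of_nonneg hx] at h1
  rw [abs_of_nonneg hy] at h2
  -- What remains of the second inequality once the side condition 1 + 2 cos x + 2 cos (x + y) ≥ 0
  -- has been used.
  have hlow : 0 < 1 + cos x / 2 + cos y := by
    have hs := sqrt_five_bounds
    rcases lt_or_ge y (2 * π / 3) with h | h
    · have a : cos (2 * π / 3) < cos y := cos_lt_cos_of_nonneg_of_le_pi hy (by linarith [pi_pos]) h
      rw [show 2 * π / 3 = π - π / 3 by ring, cos_pi_sub, cos_pi_div_three] at a
      linarith [neg_one_le_cos x]
    · have a : x ≤ 2 * π / 5 := by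
        have := arc_le_of_ge h h2
        rw [arc] at this
        linarith
      have b : cos (2 * π / 5) ≤ cos x := cos_le_cos_of_nonneg_of_le_pi hx (by linarith [pi_pos]) a
      have c : cos (4 * π / 5) ≤ cos y := cos_le_cos_of_nonneg_of_le_pi hy (by linarith [pi_pos]) h2
      rw [cos_two_pi_div_five] at b
      rw [cos_four_pi_div_five] at c
      linarith
  have ab : 4 * (cos (x / 2) * cos (y / 2)) ^ 2 = (1 + cos x) * (1 + cos y) := by
    have a := cos_sq (x / 2)
    have b := cos_sq (y / 2)
    rw [show 2 * (x / 2) = x by ring] at a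
    rw [show 2 * (y / 2) = y by ring] at b
    rw [mul_pow, a, b]
    ring
  have hsub := cos_sub x y
  have hadd := cos_add x y
  have hss : 0 ≤ sin x * sin y :=
    mul_nonneg (sin_nonneg_of_nonneg_of_le_pi hx (by linarith [pi_pos]))
      (sin_nonneg_of_nonneg_of_le_pi hy (by linarith [pi_pos]))
  rw [ab, cos_sq, cos_sq, show 2 * ((x + y) / 2) = x + y by ring,
    show 2 * ((x - y) / 2) = x - y by ring]
  constructor <;> linarith

theorem cos_sq_lt {x y : ℝ} (hp : (x, y) ∈ quad) :
    cos ((x + y) / 2) ^ 2 < 4 * (cos (x / 2) * cos (y / 2)) ^ 2 + 3 / 4 ∧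
      cos ((x - y) / 2) ^ 2 < 4 * (cos (x / 2) * cos (y / 2)) ^ 2 + 3 / 4 := by
  have upper : ∀ {x y : ℝ}, (x, y) ∈ quad → 0 ≤ y →
      cos ((x + y) / 2) ^ 2 < 4 * (cos (x / 2) * cos (y / 2)) ^ 2 + 3 / 4 ∧
        cos ((x - y) / 2) ^ 2 < 4 * (cos (x / 2) * cos (y / 2)) ^ 2 + 3 / 4 := by
    intro x y hp hy
    rcases le_total 0 x with hx | hx
    · exact cos_sq_lt_aux hp hx hy
    · have h := cos_sq_lt_aux (x := y) (y := -x)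
        (by rw [← rot_mem_quad, neg_neg]; exact hp) hy (by linarith)
      rw [neg_div, cos_neg, sub_neg_eq_add, ← sub_eq_add_neg, ← neg_sub x y, neg_div, cos_neg,
        mul_comm (cos (y / 2)), add_comm y x] at h
      exact ⟨h.2, h.1⟩
  rcases le_total 0 y with hy | hy
  · exact upper hp hy
  · have h := upper (neg_mem_quad.2 hp) (by linarith : 0 ≤ -y)
    rw [neg_div, cos_neg, neg_div, cos_neg, ← neg_add, neg_div, cos_neg, ← neg_sub',
      neg_div, cos_neg] at h
    exact h

/-! ### Contractibility -/

/-- The shear moving the point with first coordinate `x₁` to the first coordinate `x₀`, keeping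
the relative position `l` between the lower and the upper arc. -/
theorem shear_key {x₀ x₁ l : ℝ} (h0 : 0 ≤ x₀) (h01 : x₀ ≤ x₁) (h1 : x₁ ≤ 4 * π / 5)
    (hl : |l| ≤ 1) (hy : |x₁ / 2 + l * kap x₁| ≤ 4 * π / 5)
    (hx : x₁ + (x₁ / 2 + l * kap x₁) / 2 ≤ kap (x₁ / 2 + l * kap x₁)) :
    kap (x₁ / 2 + l * kap x₁) - (x₁ / 2 + l * kap x₁) / 2 - x₁
      ≤ kap (x₀ / 2 + l * kap x₀) - (x₀ / 2 + l * kap x₀) / 2 - x₀ := by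
  have hm := slope_mul
  have hA := slopeA_pos
  have hB := slopeB_gt
  obtain ⟨hl1, hl2⟩ := abs_le.1 hl
  have hk0 : π / 2 < kap x₀ := pi_div_two_lt_kap (abs_le.2 ⟨by linarith [pi_pos], by linarith⟩)
  have hk0' : kap x₀ ≤ 4 * π / 5 := kap_le (abs_le.2 ⟨by linarith [pi_pos], by linarith⟩)
  have hk01 := kap_mono h0 h01 h1
  set y₁ := x₁ / 2 + l * kap x₁ with hy₁
  set y₀ := x₀ / 2 + l * kap x₀ with hy₀
  obtain ⟨hy1, hy2⟩ := abs_le.1 hy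
  have hy0 : -(4 * π / 5) ≤ y₀ := by
    have : -1 * kap x₀ ≤ l * kap x₀ := mul_le_mul_of_nonneg_right hl1 (by linarith [pi_pos])
    linarith
  have hd : y₁ - y₀ = (x₁ - x₀) / 2 + l * (kap x₁ - kap x₀) := by rw [hy₁, hy₀]; ring
  rcases le_or_gt y₀ y₁ with hle | hgt
  · rcases le_or_gt y₁ (2 * π / 3) with h3 | h3
    · have := slope_half_le hy0 hle h3
      linarith
    -- Near the upper corner the half slope no longer suffices; there x is small enough for the
    -- `slopeA` bound, which balances the `slopeB` bound in y.
    · have hx1 : x₁ ≤ 2 * π / 5 := by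
        have := arc_le_of_ge h3.le hy2
        rw [arc] at this
        linarith
      have s1 := slope_A_le (s := x₀) (by linarith [pi_pos]) h01 hx1
      have s2 := slope_B_le hy0 hle hy2
      have s3 : l * (kap x₁ - kap x₀) ≤ 1 * (kap x₁ - kap x₀) :=
        mul_le_mul_of_nonneg_right hl2 (by linarith)
      have s4 : y₁ - y₀ ≤ (slopeA + 1 / 2) * (x₁ - x₀) := by linarith
      have s5 := mul_le_mul_of_nonneg_left s4 (show 0 ≤ slopeB - 1 / 2 by linarith)
      rw [← mul_assoc, mul_comm (slopeB - 1 / 2) (slopeA + 1 / 2), hm] at s5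
      linarith
  · have s3 : -1 * (kap x₁ - kap x₀) ≤ l * (kap x₁ - kap x₀) :=
      mul_le_mul_of_nonneg_right hl1 (by linarith)
    -- The height can grow as x decreases only if `kap` changes faster than with slope 1/2, which
    -- requires x₁ > 2π/3.
    have hx1 : 2 * π / 3 < x₁ := by
      by_contra! hx1
      have := slope_half_le (s := x₀) (by linarith [pi_pos]) h01 hx1
      linarith
    have s1 := slope_B_le (s := x₀) (by linarith [pi_pos]) h01 h1
    have s4 : y₀ - y₁ ≤ (slopeB - 1 / 2) * (x₁ - x₀) := by linarith
    have s5 := mul_le_mul_of_nonneg_left s4 (show 0 ≤ slopeA + 1 / 2 by linarith)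
    rw [← mul_assoc, hm] at s5
    have s6 : -(2 * π / 5) ≤ y₁ := by
      have a := half_slope_le hx1.le h1 le_rfl
      rw [kap_four] at a
      have b : -1 * kap x₁ ≤ l * kap x₁ := mul_le_mul_of_nonneg_right hl1 (by linarith [pi_pos])
      linarith
    have hy0' : y₀ ≤ 4 * π / 5 := by
      have hl0 : l ≤ 0 := by
        by_contra! hl0
        have := mul_nonneg hl0.le (sub_nonneg.2 hk01)
        linarith
      have := mul_nonpos_of_nonpos_of_nonneg hl0 (show 0 ≤ kap x₀ by linarith [pi_pos])
      linarith [pi_pos]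
    have s7 := slope_A_le (s := -y₀) (t := -y₁) (by linarith) (by linarith) (by linarith)
    rw [kap_neg, kap_neg] at s7
    linarith

/-- First stage of the contraction of the quadrilateral. -/
def shear (r : ℝ) (p : ℝ × ℝ) : ℝ × ℝ :=
  (r * p.1, r * p.1 / 2 + (p.2 - p.1 / 2) / kap p.1 * kap (r * p.1))

theorem shear_mem_aux {r x y : ℝ} (hr0 : 0 ≤ r) (hr1 : r ≤ 1) (hx : 0 ≤ x)
    (h : (x, y) ∈ quadInt) : shear r (x, y) ∈ quadInt := by
  obtain ⟨h1, h2, h3, h4⟩ := h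
  simp only at h1 h2 h3 h4
  rw [abs_of_nonneg hx] at h1
  have hk := pi_div_two_lt_kap (t := x) (by rw [abs_of_nonneg hx]; exact h1.le)
  set l := (y - x / 2) / kap x with hl
  have hk0 : 0 < kap x := by linarith [pi_pos]
  have hl1 : |l| < 1 := by
    rw [hl, abs_div, abs_of_pos hk0, div_lt_one hk0]
    exact h4
  have hy : y = x / 2 + l * kap x := by
    rw [hl]
    field_simp
    ring
  have hrx : 0 ≤ r * x := mul_nonneg hr0 hx
  have hrx1 : r * x ≤ x := mul_le_of_le_one_left hx hr1
  have hk1 := pi_div_two_lt_kap (t := r * x) (by rw [abs_of_nonneg hrx]; linarith)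
  have hk2 := kap_le (t := r * x) (by rw [abs_of_nonneg hrx]; linarith)
  have hk3 := kap_mono hrx hrx1 h1.le
  have hlk : |l * kap (r * x)| < kap (r * x) := by
    rw [abs_mul, abs_of_pos (by linarith [pi_pos] : 0 < kap (r * x))]
    exact mul_lt_of_lt_one_left (by linarith [pi_pos]) hl1
  have key := shear_key (l := l) hrx hrx1 h1.le hl1.le (by rw [← hy]; exact h2.le)
    (by rw [← hy]; exact (abs_lt.1 h3).2.le)
  rw [← hy] at key
  have hs : shear r (x, y) = (r * x, r * x / 2 + l * kap (r * x)) := rfl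
  obtain ⟨hlk1, hlk2⟩ := abs_lt.1 hlk
  obtain ⟨h21, h22⟩ := abs_lt.1 h2
  have hY1 : -(4 * π / 5) < r * x / 2 + l * kap (r * x) := by linarith
  have hY2 : r * x / 2 + l * kap (r * x) < 4 * π / 5 := by
    rcases le_or_gt l 0 with h0 | h0
    · have := mul_nonpos_of_nonpos_of_nonneg h0 (show 0 ≤ kap (r * x) by linarith [pi_pos])
      linarith [pi_pos]
    · have := mul_le_mul_of_nonneg_left hk3 h0.le
      linarith
  rw [hs]
  have hkY := pi_div_two_lt_kap (abs_le.2 ⟨hY1.le, hY2.le⟩)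
  refine ⟨?_, abs_lt.2 ⟨hY1, hY2⟩, ?_, ?_⟩
  · show |r * x| < _
    rw [abs_of_nonneg hrx]
    linarith
  · show |r * x + (r * x / 2 + l * kap (r * x)) / 2| < kap (r * x / 2 + l * kap (r * x))
    rw [abs_lt]
    constructor
    · linarith [pi_pos]
    · linarith [(abs_lt.1 h3).2]
  · show |r * x / 2 + l * kap (r * x) - r * x / 2| < kap (r * x)
    rwa [add_sub_cancel_left]

theorem shear_neg (r x y : ℝ) : shear r (-x, -y) = -shear r (x, y) := by
  simp only [shear, mul_neg, kap_neg, Prod.neg_mk, Prod.mk.injEq, true_and]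
  ring

theorem shear_mem {r : ℝ} {p : ℝ × ℝ} (hr : r ∈ Icc (0 : ℝ) 1) (hp : p ∈ quadInt) :
    shear r p ∈ quadInt := by
  obtain ⟨x, y⟩ := p
  rcases le_total 0 x with hx | hx
  · exact shear_mem_aux hr.1 hr.2 hx hp
  · have := shear_mem_aux hr.1 hr.2 (neg_nonneg.2 hx) (neg_mem_quadInt.2 hp)
    rw [shear_neg] at this
    exact neg_mem_quadInt.1 this

theorem zero_mem_quadInt {y : ℝ} (h : |y| < kap 0) : (0, y) ∈ quadInt := by
  have hk := kap_mono (s := 0) (t := 2 * π / 5) le_rfl (by positivity) (by linarith [pi_pos])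
  rw [kap_two] at hk
  have hy : |y| < 4 * π / 5 := by linarith [pi_pos]
  have := pi_div_two_lt_kap hy.le
  obtain ⟨h1, h2⟩ := abs_lt.1 h
  refine ⟨by simp only [abs_zero]; positivity, hy, ?_, ?_⟩
  · show |0 + y / 2| < kap y
    rw [zero_add, abs_lt]
    constructor <;> linarith [pi_pos]
  · show |y - 0 / 2| < kap 0
    rwa [zero_div, sub_zero]

theorem continuousOn_shear :
    ContinuousOn (fun q : ℝ × ℝ × ℝ => shear q.1 q.2) (Icc 0 1 ×ˢ quadInt) := by
  have hm : ∀ q ∈ Icc (0 : ℝ) 1 ×ˢ quadInt, |q.2.1| ≤ 4 * π / 5 := fun q hq => hq.2.1.le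
  have hm' : ∀ q ∈ Icc (0 : ℝ) 1 ×ˢ quadInt, |q.1 * q.2.1| ≤ 4 * π / 5 := fun q hq => by
    rw [abs_mul, abs_of_nonneg hq.1.1]
    exact (mul_le_of_le_one_left (abs_nonneg _) hq.1.2).trans (hm q hq)
  have k1 : ContinuousOn (fun q : ℝ × ℝ × ℝ => kap q.2.1) (Icc 0 1 ×ˢ quadInt) :=
    continuousOn_kap.comp (by fun_prop) fun q hq => abs_le.1 (hm q hq)
  have k2 : ContinuousOn (fun q : ℝ × ℝ × ℝ => kap (q.1 * q.2.1)) (Icc 0 1 ×ˢ quadInt) :=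
    continuousOn_kap.comp (by fun_prop) fun q hq => abs_le.1 (hm' q hq)
  refine ContinuousOn.prodMk (by fun_prop) (ContinuousOn.add (by fun_prop)
    (ContinuousOn.mul (ContinuousOn.div (by fun_prop) k1 fun q hq => ?_) k2))
  have := pi_div_two_lt_kap (hm q hq)
  linarith [pi_pos]

theorem isOpen_quadInt : IsOpen quadInt := by
  have hbox : IsOpen (Ioo (-(4 * π / 5)) (4 * π / 5) ×ˢ Ioo (-(4 * π / 5)) (4 * π / 5)) :=
    isOpen_Ioo.prod isOpen_Ioo
  have k1 : ContinuousOn (fun p : ℝ × ℝ => kap p.2 - |p.1 + p.2 / 2|)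
      (Ioo (-(4 * π / 5)) (4 * π / 5) ×ˢ Ioo (-(4 * π / 5)) (4 * π / 5)) :=
    ContinuousOn.sub (continuousOn_kap.comp (by fun_prop) fun q hq => Ioo_subset_Icc_self hq.2)
      (by fun_prop)
  have k2 : ContinuousOn (fun p : ℝ × ℝ => kap p.1 - |p.2 - p.1 / 2|)
      (Ioo (-(4 * π / 5)) (4 * π / 5) ×ˢ Ioo (-(4 * π / 5)) (4 * π / 5)) :=
    ContinuousOn.sub (continuousOn_kap.comp (by fun_prop) fun q hq => Ioo_subset_Icc_self hq.1)
      (by fun_prop)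
  have h := (k1.isOpen_inter_preimage hbox isOpen_Ioi (t := Ioi 0)).inter
    (k2.isOpen_inter_preimage hbox isOpen_Ioi (t := Ioi 0))
  convert h using 1
  ext p
  simp only [quadInt, mem_ofPred_eq, mem_inter_iff, mem_prod, mem_preimage, mem_Ioi, mem_Ioo,
    sub_pos, abs_lt (a := p.1), abs_lt (a := p.2)]
  tauto

theorem isCompact_quad : IsCompact quad := by
  have hbox : IsCompact (Icc (-(4 * π / 5)) (4 * π / 5) ×ˢ Icc (-(4 * π / 5)) (4 * π / 5)) :=
    isCompact_Icc.prod isCompact_Icc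
  have k1 : ContinuousOn (fun p : ℝ × ℝ => kap p.2 - |p.1 + p.2 / 2|)
      (Icc (-(4 * π / 5)) (4 * π / 5) ×ˢ Icc (-(4 * π / 5)) (4 * π / 5)) :=
    ContinuousOn.sub (continuousOn_kap.comp (by fun_prop) fun q hq => hq.2) (by fun_prop)
  have k2 : ContinuousOn (fun p : ℝ × ℝ => kap p.1 - |p.2 - p.1 / 2|)
      (Icc (-(4 * π / 5)) (4 * π / 5) ×ˢ Icc (-(4 * π / 5)) (4 * π / 5)) :=
    ContinuousOn.sub (continuousOn_kap.comp (by fun_prop) fun q hq => hq.1) (by fun_prop)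
  have h := (k1.preimage_isClosed_of_isClosed hbox.isClosed isClosed_Ici (t := Ici 0)).inter
    (k2.preimage_isClosed_of_isClosed hbox.isClosed isClosed_Ici (t := Ici 0))
  refine hbox.of_isClosed_subset ?_ (fun p hp => ⟨abs_le.1 hp.1, abs_le.1 hp.2.1⟩)
  convert h using 1
  ext p
  simp only [quad, mem_ofPred_eq, mem_inter_iff, mem_prod, mem_preimage, mem_Ici, mem_Icc,
    sub_nonneg, abs_le (a := p.1), abs_le (a := p.2)]
  tauto

theorem shear_one {p : ℝ × ℝ} (hp : p ∈ quadInt) : shear 1 p = p := by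
  have := pi_div_two_lt_kap hp.1.le
  have h0 : kap p.1 ≠ 0 := by linarith [pi_pos]
  ext
  · simp [shear]
  · simp only [shear, one_mul, div_mul_cancel₀ _ h0]
    ring

theorem abs_shear_zero_lt {p : ℝ × ℝ} (hp : p ∈ quadInt) : |(shear 0 p).2| < kap 0 := by
  have := (shear_mem (left_mem_Icc.2 zero_le_one) hp).2.2.2
  simpa [shear] using this

/-- Two homotopies: `H₁` shears onto the segment x = 0, `H₂` shrinks that segment to the origin. -/
instance contractibleSpace_quadInt : ContractibleSpace quadInt := by
  have hk0 := pi_div_two_lt_kap (t := 0) (by rw [abs_zero]; positivity)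
  let H₁ : C(unitInterval × quadInt, quadInt) :=
    ⟨fun q => ⟨shear (q.1 : ℝ) q.2.1, shear_mem q.1.2 q.2.2⟩,
      (continuousOn_shear.comp_continuous (f := fun q : unitInterval × quadInt => (q.1.1, q.2.1))
        (by fun_prop) fun q => ⟨q.1.2, q.2.2⟩).subtype_mk _⟩
  have hmem : ∀ q : unitInterval × quadInt, ((0 : ℝ), q.1.1 * (shear 0 q.2.1).2) ∈ quadInt := by
    intro q
    refine zero_mem_quadInt ?_
    rw [abs_mul, abs_of_nonneg q.1.2.1]
    exact (mul_le_of_le_one_left (abs_nonneg _) q.1.2.2).trans_lt (abs_shear_zero_lt q.2.2)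
  let H₂ : C(unitInterval × quadInt, quadInt) :=
    ⟨fun q => ⟨(0, q.1.1 * (shear 0 q.2.1).2), hmem q⟩, by
      have h : Continuous fun q : unitInterval × quadInt => shear 0 q.2.1 :=
        continuousOn_shear.comp_continuous
          (f := fun q : unitInterval × quadInt => ((0 : ℝ), q.2.1)) (by fun_prop)
          fun q => ⟨left_mem_Icc.2 zero_le_one, q.2.2⟩
      exact (continuous_const.prodMk ((continuous_subtype_val.comp continuous_fst).mul
        (continuous_snd.comp h))).subtype_mk _⟩
  rw [contractible_iff_id_nullhomotopic]
  have h0 : ((0 : ℝ), (0 : ℝ)) ∈ quadInt := zero_mem_quadInt (by rw [abs_zero]; linarith [pi_pos])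
  refine ⟨⟨(0, 0), h0⟩, ?_⟩
  let f : C(quadInt, quadInt) := H₁.comp ⟨fun p => (0, p), by fun_prop⟩
  have a : f.Homotopic (ContinuousMap.id quadInt) :=
    ⟨⟨H₁, fun p => rfl, fun p => Subtype.ext (shear_one p.2)⟩⟩
  have b : (ContinuousMap.const quadInt (⟨(0, 0), h0⟩ : quadInt)).Homotopic f := by
    refine ⟨⟨H₂, fun p => Subtype.ext ?_, fun p => Subtype.ext ?_⟩⟩
    · show ((0 : ℝ), (0 : ℝ) * (shear 0 p.1).2) = (0, 0)
      rw [zero_mul]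
    · show ((0 : ℝ), (1 : ℝ) * (shear 0 p.1).2) = shear 0 p.1
      rw [one_mul]
      ext <;> simp [shear]
  exact a.symm.trans b.symm

/-! ### The section over the plane of the first two coordinates -/

/-- The coordinates `(α₁ + α₂, α₁ - α₂)`, with reduced `α₁, α₂`. -/
def planeCoord (s : LabelledShape) : ℝ × ℝ := (red₁ s + red₂ s, red₁ s - red₂ s)

/-- The plane points over which there is a distinguished shape. -/
def lens : Set (ℝ × ℝ) :=
  {p | |p.1| < π ∧ |p.2| < π ∧ |cos (p.1 / 2) - cos (p.2 / 2)| ≤ 1 / 2 ∧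
    1 / 2 < cos (p.1 / 2) + cos (p.2 / 2)}

/-- The cosine of `α₃` as a function of `(α₁ + α₂, α₁ - α₂)`. -/
def heightCos (p : ℝ × ℝ) : ℝ :=
  -((cos (p.1 / 2) ^ 2 + cos (p.2 / 2) ^ 2 - 1 / 4) / (2 * (cos (p.1 / 2) * cos (p.2 / 2))))

theorem quad_subset_lens : quad ⊆ lens := fun p hp =>
  ⟨by linarith [hp.1, pi_pos], by linarith [hp.2.1, pi_pos], (abs_cos_sub_cos_le hp).1,
    half_lt_cos_add_cos hp⟩

theorem cos_half_pos {x : ℝ} (h : |x| < π) : 0 < cos (x / 2) := by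
  obtain ⟨h1, h2⟩ := abs_lt.1 h
  exact cos_pos_of_mem_Ioo ⟨by linarith, by linarith⟩

/-- The lens conditions are the triangle inequalities for sides 2 cos (x/2), 2 cos (y/2), 1. One of
them is strict, which keeps α₃ away from 0. -/
theorem heightCos_mem {p : ℝ × ℝ} (hp : p ∈ lens) : -1 ≤ heightCos p ∧ heightCos p < 1 := by
  obtain ⟨h1, h2, h3, h4⟩ := hp
  have ha := cos_half_pos h1
  have hb := cos_half_pos h2
  have hd := sq_le_sq' (abs_le.1 h3).1 (abs_le.1 h3).2
  have hab := mul_pos ha hb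
  rw [heightCos, neg_le_neg_iff, neg_lt]
  constructor
  · rw [div_le_one (by positivity)]
    nlinarith
  · rw [lt_div_iff₀ (by positivity)]
    nlinarith

theorem heightCos_equation {p : ℝ × ℝ} (hp : p ∈ lens) :
    4 * (cos (p.1 / 2) ^ 2 + cos (p.2 / 2) ^ 2
      + 2 * cos (p.1 / 2) * cos (p.2 / 2) * heightCos p) = 1 := by
  have ha := cos_half_pos hp.1
  have hb := cos_half_pos hp.2.1
  rw [heightCos]
  field_simp
  ring

theorem ofPlane_mem (p : lens) :
    4 * (cos (((p.1.1 + p.1.2) / 2 + (p.1.1 - p.1.2) / 2) / 2) ^ 2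
      + cos (((p.1.1 + p.1.2) / 2 - (p.1.1 - p.1.2) / 2) / 2) ^ 2
      + 2 * cos (((p.1.1 + p.1.2) / 2 + (p.1.1 - p.1.2) / 2) / 2)
        * cos (((p.1.1 + p.1.2) / 2 - (p.1.1 - p.1.2) / 2) / 2)
        * cos (arccos (heightCos p.1))) = 1 := by
  have h := heightCos_mem p.2
  rw [cos_arccos h.1 h.2.le, show (p.1.1 + p.1.2) / 2 + (p.1.1 - p.1.2) / 2 = p.1.1 by ring,
    show (p.1.1 + p.1.2) / 2 - (p.1.1 - p.1.2) / 2 = p.1.2 by ring]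
  exact heightCos_equation p.2

/-- The shape with given `(α₁ + α₂, α₁ - α₂)` and `α₃ ∈ (0, π]`. -/
def ofPlane (p : lens) : LabelledShape :=
  ofAlpha ⟨((p.1.1 + p.1.2) / 2, (p.1.1 - p.1.2) / 2, arccos (heightCos p.1)), ofPlane_mem p⟩

theorem continuous_ofPlane : Continuous ofPlane := by
  have h : Continuous fun p : lens => heightCos p.1 := by
    refine Continuous.neg (Continuous.div (by fun_prop) (by fun_prop) fun p => ?_)
    have ha := cos_half_pos p.2.1
    have hb := cos_half_pos p.2.2.1
    positivity
  exact continuous_ofAlpha.comp (Continuous.subtype_mk (by fun_prop) _)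

theorem hasReducedAlpha_ofPlane (p : lens) : HasReducedAlpha (ofPlane p)
    ((p.1.1 + p.1.2) / 2) ((p.1.1 - p.1.2) / 2) (arccos (heightCos p.1)) := by
  obtain ⟨h1, h2⟩ := abs_lt.1 p.2.1
  obtain ⟨h3, h4⟩ := abs_lt.1 p.2.2.1
  refine ⟨hasAlpha_ofAlpha _, ⟨by linarith, by linarith⟩, ⟨by linarith, by linarith⟩, ?_,
    arccos_le_pi _⟩
  exact arccos_pos.2 (heightCos_mem p.2).2

theorem planeCoord_ofPlane (p : lens) : planeCoord (ofPlane p) = p := by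
  obtain ⟨h1, h2, -⟩ := (hasReducedAlpha_ofPlane p).eq_red
  rw [planeCoord, ← h1, ← h2]
  ext
  · show (p.1.1 + p.1.2) / 2 + (p.1.1 - p.1.2) / 2 = p.1.1
    ring
  · show (p.1.1 + p.1.2) / 2 - (p.1.1 - p.1.2) / 2 = p.1.2
    ring

theorem planeCoord_equation (s : LabelledShape) :
    4 * (cos ((planeCoord s).1 / 2) ^ 2 + cos ((planeCoord s).2 / 2) ^ 2
      + 2 * cos ((planeCoord s).1 / 2) * cos ((planeCoord s).2 / 2) * cos (red₃ s)) = 1 :=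
  (hasReducedAlpha_red s).1.equation

theorem HasReducedAlpha.planeCoord_eq {s : LabelledShape} {a₁ a₂ a₃ : ℝ}
    (h : HasReducedAlpha s a₁ a₂ a₃) : planeCoord s = (a₁ + a₂, a₁ - a₂) := by
  obtain ⟨rfl, rfl, -⟩ := h.eq_red
  rfl

/-- When the coefficient of cos α₃ in the closing equation does not vanish, the equation determines
cos α₃, and cosine is injective on [0, π]. -/
theorem eq_of_planeCoord_eq {s t : LabelledShape} (h : planeCoord s = planeCoord t)
    (h0 : cos ((planeCoord s).1 / 2) * cos ((planeCoord s).2 / 2) ≠ 0) : s = t := by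
  have hs := planeCoord_equation s
  have ht := planeCoord_equation t
  rw [← h] at ht
  have h3 : cos (red₃ s) = cos (red₃ t) := by
    apply mul_left_cancel₀ h0
    linear_combination (hs - ht) / 8
  have ha := congrArg Prod.fst h
  have hb := congrArg Prod.snd h
  simp only [planeCoord] at ha hb
  refine eq_of_red_eq (by linarith) (by linarith) ?_
  have m1 := (hasReducedAlpha_red s).2.2.2
  have m2 := (hasReducedAlpha_red t).2.2.2
  exact injOn_cos ⟨m1.1.le, m1.2⟩ ⟨m2.1.le, m2.2⟩ h3

theorem cos_mul_cos_pos {p : ℝ × ℝ} (hp : p ∈ lens) : 0 < cos (p.1 / 2) * cos (p.2 / 2) :=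
  mul_pos (cos_half_pos hp.1) (cos_half_pos hp.2.1)

theorem ofPlane_planeCoord {s : LabelledShape} (h : planeCoord s ∈ lens) :
    ofPlane ⟨planeCoord s, h⟩ = s :=
  (eq_of_planeCoord_eq (planeCoord_ofPlane ⟨planeCoord s, h⟩).symm (cos_mul_cos_pos h).ne').symm

theorem red₁_lt {s : LabelledShape} (h : planeCoord s ∈ lens) : |red₁ s| < π ∧ |red₂ s| < π := by
  obtain ⟨h1, h2⟩ := abs_lt.1 h.1
  obtain ⟨h3, h4⟩ := abs_lt.1 h.2.1
  simp only [planeCoord] at h1 h2 h3 h4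
  exact ⟨abs_lt.2 ⟨by linarith, by linarith⟩, abs_lt.2 ⟨by linarith, by linarith⟩⟩

/-- The curve α₃ = 0 appears at α₃ = π, because α₃ is determined modulo π and the reduced range
excludes 0. It is also where the reduced coordinates may jump. -/
theorem red₃_eq_pi_iff {s : LabelledShape} : red₃ s = π ↔ s ∈ symCurve 0 := by
  rw [mem_symCurve_iff]
  simp only [Nat.cast_zero, sub_zero]
  rw [red₃]
  constructor
  · intro h
    have h' : (s.1 4 - s.1 2 + ((π : ℝ) : Real.Angle)).toReal = π := by linarith
    rw [Real.Angle.toReal_eq_pi_iff, add_eq_right, sub_eq_zero] at h'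
    exact h'.symm
  · intro h
    rw [h, sub_self, zero_add, Real.Angle.toReal_pi]
    ring

theorem red₃_lt_pi_iff {s : LabelledShape} : red₃ s < π ↔ s ∉ symCurve 0 := by
  rw [← red₃_eq_pi_iff]
  exact (hasReducedAlpha_red s).2.2.2.2.lt_iff_ne

theorem abs_cos_sub_cos_of_mem {s : LabelledShape} (h : s ∈ symCurve 0) :
    |cos ((planeCoord s).1 / 2) - cos ((planeCoord s).2 / 2)| = 1 / 2 := by
  have := planeCoord_equation s
  rw [red₃_eq_pi_iff.2 h, cos_pi] at this
  have h1 : (cos ((planeCoord s).1 / 2) - cos ((planeCoord s).2 / 2)) ^ 2 = (1 / 2) ^ 2 := by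
    linear_combination this / 4
  rw [← abs_of_pos (show (0 : ℝ) < 1 / 2 by norm_num)]
  exact sq_eq_sq_iff_abs_eq_abs _ _ |>.1 h1

theorem continuousAt_planeCoord {s : LabelledShape} (h : planeCoord s ∈ lens)
    (h3 : s ∉ symCurve 0) : ContinuousAt planeCoord s := by
  have h3 := red₃_lt_pi_iff.2 h3
  obtain ⟨h1, h2⟩ := red₁_lt h
  have c2 := continuousAt_red₂ h3 (abs_lt.1 h2).2
  have c1 := continuousAt_red₁ h3 (abs_lt.1 h2).2 (abs_lt.1 h1).2
  exact (c1.add c2).prodMk (c1.sub c2)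

/-- The open fundamental region. -/
def cell : Set LabelledShape := {s | planeCoord s ∈ quadInt}

/-- The closed fundamental region. -/
def tile : Set LabelledShape := {s | planeCoord s ∈ quad}

theorem cell_subset_tile : cell ⊆ tile := fun _ h => quadInt_subset_quad h

theorem not_mem_symCurve_zero_of_mem_cell {s : LabelledShape} (h : s ∈ cell) : s ∉ symCurve 0 :=
  fun h0 => (abs_cos_sub_cos_le (quadInt_subset_quad h)).2 (abs_cos_sub_cos_of_mem h0) h

theorem isOpen_cell : IsOpen cell := by
  rw [isOpen_iff_mem_nhds]
  intro s hs
  exact (continuousAt_planeCoord (quad_subset_lens (cell_subset_tile hs))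
    (not_mem_symCurve_zero_of_mem_cell hs)).preimage_mem_nhds (isOpen_quadInt.mem_nhds hs)

theorem image_ofPlane {A : Set (ℝ × ℝ)} (hA : A ⊆ lens) :
    ofPlane '' {p | p.1 ∈ A} = {s | planeCoord s ∈ A} := by
  ext s
  constructor
  · rintro ⟨p, hp, rfl⟩
    show planeCoord _ ∈ A
    rwa [planeCoord_ofPlane]
  · intro h
    exact ⟨⟨planeCoord s, hA h⟩, h, ofPlane_planeCoord _⟩

/-- Obtained as a continuous image of the compact quadrilateral rather than as a preimage:
continuity of `planeCoord` is not available at the corners, where α₃ = π. -/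
theorem isCompact_tile : IsCompact tile := by
  rw [tile, ← image_ofPlane quad_subset_lens]
  exact (Topology.IsInducing.subtypeVal.isCompact_preimage' isCompact_quad
    (by rw [Subtype.range_coe]; exact quad_subset_lens)).image continuous_ofPlane

theorem isClosed_tile : IsClosed tile := isCompact_tile.isClosed

theorem closure_cell : closure cell = tile := by
  apply subset_antisymm
  · exact closure_minimal cell_subset_tile isClosed_tile
  · rw [tile, ← image_ofPlane quad_subset_lens]
    have h : {p : lens | p.1 ∈ quad} ⊆ closure {p : lens | p.1 ∈ quadInt} := by
      intro p hp
      rw [closure_subtype]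
      have : ((↑) : lens → ℝ × ℝ) '' {p : lens | p.1 ∈ quadInt} = quadInt := by
        ext q
        constructor
        · rintro ⟨x, hx, rfl⟩
          exact hx
        · intro hq
          exact ⟨⟨q, quad_subset_lens (quadInt_subset_quad hq)⟩, hq, rfl⟩
      rw [this]
      exact quad_subset_closure hp
    refine (image_mono h).trans ((image_closure_subset_closure_image continuous_ofPlane).trans ?_)
    rw [image_ofPlane (quadInt_subset_quad.trans quad_subset_lens)]
    exact subset_rfl

/-- The open fundamental region is homeomorphic to the open quadrilateral. -/
def cellHomeo : quadInt ≃ₜ cell where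
  toFun p := ⟨ofPlane ⟨p.1, quad_subset_lens (quadInt_subset_quad p.2)⟩, by
    show planeCoord _ ∈ quadInt
    rw [planeCoord_ofPlane]
    exact p.2⟩
  invFun s := ⟨planeCoord s.1, s.2⟩
  left_inv p := Subtype.ext (planeCoord_ofPlane _)
  right_inv s := Subtype.ext (ofPlane_planeCoord _)
  continuous_toFun := by
    refine Continuous.subtype_mk (continuous_ofPlane.comp ?_) _
    exact continuous_subtype_val.subtype_mk _
  continuous_invFun := by
    refine Continuous.subtype_mk ?_ _
    rw [continuous_iff_continuousAt]
    intro s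
    exact (continuousAt_planeCoord (quad_subset_lens (cell_subset_tile s.2))
      (not_mem_symCurve_zero_of_mem_cell s.2)).comp continuous_subtype_val.continuousAt

instance contractibleSpace_cell : ContractibleSpace cell :=
  cellHomeo.symm.contractibleSpace

theorem isPreconnected_cell : IsPreconnected cell :=
  isPreconnected_iff_preconnectedSpace.2 inferInstance

/-! ### The four arcs in the plane of the first two coordinates -/

theorem exists_hasAlpha {a₁ a₂ a₃ c : ℝ}
    (h : ∀ x : ℝ, 2 * cos ((a₁ - a₂) / 2) * cos x + 2 * cos ((a₁ + a₂) / 2) * cos (x + a₃)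
      = cos (x + c)) :
    ∃ s, HasAlpha s a₁ a₂ a₃ ∧ s.1 1 = (((a₁ + a₂) / 2 + a₃ - c : ℝ) : Real.Angle) := by
  have k0 := h 0
  have k1 := h (π / 2)
  rw [cos_pi_div_two, add_comm (π / 2), cos_add_pi_div_two, add_comm (π / 2),
    cos_add_pi_div_two] at k1
  rw [cos_zero, zero_add, zero_add] at k0
  have h1 := cos_sq_add_sin_sq c
  have h3 := sin_sq_add_cos_sq a₃
  rw [← k0, ← neg_sq (sin c), ← k1] at h1
  let p : AlphaSurface := ⟨(a₁, a₂, a₃), by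
    linear_combination h1 - 4 * cos ((a₁ + a₂) / 2) ^ 2 * h3⟩
  refine ⟨ofAlpha p, hasAlpha_ofAlpha p, ?_⟩
  have k := (hasAlpha_ofAlpha p).cos_closing (-c)
  have k' : ((((a₁ + a₂) / 2 + a₃ + -c : ℝ) : Real.Angle) - (ofAlpha p).1 1).cos = 1 := by
    rw [← k, h, neg_add_cancel, cos_zero]
  rw [← sub_eq_add_neg, ← Real.Angle.cos_zero, Real.Angle.cos_eq_iff_eq_or_eq_neg, neg_zero,
    or_self] at k'
  exact (sub_eq_zero.1 k').symm

/-- A reflection symmetric pentagon: one edge on the axis direction z and two pairs of edges placed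
symmetrically about it. -/
theorem five_cos {w h : ℝ} (e : 4 * cos w * cos h = -1) (z : ℝ) :
    cos z + cos (z + w + h) + cos (z + w - h) + cos (z - w + h) + cos (z - w - h) = 0 := by
  rw [cos_sub (z - w), cos_add (z - w), cos_sub (z + w), cos_add (z + w), cos_sub z, cos_add z]
  linear_combination cos z * e

theorem two_cos_mul_cos (p q : ℝ) : 2 * cos p * cos q = cos (q + p) + cos (q - p) := by
  rw [cos_add, cos_sub]
  ring

theorem arc_height_mem {t : ℝ} (h : t ∈ Icc (-(2 * π / 5)) (4 * π / 5)) :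
    3 * kap t / 2 - t / 4 ∈ Ioc 0 π := by
  obtain ⟨h1, h2⟩ := h
  have habs : |t| ≤ 4 * π / 5 := abs_le.2 ⟨by linarith [pi_pos], h2⟩
  have hk := pi_div_two_lt_kap habs
  have hk2 := kap_le habs
  have hc := cos_half_gt habs
  refine ⟨by linarith [pi_pos], ?_⟩
  -- Under cosine this becomes 4u² - 2u - 1 ≤ 0 for u = cos (π/3 + t/3). The roots cos (π/5) and cos
  -- (3π/5) are the values at the two ends of the interval.
  suffices kap t ≤ 2 * π / 3 + t / 6 by linarith
  by_contra! hlt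
  have h3 : cos (kap t) < cos (2 * π / 3 + t / 6) :=
    cos_lt_cos_of_nonneg_of_le_pi (by linarith [pi_pos]) (by linarith [pi_pos]) hlt
  rw [cos_kap habs] at h3
  have h4 := mul_lt_mul_of_pos_right h3 (show 0 < 4 * cos (t / 2) by linarith)
  rw [neg_mul, one_div_mul_cancel (by linarith)] at h4
  have e := two_cos_mul_cos (t / 2) (2 * π / 3 + t / 6)
  rw [show 2 * π / 3 + t / 6 + t / 2 = 2 * (π / 3 + t / 3) by ring,
    show 2 * π / 3 + t / 6 - t / 2 = π - (π / 3 + t / 3) by ring, cos_pi_sub, cos_two_mul] at e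
  have d1 : cos (π / 3 + t / 3) ≤ cos (π / 5) :=
    cos_le_cos_of_nonneg_of_le_pi (by positivity) (by linarith [pi_pos]) (by linarith)
  have d2 : cos (3 * π / 5) ≤ cos (π / 3 + t / 3) :=
    cos_le_cos_of_nonneg_of_le_pi (by linarith [pi_pos]) (by linarith [pi_pos]) (by linarith)
  rw [cos_pi_div_five] at d1
  rw [cos_three_pi_div_five] at d2
  have hs := Real.sq_sqrt (show (0 : ℝ) ≤ 5 by norm_num)
  nlinarith

theorem bHeight_eq {t : ℝ} (h : |t| ≤ 4 * π / 5) : bHeight t = 2 * π - 2 * kap t := by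
  have h1 := pi_div_two_lt_kap h
  have h2 := kap_le h
  have hc := cos_half_gt h
  have hc0 : cos (t / 2) ≠ 0 := by linarith
  rw [bHeight, ← arccos_cos (x := 2 * π - 2 * kap t) (by linarith [pi_pos]) (by linarith)]
  congr 1
  rw [cos_two_pi_sub, cos_two_mul, cos_kap h, show t = 2 * (t / 2) by ring, cos_two_mul,
    show 2 * (t / 2) / 2 = t / 2 by ring]
  field_simp
  ring

/-- Identifies the planar side with an arc of a symmetry curve by giving one shape both
descriptions: its reduced coordinates, and the coordinates after undoing the rotation. -/
theorem exists_right_arc {t : ℝ} (ht : t ∈ Icc (-(2 * π / 5)) (4 * π / 5)) :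
    ∃ s, HasReducedAlpha s ((arc t + t) / 2) ((arc t - t) / 2) (3 * kap t / 2 - t / 4) ∧
      HasAlpha ((vertexRot ^ 1)⁻¹ s) (-bHeight t) t 0 := by
  have habs : |t| ≤ 4 * π / 5 := abs_le.2 ⟨by linarith [ht.1, pi_pos], ht.2⟩
  have hc := cos_half_gt habs
  have e : 4 * cos (kap t) * cos (t / 2) = -1 := by
    rw [cos_kap habs]
    field_simp
  obtain ⟨s, hs, h1⟩ := exists_hasAlpha (a₁ := (arc t + t) / 2) (a₂ := (arc t - t) / 2)
    (a₃ := 3 * kap t / 2 - t / 4) (c := 2 * kap t + t / 2 + π) (by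
      intro x
      rw [two_cos_mul_cos, two_cos_mul_cos, ← add_assoc x, cos_add_pi]
      -- The edge of direction x + kap t is the axis; the others deviate from it by ± kap t ± t/2,
      -- and the combination with both signs positive is the closing edge.
      have := five_cos e (x + kap t)
      rw [arc]
      rw [show x + kap t + kap t + t / 2 = x + (2 * kap t + t / 2) by ring] at this
      rw [← sub_eq_zero, ← this]
      ring_nf)
  obtain ⟨m1, m2⟩ := arc_mem_Icc ht
  obtain ⟨m3, m4⟩ := abs_le.1 habs
  refine ⟨s, ⟨hs, ⟨by linarith [pi_pos], by linarith [pi_pos]⟩,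
    ⟨by linarith [pi_pos], by linarith [pi_pos]⟩, arc_height_mem ht⟩, ?_⟩
  obtain ⟨h2, h3, -⟩ := hs
  refine ⟨?_, ?_, ?_⟩ <;> rw [vertexRot_pow_inv_apply]
  · rw [show (2 - (1 : ℕ) : ZMod 5) = 1 by decide, h1]
    exact Real.Angle.angle_eq_iff_two_pi_dvd_sub.2 ⟨-1, by rw [arc]; push_cast; ring⟩
  · rw [show (3 - (1 : ℕ) : ZMod 5) = 2 by decide, h2, ← sub_eq_zero, ← Real.Angle.coe_sub,
      bHeight_eq habs, arc, ← Real.Angle.coe_zero]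
    congr 1; ring
  · rw [show (4 - (1 : ℕ) : ZMod 5) = 3 by decide, h3]
    exact Real.Angle.angle_eq_iff_two_pi_dvd_sub.2 ⟨-1, by push_cast; ring⟩

theorem exists_top_arc {t : ℝ} (ht : t ∈ Icc (-(2 * π / 5)) (4 * π / 5)) :
    ∃ s, HasReducedAlpha s ((-t + arc t) / 2) ((-t - arc t) / 2) (3 * kap t / 2 - t / 4) ∧
      HasAlpha ((vertexRot ^ 3)⁻¹ s) t (bHeight t) 0 := by
  have habs : |t| ≤ 4 * π / 5 := abs_le.2 ⟨by linarith [ht.1, pi_pos], ht.2⟩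
  have hc := cos_half_gt habs
  have e : 4 * cos (kap t) * cos (t / 2) = -1 := by
    rw [cos_kap habs]
    field_simp
  obtain ⟨s, hs, h1⟩ := exists_hasAlpha (a₁ := (-t + arc t) / 2) (a₂ := (-t - arc t) / 2)
    (a₃ := 3 * kap t / 2 - t / 4) (c := -(kap t / 2) - 3 * t / 4 + π) (by
      intro x
      rw [two_cos_mul_cos, two_cos_mul_cos, ← add_assoc x, cos_add_pi]
      have := five_cos e (x + kap t / 2 - t / 4)
      rw [arc]
      rw [show x + kap t / 2 - t / 4 - kap t - t / 2 = x + (-(kap t / 2) - 3 * t / 4) by ring]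
        at this
      rw [← sub_eq_zero, ← this]
      ring_nf)
  obtain ⟨m1, m2⟩ := arc_mem_Icc ht
  obtain ⟨m3, m4⟩ := abs_le.1 habs
  refine ⟨s, ⟨hs, ⟨by linarith [pi_pos], by linarith [pi_pos]⟩,
    ⟨by linarith [pi_pos], by linarith [pi_pos]⟩, arc_height_mem ht⟩, ?_⟩
  have hsum := sum_relAngle s
  obtain ⟨h2, h3, h4⟩ := hs
  have h2p := Real.Angle.coe_two_pi
  have e4 : s.1 4 = ((-(bHeight t - π) - 0 : ℝ) : Real.Angle) := by
    rw [h4, ← sub_eq_zero, ← Real.Angle.coe_sub, bHeight_eq habs, ← h2p, arc]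
    congr 1; ring
  have e1 : s.1 1 = ((-(bHeight t - π) + 0 : ℝ) : Real.Angle) := by
    rw [h1, ← sub_eq_zero, ← Real.Angle.coe_sub, bHeight_eq habs, arc, ← Real.Angle.coe_zero]
    congr 1; ring
  refine ⟨?_, ?_, ?_⟩ <;> rw [vertexRot_pow_inv_apply]
  · rw [show (2 - (3 : ℕ) : ZMod 5) = 4 by decide, e4]
  · rw [show (3 - (3 : ℕ) : ZMod 5) = 0 by decide]
    rw [h2, h3, e4, e1, ← sub_eq_zero] at hsum
    rw [← sub_eq_zero, ← hsum]
    rw [add_assoc (s.1 0), add_assoc (s.1 0), add_assoc (s.1 0), add_sub_assoc, sub_eq_add_neg]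
    congr 1
    rw [← Real.Angle.coe_neg, ← Real.Angle.coe_add, ← Real.Angle.coe_add, ← Real.Angle.coe_add,
      ← Real.Angle.coe_sub, bHeight_eq habs, arc, ← sub_eq_zero, ← Real.Angle.coe_sub, ← h2p]
    congr 1; ring
  · rw [show (4 - (3 : ℕ) : ZMod 5) = 1 by decide, e1]

theorem quad_cos_ne_zero {s : LabelledShape} {p : ℝ × ℝ} (hs : planeCoord s = p) (hp : p ∈ quad) :
    cos ((planeCoord s).1 / 2) * cos ((planeCoord s).2 / 2) ≠ 0 := by
  rw [hs]
  exact (cos_mul_cos_pos (quad_subset_lens hp)).ne'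

theorem perm_apply_inv {α : Type*} (g : Equiv.Perm α) (x : α) : g (g⁻¹ x) = x := by
  rw [← Equiv.Perm.mul_apply, mul_inv_cancel, Equiv.Perm.one_apply]

theorem mem_right_arc {s : LabelledShape} : s ∈ ⇑(vertexRot ^ 1) '' b₄ ↔
    ∃ t ∈ Icc (-(2 * π / 5)) (4 * π / 5), planeCoord s = (arc t, t) := by
  constructor
  · rintro ⟨u, ⟨t, ht, hu⟩, rfl⟩
    obtain ⟨s, hs, hs'⟩ := exists_right_arc ht
    have : u = (vertexRot ^ 1)⁻¹ s := hu.unique hs'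
    refine ⟨t, ht, ?_⟩
    rw [this, perm_apply_inv, hs.planeCoord_eq]
    ext <;> simp only <;> ring
  · rintro ⟨t, ht, h⟩
    obtain ⟨u, hu, hu'⟩ := exists_right_arc ht
    have hc := hu.planeCoord_eq
    rw [show (arc t + t) / 2 + (arc t - t) / 2 = arc t by ring,
      show (arc t + t) / 2 - (arc t - t) / 2 = t by ring] at hc
    have : s = u := eq_of_planeCoord_eq (h.trans hc.symm) (quad_cos_ne_zero h (arc_mem_quad ht))
    exact ⟨(vertexRot ^ 1)⁻¹ u, ⟨t, ht, hu'⟩, by rw [this, perm_apply_inv]⟩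

theorem mem_top_arc {s : LabelledShape} : s ∈ ⇑(vertexRot ^ 3) '' b₁ ↔
    ∃ t ∈ Icc (-(2 * π / 5)) (4 * π / 5), planeCoord s = (-t, arc t) := by
  constructor
  · rintro ⟨u, ⟨t, ht, hu⟩, rfl⟩
    obtain ⟨s, hs, hs'⟩ := exists_top_arc ht
    have : u = (vertexRot ^ 3)⁻¹ s := hu.unique hs'
    refine ⟨t, ht, ?_⟩
    rw [this, perm_apply_inv, hs.planeCoord_eq]
    ext <;> simp only <;> ring
  · rintro ⟨t, ht, h⟩
    obtain ⟨u, hu, hu'⟩ := exists_top_arc ht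
    have hc := hu.planeCoord_eq
    rw [show (-t + arc t) / 2 + (-t - arc t) / 2 = -t by ring,
      show (-t + arc t) / 2 - (-t - arc t) / 2 = arc t by ring] at hc
    have : s = u := eq_of_planeCoord_eq (h.trans hc.symm)
      (quad_cos_ne_zero h (rot_mem_quad.2 (arc_mem_quad ht)))
    exact ⟨(vertexRot ^ 3)⁻¹ u, ⟨t, ht, hu'⟩, by rw [this, perm_apply_inv]⟩

/-! ### The vertex reflection -/

/-- V keeps α₃ and is the point reflection of the plane; it transfers the right and upper sides to
the left and lower ones. -/
theorem HasAlpha.vertexRefl {s : LabelledShape} {a₁ a₂ a₃ : ℝ} (h : HasAlpha s a₁ a₂ a₃) :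
    HasAlpha (vertexRefl s) (-a₁) (-a₂) a₃ := by
  obtain ⟨h2, h3, h4⟩ := h
  have h2p := Real.Angle.coe_two_pi
  refine ⟨?_, ?_, ?_⟩ <;> rw [vertexRefl_apply]
  · rw [show (6 - 2 : ZMod 5) = 4 by decide, h4, ← Real.Angle.coe_neg, ← sub_eq_zero,
      ← Real.Angle.coe_sub, ← neg_zero, ← h2p, ← Real.Angle.coe_neg]
    congr 1; ring
  · rw [show (6 - 3 : ZMod 5) = 3 by decide, h3, ← Real.Angle.coe_neg, ← sub_eq_zero,
      ← Real.Angle.coe_sub, ← h2p]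
    congr 1; ring
  · rw [show (6 - 4 : ZMod 5) = 2 by decide, h2, ← Real.Angle.coe_neg, ← sub_eq_zero,
      ← Real.Angle.coe_sub, ← neg_zero, ← h2p, ← Real.Angle.coe_neg]
    congr 1; ring

theorem hasReducedAlpha_vertexRefl {s : LabelledShape} (h : planeCoord s ∈ lens) :
    HasReducedAlpha (vertexRefl s) (-red₁ s) (-red₂ s) (red₃ s) := by
  obtain ⟨h1, h2⟩ := red₁_lt h
  obtain ⟨h3, h4⟩ := abs_lt.1 h1
  obtain ⟨h5, h6⟩ := abs_lt.1 h2
  have hr := hasReducedAlpha_red s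
  exact ⟨hr.1.vertexRefl, ⟨by linarith, by linarith⟩, ⟨by linarith, by linarith⟩, hr.2.2.2⟩

theorem planeCoord_vertexRefl {s : LabelledShape} (h : planeCoord s ∈ lens) :
    planeCoord (vertexRefl s) = -planeCoord s := by
  rw [(hasReducedAlpha_vertexRefl h).planeCoord_eq, planeCoord]
  ext <;> simp only [Prod.neg_mk] <;> ring

theorem vertexRefl_mem_tile {s : LabelledShape} (h : s ∈ tile) : vertexRefl s ∈ tile := by
  show planeCoord _ ∈ quad
  rw [planeCoord_vertexRefl (quad_subset_lens h)]
  exact neg_mem_quad.2 h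

theorem vertexRefl_image_tile : vertexRefl '' tile = tile := by
  apply subset_antisymm
  · rintro _ ⟨s, hs, rfl⟩
    exact vertexRefl_mem_tile hs
  · intro s hs
    exact ⟨vertexRefl s, vertexRefl_mem_tile hs, vertexRefl_vertexRefl s⟩

theorem vertexRefl_vertexRot_pow (k l : ℕ) (h : k + l = 5) (s : LabelledShape) :
    vertexRefl ((vertexRot ^ k) s) = (vertexRot ^ l) (vertexRefl s) := by
  refine shape_ext fun i => ?_
  have : (k : ZMod 5) + l = 0 := by
    rw [← Nat.cast_add, h]
    rfl
  rw [vertexRefl_apply, vertexRot_pow_apply, vertexRot_pow_apply, vertexRefl_apply]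
  refine congrArg (fun j => -s.1 j) ?_
  linear_combination this

theorem vertexRefl_mem_b₂ {s : LabelledShape} (h : s ∈ b₄) : vertexRefl s ∈ b₂ := by
  obtain ⟨t, ht, h⟩ := h
  refine ⟨t, ht, ?_⟩
  simpa only [neg_neg] using h.vertexRefl

theorem vertexRefl_mem_b₄ {s : LabelledShape} (h : s ∈ b₂) : vertexRefl s ∈ b₄ := by
  obtain ⟨t, ht, h⟩ := h
  refine ⟨t, ht, ?_⟩
  simpa only [neg_neg] using h.vertexRefl

theorem vertexRefl_mem_b₃ {s : LabelledShape} (h : s ∈ b₁) : vertexRefl s ∈ b₃ := by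
  obtain ⟨t, ht, h⟩ := h
  exact ⟨t, ht, h.vertexRefl⟩

theorem vertexRefl_mem_b₁ {s : LabelledShape} (h : s ∈ b₃) : vertexRefl s ∈ b₁ := by
  obtain ⟨t, ht, h⟩ := h
  refine ⟨t, ht, ?_⟩
  simpa only [neg_neg] using h.vertexRefl

theorem left_arc_iff {s : LabelledShape} :
    s ∈ ⇑(vertexRot ^ 4) '' b₂ ↔ vertexRefl s ∈ ⇑(vertexRot ^ 1) '' b₄ := by
  constructor
  · rintro ⟨u, hu, rfl⟩
    exact ⟨vertexRefl u, vertexRefl_mem_b₄ hu, (vertexRefl_vertexRot_pow 4 1 rfl u).symm⟩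
  · rintro ⟨u, hu, h⟩
    refine ⟨vertexRefl u, vertexRefl_mem_b₂ hu, ?_⟩
    rw [← vertexRefl_vertexRot_pow 1 4 rfl, h, vertexRefl_vertexRefl]

theorem bottom_arc_iff {s : LabelledShape} :
    s ∈ ⇑(vertexRot ^ 2) '' b₃ ↔ vertexRefl s ∈ ⇑(vertexRot ^ 3) '' b₁ := by
  constructor
  · rintro ⟨u, hu, rfl⟩
    exact ⟨vertexRefl u, vertexRefl_mem_b₁ hu, (vertexRefl_vertexRot_pow 2 3 rfl u).symm⟩
  · rintro ⟨u, hu, h⟩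
    refine ⟨vertexRefl u, vertexRefl_mem_b₃ hu, ?_⟩
    rw [← vertexRefl_vertexRot_pow 3 2 rfl, h, vertexRefl_vertexRefl]

theorem planeCoord_eq_neg_iff {s : LabelledShape} {p : ℝ × ℝ} (hp : p ∈ quad) :
    planeCoord (vertexRefl s) = p ↔ planeCoord s = -p := by
  have hp' : -p ∈ quad := neg_mem_quad.2 hp
  constructor
  · intro h
    have := planeCoord_vertexRefl (s := vertexRefl s) (by rw [h]; exact quad_subset_lens hp)
    rwa [vertexRefl_vertexRefl, h] at this
  · intro h
    rw [planeCoord_vertexRefl (by rw [h]; exact quad_subset_lens hp'), h, neg_neg]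

theorem mem_left_arc {s : LabelledShape} : s ∈ ⇑(vertexRot ^ 4) '' b₂ ↔
    ∃ t ∈ Icc (-(2 * π / 5)) (4 * π / 5), planeCoord s = (-arc t, -t) := by
  rw [left_arc_iff, mem_right_arc]
  exact exists_congr fun t => and_congr_right fun ht => planeCoord_eq_neg_iff (arc_mem_quad ht)

theorem mem_bottom_arc {s : LabelledShape} : s ∈ ⇑(vertexRot ^ 2) '' b₃ ↔
    ∃ t ∈ Icc (-(2 * π / 5)) (4 * π / 5), planeCoord s = (t, -arc t) := by
  rw [bottom_arc_iff, mem_top_arc]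
  refine exists_congr fun t => and_congr_right fun ht => ?_
  rw [planeCoord_eq_neg_iff (rot_mem_quad.2 (arc_mem_quad ht)), Prod.neg_mk, neg_neg]

/-! ### The boundary of the fundamental region -/

/-- The union of the four arcs. -/
def arcs : Set LabelledShape :=
  ⇑(vertexRot ^ 1) '' b₄ ∪ ⇑(vertexRot ^ 3) '' b₁ ∪ ⇑(vertexRot ^ 4) '' b₂ ∪ ⇑(vertexRot ^ 2) '' b₃

theorem arcs_subset_tile : arcs ⊆ tile := by
  intro s hs
  have hq : ∀ {t}, t ∈ Icc (-(2 * π / 5)) (4 * π / 5) → (arc t, t) ∈ quad := arc_mem_quad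
  simp only [arcs, mem_union, mem_right_arc, mem_top_arc, mem_left_arc, mem_bottom_arc] at hs
  show planeCoord s ∈ quad
  rcases hs with ((⟨t, ht, h⟩ | ⟨t, ht, h⟩) | ⟨t, ht, h⟩) | ⟨t, ht, h⟩ <;> rw [h]
  · exact hq ht
  · exact rot_mem_quad.2 (hq ht)
  · exact neg_mem_quad.2 (hq ht)
  · rw [← rot_mem_quad, neg_neg]
    exact hq ht

theorem mem_cell_or_arcs {s : LabelledShape} (h : s ∈ tile) : s ∈ cell ∨ s ∈ arcs := by
  rcases quad_cases h with h | ⟨t, ht, h⟩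
  · exact Or.inl h
  · right
    simp only [arcs, mem_union, mem_right_arc, mem_top_arc, mem_left_arc, mem_bottom_arc]
    rcases h with h | h | h | h
    · exact Or.inl (Or.inl (Or.inl ⟨t, ht, h⟩))
    · exact Or.inl (Or.inl (Or.inr ⟨t, ht, h⟩))
    · exact Or.inl (Or.inr ⟨t, ht, h⟩)
    · exact Or.inr ⟨t, ht, h⟩

theorem image_subset_symCurve (k : ℕ) {b : Set LabelledShape}
    (hb : b ⊆ {s | ∃ a₁ a₂ : ℝ, HasAlpha s a₁ a₂ 0}) : ⇑(vertexRot ^ k) '' b ⊆ symCurve k :=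
  image_mono hb

theorem right_arc_subset : ⇑(vertexRot ^ 1) '' b₄ ⊆ symCurve 1 :=
  image_subset_symCurve 1 fun _ ⟨_, _, h⟩ => ⟨_, _, h⟩

theorem top_arc_subset : ⇑(vertexRot ^ 3) '' b₁ ⊆ symCurve 3 :=
  image_subset_symCurve 3 fun _ ⟨_, _, h⟩ => ⟨_, _, h⟩

theorem left_arc_subset : ⇑(vertexRot ^ 4) '' b₂ ⊆ symCurve 4 :=
  image_subset_symCurve 4 fun _ ⟨_, _, h⟩ => ⟨_, _, h⟩

theorem bottom_arc_subset : ⇑(vertexRot ^ 2) '' b₃ ⊆ symCurve 2 :=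
  image_subset_symCurve 2 fun _ ⟨_, _, h⟩ => ⟨_, _, h⟩

/-- A point of an arc lies on one of the symmetry curves other than `symCurve 0`. -/
theorem exists_symCurve_of_mem_arcs {s : LabelledShape} (h : s ∈ arcs) :
    ∃ k < 5, k ≠ 0 ∧ s ∈ symCurve k := by
  rcases h with ((h | h) | h) | h
  · exact ⟨1, by norm_num, by norm_num, right_arc_subset h⟩
  · exact ⟨3, by norm_num, by norm_num, top_arc_subset h⟩
  · exact ⟨4, by norm_num, by norm_num, left_arc_subset h⟩
  · exact ⟨2, by norm_num, by norm_num, bottom_arc_subset h⟩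

theorem not_mem_symCurve_zero {s : LabelledShape} (h : s ∈ tile) (hr : ¬ IsRegular s) :
    s ∉ symCurve 0 := by
  intro h0
  rcases mem_cell_or_arcs h with h1 | h1
  · exact not_mem_symCurve_zero_of_mem_cell h1 h0
  · obtain ⟨k, hk, hk0, h2⟩ := exists_symCurve_of_mem_arcs h1
    exact hr (isRegular_of_two_symCurves hk (by norm_num) hk0 h2 h0)

theorem continuousAt_planeCoord_of_mem_tile {s : LabelledShape} (h : s ∈ tile)
    (hr : ¬ IsRegular s) : ContinuousAt planeCoord s :=
  continuousAt_planeCoord (quad_subset_lens h) (not_mem_symCurve_zero h hr)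

/-! ### Two functions vanishing on symmetry curves -/

/-- A function on shapes vanishing on the symmetry curves 1 and 4. -/
def wallA (s : LabelledShape) : ℝ :=
  1 - 2 * (s.1 2 + s.1 3 + s.1 4).cos + 2 * (s.1 2 + s.1 3 + s.1 3 + s.1 4).cos

/-- A function on shapes vanishing on the symmetry curves 2 and 3. -/
def wallB (s : LabelledShape) : ℝ := 1 - 2 * (s.1 3).cos + 2 * (s.1 2 + s.1 4).cos

theorem continuous_wallA : Continuous wallA := by
  have h := continuous_eval
  have := Real.Angle.continuous_cos
  exact (continuous_const.sub (continuous_const.mul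
    (this.comp (((h 2).add (h 3)).add (h 4))))).add
    (continuous_const.mul (this.comp ((((h 2).add (h 3)).add (h 3)).add (h 4))))

theorem continuous_wallB : Continuous wallB := by
  have h := continuous_eval
  have := Real.Angle.continuous_cos
  exact (continuous_const.sub (continuous_const.mul (this.comp (h 3)))).add
    (continuous_const.mul (this.comp ((h 2).add (h 4))))

/-- Links a globally continuous function of the angles to one pair of sides: for moderate x, y its
sign decides |x + y/2| < kap y (`one_add_cos_pos_iff`). -/
theorem wallA_eq (s : LabelledShape) : wallA s =
    1 + 4 * cos ((planeCoord s).1 + (planeCoord s).2 / 2) * cos ((planeCoord s).2 / 2) := by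
  obtain ⟨h2, h3, h4⟩ := (hasReducedAlpha_red s).1
  have e1 : s.1 2 + s.1 3 + s.1 4 = ((π - (red₁ s + red₂ s) : ℝ) : Real.Angle) := by
    rw [h2, h3, h4, ← Real.Angle.coe_add, ← Real.Angle.coe_add]
    congr 1; ring
  have e2 : s.1 2 + s.1 3 + s.1 3 + s.1 4 = ((-(2 * red₁ s) : ℝ) : Real.Angle) := by
    rw [h2, h3, h4, ← Real.Angle.coe_add, ← Real.Angle.coe_add, ← Real.Angle.coe_add]
    congr 1; ring
  have e3 := two_cos_mul_cos ((planeCoord s).2 / 2) ((planeCoord s).1 + (planeCoord s).2 / 2)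
  simp only [planeCoord] at e3 ⊢
  rw [show red₁ s + red₂ s + (red₁ s - red₂ s) / 2 + (red₁ s - red₂ s) / 2 = 2 * red₁ s by ring,
    show red₁ s + red₂ s + (red₁ s - red₂ s) / 2 - (red₁ s - red₂ s) / 2 = red₁ s + red₂ s by ring]
    at e3
  rw [wallA, e1, e2, Real.Angle.cos_coe, Real.Angle.cos_coe, cos_pi_sub, cos_neg]
  linear_combination (-2) * e3

theorem wallB_eq (s : LabelledShape) : wallB s =
    1 + 4 * cos ((planeCoord s).2 - (planeCoord s).1 / 2) * cos ((planeCoord s).1 / 2) := by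
  obtain ⟨h2, h3, h4⟩ := (hasReducedAlpha_red s).1
  have e1 : s.1 3 = ((-(π + (red₁ s - red₂ s)) : ℝ) : Real.Angle) := by
    rw [h3]
    congr 1; ring
  have e2 : s.1 2 + s.1 4 = ((2 * π - 2 * red₂ s : ℝ) : Real.Angle) := by
    rw [h2, h4, ← Real.Angle.coe_add]
    congr 1; ring
  have e3 := two_cos_mul_cos ((planeCoord s).1 / 2) ((planeCoord s).2 - (planeCoord s).1 / 2)
  simp only [planeCoord] at e3 ⊢
  rw [show red₁ s - red₂ s - (red₁ s + red₂ s) / 2 + (red₁ s + red₂ s) / 2 = red₁ s - red₂ s by ring,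
    show red₁ s - red₂ s - (red₁ s + red₂ s) / 2 - (red₁ s + red₂ s) / 2 = -(2 * red₂ s) by ring,
    cos_neg] at e3
  rw [wallB, e1, e2, Real.Angle.cos_coe, Real.Angle.cos_coe, cos_neg, add_comm π, cos_add_pi,
    cos_two_pi_sub]
  linear_combination (-2) * e3

theorem one_add_cos_pos_iff {t x : ℝ} (ht : |t| ≤ 4 * π / 5) (hx : |x| ≤ π) :
    0 < 1 + 4 * cos x * cos (t / 2) ↔ |x| < kap t := by
  have hb := cos_half_gt ht
  have hk := cos_kap ht
  have h1 := pi_div_two_lt_kap ht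
  have h2 := kap_le ht
  rw [← strictAntiOn_cos.lt_iff_gt ⟨by linarith [pi_pos], by linarith [pi_pos]⟩
    ⟨abs_nonneg x, hx⟩, hk, cos_abs, neg_lt, ← sub_pos, ← sub_pos (b := -cos x)]
  have : 1 / (4 * cos (t / 2)) - -cos x
    = (1 + 4 * cos x * cos (t / 2)) / (4 * cos (t / 2)) := by
    field_simp
    ring
  rw [this, div_pos_iff_of_pos_right (by linarith)]
  simp

theorem one_add_cos_nonneg_iff {t x : ℝ} (ht : |t| ≤ 4 * π / 5) (hx : |x| ≤ π) :
    0 ≤ 1 + 4 * cos x * cos (t / 2) ↔ |x| ≤ kap t := by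
  have hb := cos_half_gt ht
  have hk := cos_kap ht
  have h1 := pi_div_two_lt_kap ht
  have h2 := kap_le ht
  rw [← strictAntiOn_cos.le_iff_ge ⟨by linarith [pi_pos], by linarith [pi_pos]⟩
    ⟨abs_nonneg x, hx⟩, hk, cos_abs, neg_le, ← sub_nonneg, ← sub_nonneg (b := -cos x)]
  have : 1 / (4 * cos (t / 2)) - -cos x
    = (1 + 4 * cos x * cos (t / 2)) / (4 * cos (t / 2)) := by
    field_simp
    ring
  rw [this, le_div_iff₀ (by linarith), zero_mul, sub_zero]

theorem wallA_pos {s : LabelledShape} (h : |(planeCoord s).2| ≤ 4 * π / 5)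
    (h' : |(planeCoord s).1 + (planeCoord s).2 / 2| < kap (planeCoord s).2) : 0 < wallA s := by
  rw [wallA_eq, one_add_cos_pos_iff h (by linarith [kap_le h, pi_pos])]
  exact h'

theorem wallB_pos {s : LabelledShape} (h : |(planeCoord s).1| ≤ 4 * π / 5)
    (h' : |(planeCoord s).2 - (planeCoord s).1 / 2| < kap (planeCoord s).1) : 0 < wallB s := by
  rw [wallB_eq, one_add_cos_pos_iff h (by linarith [kap_le h, pi_pos])]
  exact h'

theorem wallA_pos_of_mem_cell {s : LabelledShape} (h : s ∈ cell) : 0 < wallA s :=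
  wallA_pos h.2.1.le h.2.2.1

theorem wallB_pos_of_mem_cell {s : LabelledShape} (h : s ∈ cell) : 0 < wallB s :=
  wallB_pos h.1.le h.2.2.2

theorem wallA_vertexRefl (s : LabelledShape) : wallA (vertexRefl s) = wallA s := by
  simp only [wallA, vertexRefl_apply]
  rw [show (6 - 2 : ZMod 5) = 4 by decide, show (6 - 3 : ZMod 5) = 3 by decide,
    show (6 - 4 : ZMod 5) = 2 by decide, ← Real.Angle.cos_neg,
    ← Real.Angle.cos_neg (-s.1 4 + -s.1 3 + -s.1 3 + -s.1 2)]
  congr 4 <;> abel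

theorem wallB_vertexRefl (s : LabelledShape) : wallB (vertexRefl s) = wallB s := by
  simp only [wallB, vertexRefl_apply]
  rw [show (6 - 2 : ZMod 5) = 4 by decide, show (6 - 3 : ZMod 5) = 3 by decide,
    show (6 - 4 : ZMod 5) = 2 by decide, Real.Angle.cos_neg,
    ← Real.Angle.cos_neg (-s.1 4 + -s.1 2)]
  congr 3
  abel

theorem involution_zero_apply (s : LabelledShape) : (involution 0 s).1 2 = s.1 4 ∧
    (involution 0 s).1 3 = s.1 3 ∧ (involution 0 s).1 4 = s.1 2 := by
  simp only [involution_apply]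
  exact ⟨rfl, rfl, rfl⟩

theorem wallA_involution_zero (s : LabelledShape) : wallA (involution 0 s) = wallA s := by
  obtain ⟨h2, h3, h4⟩ := involution_zero_apply s
  rw [wallA, h2, h3, h4, wallA, show s.1 4 + s.1 3 + s.1 2 = s.1 2 + s.1 3 + s.1 4 by abel,
    show s.1 4 + s.1 3 + s.1 3 + s.1 2 = s.1 2 + s.1 3 + s.1 3 + s.1 4 by abel]

theorem wallB_involution_zero (s : LabelledShape) : wallB (involution 0 s) = wallB s := by
  obtain ⟨h2, h3, h4⟩ := involution_zero_apply s
  rw [wallB, h2, h3, h4, wallB, add_comm (s.1 4)]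

/-- The closing relation in direction ψ₃ + ψ₄ cancels all but one cosine, leaving a nonnegative sum.
Hence of a shape and its reflection at least one is on the inner side of the wall; on the fixed
curve the sum vanishes. -/
theorem wallA_add_wallA (s : LabelledShape) : wallA s + wallA (involution 1 s)
    = 2 + 2 * (s.1 2 + s.1 3 + s.1 3 + s.1 4 + s.1 4).cos := by
  have hp := Real.Angle.coe_pi_add_coe_pi
  have hs := sum_relAngle s
  have e2 : (involution 1 s).1 2 = s.1 2 := by rw [involution_apply]; rfl
  have e3 : (involution 1 s).1 3 = s.1 1 := by rw [involution_apply]; rfl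
  have e4 : (involution 1 s).1 4 = s.1 0 := by rw [involution_apply]; rfl
  have c := closing s (s.1 3 + s.1 4)
  have a1 : (s.1 2 + s.1 1 + s.1 0).cos = -(s.1 3 + s.1 4).cos := by
    rw [← Real.Angle.cos_neg (s.1 3 + s.1 4), ← Real.Angle.cos_add_pi]
    congr 1
    linear_combination (norm := module) hs
  have a2 : (s.1 2 + s.1 1 + s.1 1 + s.1 0).cos = -(s.1 3 + s.1 4 - s.1 1).cos := by
    rw [← Real.Angle.cos_neg (s.1 3 + s.1 4 - s.1 1), ← Real.Angle.cos_add_pi]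
    congr 1
    linear_combination (norm := module) hs
  rw [wallA, wallA, e2, e3, e4, a1, a2]
  rw [show s.1 3 + s.1 4 + s.1 2 = s.1 2 + s.1 3 + s.1 4 by abel,
    show s.1 2 + s.1 3 + s.1 4 + s.1 3 = s.1 2 + s.1 3 + s.1 3 + s.1 4 by abel] at c
  linarith

theorem wallB_add_wallB (s : LabelledShape) : wallB s + wallB (involution 3 s)
    = 2 - 2 * (s.1 2 - s.1 3).cos := by
  have e2 : (involution 3 s).1 2 = s.1 3 := by rw [involution_apply]; rfl
  have e3 : (involution 3 s).1 3 = s.1 2 := by rw [involution_apply]; rfl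
  have e4 : (involution 3 s).1 4 = s.1 1 := by rw [involution_apply]; rfl
  have c := closing s (-s.1 3)
  rw [wallB, wallB, e2, e3, e4]
  rw [Real.Angle.cos_neg, show -s.1 3 + s.1 2 = s.1 2 - s.1 3 by abel, sub_add_cancel,
    show -s.1 3 - s.1 1 = -(s.1 3 + s.1 1) by abel, Real.Angle.cos_neg] at c
  linarith

theorem angle_cos_mem (θ : Real.Angle) : -1 ≤ θ.cos ∧ θ.cos ≤ 1 := by
  induction θ using Real.Angle.induction_on with
  | h x => exact ⟨neg_one_le_cos x, cos_le_one x⟩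

theorem involution_vertexRefl {k l : ℕ} (h : k + l = 5) (s : LabelledShape) :
    involution l (vertexRefl s) = vertexRefl (involution k s) := by
  refine shape_ext fun i => ?_
  have : (k : ZMod 5) + l = 0 := by
    rw [← Nat.cast_add, h]
    rfl
  rw [vertexRefl_apply, involution_apply, involution_apply, vertexRefl_apply]
  refine congrArg (fun j => -s.1 j) ?_
  have h5 : (5 : ZMod 5) = 0 := rfl
  linear_combination 2 * this + 2 * h5

theorem wallA_add_nonneg {k : ℕ} (hk : k = 1 ∨ k = 4) (s : LabelledShape) :
    0 ≤ wallA s + wallA (involution k s) := by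
  rcases hk with rfl | rfl
  · rw [wallA_add_wallA]
    linarith [(angle_cos_mem (s.1 2 + s.1 3 + s.1 3 + s.1 4 + s.1 4)).1]
  · rw [← wallA_vertexRefl s, ← wallA_vertexRefl (involution 4 s),
      ← involution_vertexRefl (show 4 + 1 = 5 by norm_num), wallA_add_wallA]
    linarith [(angle_cos_mem ((vertexRefl s).1 2 + (vertexRefl s).1 3 + (vertexRefl s).1 3
      + (vertexRefl s).1 4 + (vertexRefl s).1 4)).1]

theorem wallB_add_nonneg {k : ℕ} (hk : k = 3 ∨ k = 2) (s : LabelledShape) :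
    0 ≤ wallB s + wallB (involution k s) := by
  rcases hk with rfl | rfl
  · rw [wallB_add_wallB]
    linarith [(angle_cos_mem (s.1 2 - s.1 3)).2]
  · rw [← wallB_vertexRefl s, ← wallB_vertexRefl (involution 2 s),
      ← involution_vertexRefl (show 2 + 3 = 5 by norm_num), wallB_add_wallB]
    linarith [(angle_cos_mem ((vertexRefl s).1 2 - (vertexRefl s).1 3)).2]

theorem wallA_eq_zero_aux {s : LabelledShape} (h : involution 1 s = s) : wallA s = 0 := by
  have hs := sum_relAngle s
  have e3 : s.1 1 = s.1 3 := by
    conv_rhs => rw [← h, involution_apply]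
    rfl
  have e4 : s.1 0 = s.1 4 := by
    conv_rhs => rw [← h, involution_apply]
    rfl
  have h1 := wallA_add_wallA s
  rw [h, show s.1 2 + s.1 3 + s.1 3 + s.1 4 + s.1 4 = ((π : ℝ) : Real.Angle) by
    rw [← hs, e3, e4]; abel, Real.Angle.cos_coe_pi] at h1
  linarith

theorem wallB_eq_zero_aux {s : LabelledShape} (h : involution 3 s = s) : wallB s = 0 := by
  have e3 : s.1 2 = s.1 3 := by
    conv_rhs => rw [← h, involution_apply]
    rfl
  have h1 := wallB_add_wallB s
  rw [h, e3, sub_self, Real.Angle.cos_zero] at h1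
  linarith

theorem vertexRefl_fixed {k l : ℕ} (hkl : k + l = 5) {s : LabelledShape} (h : involution k s = s) :
    involution l (vertexRefl s) = vertexRefl s := by
  rw [involution_vertexRefl hkl, h]

theorem wallA_eq_zero {k : ℕ} (hk : k = 1 ∨ k = 4) {s : LabelledShape} (h : involution k s = s) :
    wallA s = 0 := by
  rcases hk with rfl | rfl
  · exact wallA_eq_zero_aux h
  · rw [← wallA_vertexRefl]
    exact wallA_eq_zero_aux (vertexRefl_fixed (by norm_num) h)

theorem wallB_eq_zero {k : ℕ} (hk : k = 3 ∨ k = 2) {s : LabelledShape} (h : involution k s = s) :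
    wallB s = 0 := by
  rcases hk with rfl | rfl
  · exact wallB_eq_zero_aux h
  · rw [← wallB_vertexRefl]
    exact wallB_eq_zero_aux (vertexRefl_fixed (by norm_num) h)

/-! ### The fundamental region avoids the symmetry curves -/

theorem mem_symCurve_iff_fixed {k : ℕ} {s : LabelledShape} :
    s ∈ symCurve k ↔ involution k s = s := by
  rw [symCurve_eq]
  exact Iff.rfl

theorem cell_subset_offCurves : cell ⊆ offCurves := by
  intro s hs
  rw [mem_offCurves_iff]
  intro k hk h
  have hA := wallA_pos_of_mem_cell hs
  have hB := wallB_pos_of_mem_cell hs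
  interval_cases k
  · exact not_mem_symCurve_zero_of_mem_cell hs (mem_symCurve_iff_fixed.2 h)
  · exact hA.ne' (wallA_eq_zero (Or.inl rfl) h)
  · exact hB.ne' (wallB_eq_zero (Or.inr rfl) h)
  · exact hB.ne' (wallB_eq_zero (Or.inl rfl) h)
  · exact hA.ne' (wallA_eq_zero (Or.inr rfl) h)

theorem mem_cell_of_mem_offCurves {s : LabelledShape} (h : s ∈ tile) (h' : s ∈ offCurves) :
    s ∈ cell := by
  rcases mem_cell_or_arcs h with h1 | h1
  · exact h1
  · obtain ⟨k, hk, -, h2⟩ := exists_symCurve_of_mem_arcs h1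
    exact absurd (mem_symCurve_iff_fixed.1 h2) (mem_offCurves_iff.1 h' k hk)

theorem not_isRegular_of_mem_offCurves {s : LabelledShape} (h : s ∈ offCurves) : ¬ IsRegular s :=
  fun hr => mem_offCurves_iff.1 h 0 (by norm_num) (mem_symCurve_iff_fixed.1 (hr.mem_symCurve 0))

/-- Describing the complement of the curves by trivial isotropy makes its invariance under D₅⁺ a
matter of conjugation. -/
theorem mem_offCurves_iff_free {s : LabelledShape} :
    s ∈ offCurves ↔ ∀ g ∈ D5plus, g s = s → g = 1 := by
  constructor
  · intro h g hg hgs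
    rcases eq_one_or_involution_of_fixed hg (not_isRegular_of_mem_offCurves h) hgs with h1 | ⟨k, hk, rfl⟩
    · exact h1
    · exact absurd hgs (mem_offCurves_iff.1 h k hk)
  · intro h
    rw [mem_offCurves_iff]
    intro k hk hks
    exact involution_ne_one hk (h _ (involution_mem k) hks)

theorem map_mem_offCurves {g : Equiv.Perm LabelledShape} (hg : g ∈ D5plus) {s : LabelledShape}
    (h : s ∈ offCurves) : g s ∈ offCurves := by
  rw [mem_offCurves_iff_free] at h ⊢
  intro h' hh' hfix
  have := h (g⁻¹ * h' * g) (mul_mem (mul_mem (inv_mem hg) hh') hg) (by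
    rw [Equiv.Perm.mul_apply, Equiv.Perm.mul_apply, hfix, ← Equiv.Perm.mul_apply, inv_mul_cancel,
      Equiv.Perm.one_apply])
  rw [mul_assoc, inv_mul_eq_one] at this
  exact (mul_eq_right.1 this.symm)

theorem map_mem_offCurves_iff {g : Equiv.Perm LabelledShape} (hg : g ∈ D5plus)
    {s : LabelledShape} : g s ∈ offCurves ↔ s ∈ offCurves := by
  refine ⟨fun h => ?_, map_mem_offCurves hg⟩
  have := map_mem_offCurves (inv_mem hg) h
  rwa [← Equiv.Perm.mul_apply, inv_mul_cancel, Equiv.Perm.one_apply] at this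

/-! ### The images of the fundamental region are disjoint -/

theorem isOpen_image {g : Equiv.Perm LabelledShape} (hg : g ∈ D5plus) {A : Set LabelledShape}
    (hA : IsOpen A) : IsOpen (g '' A) :=
  (symmHomeo ⟨g, hg⟩).isOpenMap A hA

theorem isClosed_image {g : Equiv.Perm LabelledShape} (hg : g ∈ D5plus) {A : Set LabelledShape}
    (hA : IsClosed A) : IsClosed (g '' A) :=
  (symmHomeo ⟨g, hg⟩).isClosedMap A hA

/-- Off the curves the open `cell` coincides with the closed `tile`, so it is open and closed in the
complement, and it is connected. -/
theorem connectedComponentIn_offCurves {g : Equiv.Perm LabelledShape} (hg : g ∈ D5plus)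
    {s : LabelledShape} (hs : s ∈ g '' cell) : connectedComponentIn offCurves s = g '' cell := by
  have hsub : g '' cell ⊆ offCurves := by
    rintro _ ⟨u, hu, rfl⟩
    exact map_mem_offCurves hg (cell_subset_offCurves hu)
  apply subset_antisymm
  · refine isPreconnected_connectedComponentIn.subset_left_of_subset_union
      (isOpen_image hg isOpen_cell) (isClosed_image hg isClosed_tile).isOpen_compl ?_ ?_ ?_
    · exact disjoint_compl_right.mono_left (image_mono cell_subset_tile)
    · intro u hu
      have hu' := connectedComponentIn_subset _ _ hu
      by_cases h : u ∈ g '' tile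
      · obtain ⟨v, hv, rfl⟩ := h
        exact Or.inl ⟨v, mem_cell_of_mem_offCurves hv ((map_mem_offCurves_iff hg).1 hu'), rfl⟩
      · exact Or.inr h
    · exact ⟨s, mem_connectedComponentIn (hsub hs), hs⟩
  · exact (isPreconnected_cell.image g (continuous_of_mem_D5plus hg).continuousOn).subset_connectedComponentIn hs hsub

theorem center_mem_cell : center ∈ cell := by
  have h : HasReducedAlpha center 0 0 (π - arccos (7 / 8)) := by
    refine ⟨hasAlpha_center, ⟨by linarith [pi_pos], pi_pos.le⟩, ⟨by linarith [pi_pos], pi_pos.le⟩,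
      ?_, by linarith [arccos_nonneg (7 / 8)]⟩
    have : arccos (7 / 8) ≠ π := by
      intro h
      rw [arccos_eq_pi] at h
      norm_num at h
    linarith [lt_of_le_of_ne (arccos_le_pi (7 / 8)) this]
  show planeCoord _ ∈ quadInt
  rw [h.planeCoord_eq]
  simp only [add_zero, sub_zero]
  refine zero_mem_quadInt ?_
  rw [abs_zero]
  linarith [pi_div_two_lt_kap (t := 0) (by rw [abs_zero]; positivity), pi_pos]

theorem vertexRefl_center : vertexRefl center = center := by
  have := hasAlpha_center.vertexRefl
  rw [neg_zero] at this
  exact this.unique hasAlpha_center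

theorem center_cos : (center.1 1).cos = 1 / 4 ∧ (center.1 1 + center.1 2).cos = -(1 / 4) := by
  obtain ⟨h2, h3, h4, -⟩ := center_relAngle
  have hc : cos (arccos (7 / 8)) = 7 / 8 := cos_arccos (by norm_num) (by norm_num)
  have h := closing center
  rw [h2, h3, h4] at h
  have h' : ∀ φ : Real.Angle, 2 * φ.cos - 2 * (φ + (arccos (7 / 8) : ℝ)).cos
      = (φ - center.1 1).cos := by
    intro φ
    have := h φ
    rw [Real.Angle.cos_add_pi, show φ + (arccos (7 / 8) : ℝ) + (π : ℝ)
      + ((-arccos (7 / 8) : ℝ) : Real.Angle) = φ + (π : ℝ) by rw [Real.Angle.coe_neg]; abel,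
      Real.Angle.cos_add_pi] at this
    linarith
  constructor
  · have := h' 0
    rw [zero_add, zero_sub, Real.Angle.cos_neg, Real.Angle.cos_zero, Real.Angle.cos_coe, hc] at this
    linarith
  · have := h' (-(arccos (7 / 8) : ℝ))
    rw [neg_add_cancel, Real.Angle.cos_zero, Real.Angle.cos_neg, Real.Angle.cos_coe, hc,
      show -((arccos (7 / 8) : ℝ) : Real.Angle) - center.1 1 = -(center.1 1 + center.1 2) by
        rw [h2]; abel, Real.Angle.cos_neg] at this
    linarith

/-- One wall function takes the value 1 - 7/4 - 1/2 < 0 on the first two rotations; V supplies the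
other two. -/
theorem rot_center_walls {k : ℕ} (hk : k < 5) (h0 : k ≠ 0) :
    wallA ((vertexRot ^ k) center) < 0 ∨ wallB ((vertexRot ^ k) center) < 0 := by
  obtain ⟨h2, h3, h4, h10⟩ := center_relAngle
  obtain ⟨c1, c2⟩ := center_cos
  have hc : cos (arccos (7 / 8)) = 7 / 8 := cos_arccos (by norm_num) (by norm_num)
  have e0 : center.1 0 = -center.1 1 := (neg_eq_of_add_eq_zero_right h10).symm
  have one : wallB ((vertexRot ^ 1) center) < 0 := by
    simp only [wallB, vertexRot_pow_apply]
    rw [show (3 + (1 : ℕ) : ZMod 5) = 4 from rfl, show (2 + (1 : ℕ) : ZMod 5) = 3 from rfl,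
      show (4 + (1 : ℕ) : ZMod 5) = 0 from rfl, h3, h4, e0, add_comm, add_comm ((π : ℝ) : Real.Angle),
      Real.Angle.cos_add_pi, Real.Angle.cos_neg, c1, Real.Angle.cos_coe, cos_neg, hc]
    norm_num
  have two : wallA ((vertexRot ^ 2) center) < 0 := by
    simp only [wallA, vertexRot_pow_apply]
    rw [show (3 + (2 : ℕ) : ZMod 5) = 0 from rfl, show (2 + (2 : ℕ) : ZMod 5) = 4 from rfl,
      show (4 + (2 : ℕ) : ZMod 5) = 1 from rfl, e0, neg_add_cancel_right, neg_add_cancel_right, h4]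
    have : ((-arccos (7 / 8) : ℝ) : Real.Angle) + -center.1 1 = -(center.1 1 + center.1 2) := by
      rw [h2, Real.Angle.coe_neg]; abel
    rw [this, Real.Angle.cos_neg, c2, Real.Angle.cos_coe, cos_neg, hc]
    norm_num
  interval_cases k
  · exact absurd rfl h0
  · exact Or.inr one
  · exact Or.inl two
  · left
    rw [← vertexRefl_center, ← vertexRefl_vertexRot_pow 2 3 rfl, wallA_vertexRefl]
    exact two
  · right
    rw [← vertexRefl_center, ← vertexRefl_vertexRot_pow 1 4 rfl, wallB_vertexRefl]
    exact one

theorem HasAlpha.involution_zero {s : LabelledShape} {a₁ a₂ a₃ : ℝ} (h : HasAlpha s a₁ a₂ a₃) :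
    HasAlpha (involution 0 s) (a₁ + π) (a₂ + π) (π - a₃) := by
  obtain ⟨e2, e3, e4⟩ := involution_zero_apply s
  obtain ⟨h2, h3, h4⟩ := h
  refine ⟨?_, ?_, ?_⟩
  · rw [e2, h4]
    exact Real.Angle.angle_eq_iff_two_pi_dvd_sub.2 ⟨1, by push_cast; ring⟩
  · rw [e3, h3]
    exact Real.Angle.angle_eq_iff_two_pi_dvd_sub.2 ⟨0, by push_cast; ring⟩
  · rw [e4, h2]
    exact Real.Angle.angle_eq_iff_two_pi_dvd_sub.2 ⟨0, by push_cast; ring⟩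

theorem involution_eq_rot (k l : ℕ) (h : (l : ZMod 5) = 3 * k) (s : LabelledShape) :
    involution k s = involution 0 ((vertexRot ^ l) s) := by
  refine shape_ext fun i => ?_
  rw [involution_apply, involution_apply, vertexRot_pow_apply, h]
  have h5 : (5 : ZMod 5) = 0 := rfl
  refine congrArg s.1 ?_
  rw [Nat.cast_zero]
  linear_combination (-(k : ZMod 5)) * h5

/-- Both wall functions are invariant under this involution and cannot detect it; the coordinates
can, as they become α₁ = α₂ = π. -/
theorem involution_zero_center_not_mem : involution 0 center ∉ cell := by
  have hpos : 0 < arccos (7 / 8) := arccos_pos.2 (by norm_num)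
  have h : HasReducedAlpha (involution 0 center) π π (arccos (7 / 8)) := by
    refine ⟨?_, ⟨by linarith [pi_pos], le_rfl⟩, ⟨by linarith [pi_pos], le_rfl⟩, hpos, arccos_le_pi _⟩
    simpa using hasAlpha_center.involution_zero
  intro h0
  have h1 : planeCoord (involution 0 center) ∈ quadInt := h0
  rw [h.planeCoord_eq] at h1
  have := (abs_lt.1 h1.1).2
  simp only at this
  linarith [pi_pos]

theorem eq_one_of_map_center {g : Equiv.Perm LabelledShape} (hg : g ∈ D5plus)
    (h : g center ∈ cell) : g = 1 := by
  have hA := wallA_pos_of_mem_cell h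
  have hB := wallB_pos_of_mem_cell h
  have rot : ∀ k, k < 5 → k ≠ 0 → 0 < wallA ((vertexRot ^ k) center) →
      0 < wallB ((vertexRot ^ k) center) → False := by
    intro k hk h0 h1 h2
    rcases rot_center_walls hk h0 with h3 | h3 <;> linarith
  rcases mem_D5plus_cases hg with ⟨k, hk, rfl⟩ | ⟨k, hk, rfl⟩
  · by_cases h0 : k = 0
    · rw [h0, pow_zero]
    · exact (rot k hk h0 hA hB).elim
  · exfalso
    by_cases h0 : k = 0
    · subst h0
      exact involution_zero_center_not_mem h
    · have e := involution_eq_rot k ((3 * k : ℕ) % 5) (by simp) center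
      rw [e, wallA_involution_zero] at hA
      rw [e, wallB_involution_zero] at hB
      exact rot _ (Nat.mod_lt _ (by norm_num)) (by omega) hA hB

/-- Overlapping components are equal, so the question reduces to the image of the single shape
`center`. -/
theorem eq_one_of_mem_cell {g : Equiv.Perm LabelledShape} (hg : g ∈ D5plus) {s : LabelledShape}
    (h : s ∈ cell) (h' : g s ∈ cell) : g = 1 := by
  have h1 := connectedComponentIn_offCurves (one_mem D5plus) (s := g s) ⟨g s, h', rfl⟩
  have h2 := connectedComponentIn_offCurves hg (mem_image_of_mem g h)
  rw [h2, Equiv.Perm.coe_one, image_id] at h1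
  exact eq_one_of_map_center hg (h1 ▸ mem_image_of_mem g center_mem_cell)

/-! ### Regular shapes are the corners -/

theorem HasConstAngle.hasAlpha {s : LabelledShape} {θ a₁ a₂ : ℝ} (h : HasConstAngle s θ)
    (h2 : ((θ : ℝ) : Real.Angle) = ((-a₂ : ℝ) : Real.Angle))
    (h3 : ((θ : ℝ) : Real.Angle) = ((-a₁ + (a₂ - π) : ℝ) : Real.Angle)) : HasAlpha s a₁ a₂ π := by
  refine ⟨?_, ?_, ?_⟩ <;> rw [h]
  · rw [h2]
    congr 1; ring
  · exact h3
  · rw [h2]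
    exact Real.Angle.angle_eq_iff_two_pi_dvd_sub.2 ⟨-1, by push_cast; ring⟩

theorem planeCoord_of_one {s : LabelledShape} (h : HasConstAngle s (π / 5)) :
    planeCoord s = (2 * π / 5, 4 * π / 5) := by
  have hr : HasReducedAlpha s (3 * π / 5) (-(π / 5)) π := by
    refine ⟨h.hasAlpha (by rw [neg_neg]) (Real.Angle.angle_eq_iff_two_pi_dvd_sub.2 ⟨1, ?_⟩), ?_, ?_, ?_⟩
    · push_cast; ring
    all_goals constructor <;> linarith [pi_pos]
  rw [hr.planeCoord_eq]
  ext <;> simp only <;> ring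

theorem planeCoord_of_neg_one {s : LabelledShape} (h : HasConstAngle s (-(π / 5))) :
    planeCoord s = (-(2 * π / 5), -(4 * π / 5)) := by
  have hr : HasReducedAlpha s (-(3 * π / 5)) (π / 5) π := by
    refine ⟨h.hasAlpha rfl (Real.Angle.angle_eq_iff_two_pi_dvd_sub.2 ⟨0, ?_⟩), ?_, ?_, ?_⟩
    · push_cast; ring
    all_goals constructor <;> linarith [pi_pos]
  rw [hr.planeCoord_eq]
  ext <;> simp only <;> ring

theorem planeCoord_of_three {s : LabelledShape} (h : HasConstAngle s (3 * π / 5)) :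
    planeCoord s = (-(4 * π / 5), 2 * π / 5) := by
  have hr : HasReducedAlpha s (-(π / 5)) (-(3 * π / 5)) π := by
    refine ⟨h.hasAlpha (by rw [neg_neg]) (Real.Angle.angle_eq_iff_two_pi_dvd_sub.2 ⟨1, ?_⟩), ?_, ?_, ?_⟩
    · push_cast; ring
    all_goals constructor <;> linarith [pi_pos]
  rw [hr.planeCoord_eq]
  ext <;> simp only <;> ring

theorem planeCoord_of_neg_three {s : LabelledShape} (h : HasConstAngle s (-(3 * π / 5))) :
    planeCoord s = (4 * π / 5, -(2 * π / 5)) := by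
  have hr : HasReducedAlpha s (π / 5) (3 * π / 5) π := by
    refine ⟨h.hasAlpha rfl (Real.Angle.angle_eq_iff_two_pi_dvd_sub.2 ⟨0, ?_⟩), ?_, ?_, ?_⟩
    · push_cast; ring
    all_goals constructor <;> linarith [pi_pos]
  rw [hr.planeCoord_eq]
  ext <;> simp only <;> ring

theorem left_end_mem : -(2 * π / 5) ∈ Icc (-(2 * π / 5)) (4 * π / 5) :=
  ⟨le_rfl, by linarith [pi_pos]⟩

theorem right_end_mem : 4 * π / 5 ∈ Icc (-(2 * π / 5)) (4 * π / 5) :=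
  ⟨by linarith [pi_pos], le_rfl⟩

theorem corner_mem_quad : (2 * π / 5, 4 * π / 5) ∈ quad := by
  have := arc_mem_quad right_end_mem
  rwa [arc_end] at this

theorem IsRegular.mem_tile {s : LabelledShape} (h : IsRegular s) : s ∈ tile := by
  have h0 := corner_mem_quad
  show planeCoord s ∈ quad
  rcases h with h | h | h | h
  · rw [planeCoord_of_one h]
    exact h0
  · rw [planeCoord_of_neg_one h]
    exact neg_mem_quad.2 h0
  · rw [planeCoord_of_three h]
    exact rot_mem_quad.2 h0
  · rw [planeCoord_of_neg_three h, ← rot_mem_quad, neg_neg]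
    exact h0

/-! ### Points of the arcs other than the corners -/

/-- An end point of a side also lies on the next side, hence on two symmetry curves, and is
therefore regular. -/
theorem arcs_cases {s : LabelledShape} (h : s ∈ arcs) (hr : ¬ IsRegular s) :
    ∃ t ∈ Ioo (-(2 * π / 5)) (4 * π / 5),
      (planeCoord s = (arc t, t) ∧ s ∈ symCurve 1) ∨ (planeCoord s = (-t, arc t) ∧ s ∈ symCurve 3) ∨
      (planeCoord s = (-arc t, -t) ∧ s ∈ symCurve 4) ∨
      (planeCoord s = (t, -arc t) ∧ s ∈ symCurve 2) := by
  have two : ∀ {k l}, k < 5 → l < 5 → k ≠ l → s ∈ symCurve k → s ∈ symCurve l → False :=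
    fun hk hl hkl h1 h2 => hr (isRegular_of_two_symCurves hk hl hkl h1 h2)
  have inner : ∀ {t}, t ∈ Icc (-(2 * π / 5)) (4 * π / 5) → t ≠ -(2 * π / 5) → t ≠ 4 * π / 5 →
      t ∈ Ioo (-(2 * π / 5)) (4 * π / 5) :=
    fun ht h1 h2 => ⟨lt_of_le_of_ne ht.1 (Ne.symm h1), lt_of_le_of_ne ht.2 h2⟩
  rcases h with ((h | h) | h) | h
  · have hk := right_arc_subset h
    obtain ⟨t, ht, e⟩ := mem_right_arc.1 h
    refine ⟨t, inner ht ?_ ?_, Or.inl ⟨e, hk⟩⟩ <;> rintro rfl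
    · refine two (k := 1) (l := 2) (by norm_num) (by norm_num) (by norm_num) hk
        (bottom_arc_subset (mem_bottom_arc.2 ⟨_, right_end_mem, ?_⟩))
      rw [e, arc_start, arc_end]
    · refine two (k := 1) (l := 3) (by norm_num) (by norm_num) (by norm_num) hk
        (top_arc_subset (mem_top_arc.2 ⟨_, left_end_mem, ?_⟩))
      rw [e, arc_start, arc_end, neg_neg]
  · have hk := top_arc_subset h
    obtain ⟨t, ht, e⟩ := mem_top_arc.1 h
    refine ⟨t, inner ht ?_ ?_, Or.inr (Or.inl ⟨e, hk⟩)⟩ <;> rintro rfl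
    · refine two (k := 3) (l := 1) (by norm_num) (by norm_num) (by norm_num) hk
        (right_arc_subset (mem_right_arc.2 ⟨_, right_end_mem, ?_⟩))
      rw [e, arc_start, arc_end, neg_neg]
    · refine two (k := 3) (l := 4) (by norm_num) (by norm_num) (by norm_num) hk
        (left_arc_subset (mem_left_arc.2 ⟨_, left_end_mem, ?_⟩))
      rw [e, arc_start, arc_end, neg_neg]
  · have hk := left_arc_subset h
    obtain ⟨t, ht, e⟩ := mem_left_arc.1 h
    refine ⟨t, inner ht ?_ ?_, Or.inr (Or.inr (Or.inl ⟨e, hk⟩))⟩ <;> rintro rfl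
    · refine two (k := 4) (l := 3) (by norm_num) (by norm_num) (by norm_num) hk
        (top_arc_subset (mem_top_arc.2 ⟨_, right_end_mem, ?_⟩))
      rw [e, arc_start, arc_end, neg_neg]
    · refine two (k := 4) (l := 2) (by norm_num) (by norm_num) (by norm_num) hk
        (bottom_arc_subset (mem_bottom_arc.2 ⟨_, left_end_mem, ?_⟩))
      rw [e, arc_start, arc_end]
  · have hk := bottom_arc_subset h
    obtain ⟨t, ht, e⟩ := mem_bottom_arc.1 h
    refine ⟨t, inner ht ?_ ?_, Or.inr (Or.inr (Or.inr ⟨e, hk⟩))⟩ <;> rintro rfl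
    · refine two (k := 2) (l := 4) (by norm_num) (by norm_num) (by norm_num) hk
        (left_arc_subset (mem_left_arc.2 ⟨_, right_end_mem, ?_⟩))
      rw [e, arc_start, arc_end]
    · refine two (k := 2) (l := 1) (by norm_num) (by norm_num) (by norm_num) hk
        (right_arc_subset (mem_right_arc.2 ⟨_, left_end_mem, ?_⟩))
      rw [e, arc_start, arc_end]

theorem abs_lt_of_mem_Ioo {t : ℝ} (ht : t ∈ Ioo (-(2 * π / 5)) (4 * π / 5)) :
    |t| < 4 * π / 5 ∧ |arc t| < 4 * π / 5 := by
  have h1 : |t| < 4 * π / 5 := abs_lt.2 ⟨by linarith [ht.1, pi_pos], ht.2⟩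
  refine ⟨h1, ?_⟩
  rw [abs_of_pos (arc_pos h1.le)]
  exact arc_lt ht.1 ht.2.le

theorem abs_planeCoord_lt {s : LabelledShape} (h : s ∈ tile) (hr : ¬ IsRegular s) :
    |(planeCoord s).1| < 4 * π / 5 ∧ |(planeCoord s).2| < 4 * π / 5 := by
  rcases mem_cell_or_arcs h with h1 | h1
  · exact ⟨h1.1, h1.2.1⟩
  · obtain ⟨t, ht, e⟩ := arcs_cases h1 hr
    obtain ⟨h2, h3⟩ := abs_lt_of_mem_Ioo ht
    rcases e with ⟨e, -⟩ | ⟨e, -⟩ | ⟨e, -⟩ | ⟨e, -⟩ <;> rw [e] <;> simp only [abs_neg]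
    exacts [⟨h3, h2⟩, ⟨h2, h3⟩, ⟨h3, h2⟩, ⟨h2, h3⟩]

/-- Away from the corners `planeCoord` is continuous and the box constraints are strict, so nearby
only the signs of the two wall functions decide. -/
theorem eventually_mem_tile {s : LabelledShape} (h : s ∈ tile) (hr : ¬ IsRegular s) :
    ∀ᶠ u in nhds s, 0 ≤ wallA u → 0 ≤ wallB u → u ∈ tile := by
  have hc := continuousAt_planeCoord_of_mem_tile h hr
  obtain ⟨h1, h2⟩ := abs_planeCoord_lt h hr
  have h3 : |(planeCoord s).1 + (planeCoord s).2 / 2| < π := by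
    linarith [h.2.2.1, kap_le h.2.1, pi_pos]
  have h4 : |(planeCoord s).2 - (planeCoord s).1 / 2| < π := by
    linarith [h.2.2.2, kap_le h.1, pi_pos]
  have e1 := (hc.fst.abs).eventually (gt_mem_nhds h1)
  have e2 := (hc.snd.abs).eventually (gt_mem_nhds h2)
  have e3 : ∀ᶠ u in nhds s, |(planeCoord u).1 + (planeCoord u).2 / 2| < π :=
    ((hc.fst.add (hc.snd.div_const 2)).abs).eventually (gt_mem_nhds h3)
  have e4 : ∀ᶠ u in nhds s, |(planeCoord u).2 - (planeCoord u).1 / 2| < π :=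
    ((hc.snd.sub (hc.fst.div_const 2)).abs).eventually (gt_mem_nhds h4)
  filter_upwards [e1, e2, e3, e4] with u u1 u2 u3 u4 hA hB
  rw [wallA_eq, one_add_cos_nonneg_iff u2.le u3.le] at hA
  rw [wallB_eq, one_add_cos_nonneg_iff u1.le u4.le] at hB
  exact ⟨u1.le, u2.le, hA, hB⟩

theorem arcs_walls {s : LabelledShape} (h : s ∈ arcs) (hr : ¬ IsRegular s) :
    ∃ k < 5, s ∈ symCurve k ∧ (((k = 1 ∨ k = 4) ∧ 0 < wallB s) ∨ ((k = 3 ∨ k = 2) ∧ 0 < wallA s)) := by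
  obtain ⟨t, ht, e⟩ := arcs_cases h hr
  obtain ⟨h2, h3⟩ := abs_lt_of_mem_Ioo ht
  have hl := arc_lt_strict ht.1 ht.2
  rcases e with ⟨e, hk⟩ | ⟨e, hk⟩ | ⟨e, hk⟩ | ⟨e, hk⟩
  · refine ⟨1, by norm_num, hk, Or.inl ⟨Or.inl rfl, wallB_pos ?_ ?_⟩⟩ <;> rw [e]
    exacts [h3.le, hl]
  · refine ⟨3, by norm_num, hk, Or.inr ⟨Or.inl rfl, wallA_pos ?_ ?_⟩⟩ <;> rw [e]
    · exact h3.le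
    · rw [← abs_neg]
      convert hl using 2
      ring
  · refine ⟨4, by norm_num, hk, Or.inl ⟨Or.inr rfl, wallB_pos ?_ ?_⟩⟩ <;> rw [e]
    · simpa using h3.le
    · rw [← abs_neg, kap_neg]
      convert hl using 2
      ring
  · refine ⟨2, by norm_num, hk, Or.inr ⟨Or.inr rfl, wallA_pos ?_ ?_⟩⟩ <;> rw [e]
    · simpa using h3.le
    · rw [kap_neg]
      convert hl using 2
      ring

/-- Near a shape on a side, one side of the symmetry curve belongs to the fundamental region, the
other side to its mirror image. -/
theorem eventually_mem_tile_or {s : LabelledShape} (h : s ∈ tile) (hr : ¬ IsRegular s) {k : ℕ}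
    (hk : k < 5) (hs : involution k s = s) :
    ∀ᶠ u in nhds s, u ∈ tile ∨ involution k u ∈ tile := by
  have hs' := mem_symCurve_iff_fixed.2 hs
  have harc : s ∈ arcs := by
    rcases mem_cell_or_arcs h with h1 | h1
    · exact absurd hs (mem_offCurves_iff.1 (cell_subset_offCurves h1) k hk)
    · exact h1
  obtain ⟨l, hl, hls, hw⟩ := arcs_walls harc hr
  have hkl : k = l := by
    by_contra hne
    exact hr (isRegular_of_two_symCurves hk hl hne hs' hls)
  subst hkl
  have hcont : Filter.Tendsto (involution k) (nhds s) (nhds s) := by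
    have := (continuous_of_mem_D5plus (involution_mem k)).tendsto s
    rwa [hs] at this
  have e1 := eventually_mem_tile h hr
  have e2 := hcont.eventually e1
  rcases hw with ⟨hk', hB⟩ | ⟨hk', hA⟩
  · have e3 := continuous_wallB.continuousAt.eventually (lt_mem_nhds hB)
    have e4 := hcont.eventually e3
    filter_upwards [e1, e2, e3, e4] with u u1 u2 u3 u4
    have := wallA_add_nonneg hk' u
    rcases le_or_gt 0 (wallA u) with h0 | h0
    · exact Or.inl (u1 h0 u3.le)
    · exact Or.inr (u2 (by linarith) u4.le)
  · have e3 := continuous_wallA.continuousAt.eventually (lt_mem_nhds hA)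
    have e4 := hcont.eventually e3
    filter_upwards [e1, e2, e3, e4] with u u1 u2 u3 u4
    have := wallB_add_nonneg hk' u
    rcases le_or_gt 0 (wallB u) with h0 | h0
    · exact Or.inl (u1 u3.le h0)
    · exact Or.inr (u2 u4.le (by linarith))

/-! ### The images of the fundamental region cover the surface -/

/-- The union of the images of the closed fundamental region. -/
def tiled : Set LabelledShape := ⋃ g : D5plus, (g : Equiv.Perm LabelledShape) '' tile

instance finite_D5plus : Finite D5plus :=
  Nat.finite_of_card_ne_zero (by rw [card_D5plus]; norm_num)

theorem isClosed_tiled : IsClosed tiled := isClosed_iUnion_of_finite fun g => isClosed_image g.2 isClosed_tile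

theorem mem_tiled_iff {s : LabelledShape} : s ∈ tiled ↔ ∃ g ∈ D5plus, g s ∈ tile := by
  rw [tiled, mem_iUnion]
  constructor
  · rintro ⟨g, u, hu, rfl⟩
    refine ⟨(g : Equiv.Perm LabelledShape)⁻¹, inv_mem g.2, ?_⟩
    rwa [← Equiv.Perm.mul_apply, inv_mul_cancel, Equiv.Perm.one_apply]
  · rintro ⟨g, hg, h⟩
    exact ⟨⟨g⁻¹, inv_mem hg⟩, g s, h, by
      rw [← Equiv.Perm.mul_apply, inv_mul_cancel, Equiv.Perm.one_apply]⟩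

theorem map_mem_tiled_iff {g : Equiv.Perm LabelledShape} (hg : g ∈ D5plus) {s : LabelledShape} :
    g s ∈ tiled ↔ s ∈ tiled := by
  rw [mem_tiled_iff, mem_tiled_iff]
  constructor
  · rintro ⟨h, hh, h'⟩
    exact ⟨h * g, mul_mem hh hg, h'⟩
  · rintro ⟨h, hh, h'⟩
    refine ⟨h * g⁻¹, mul_mem hh (inv_mem hg), ?_⟩
    rwa [Equiv.Perm.mul_apply, ← Equiv.Perm.mul_apply g⁻¹, inv_mul_cancel, Equiv.Perm.one_apply]

theorem IsRegular.of_map {g : Equiv.Perm LabelledShape} (hg : g ∈ D5plus) {s : LabelledShape}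
    (h : IsRegular (g s)) : IsRegular s := by
  have := h.fixed (inv_mem hg)
  rw [← Equiv.Perm.mul_apply, inv_mul_cancel, Equiv.Perm.one_apply] at this
  rwa [← this] at h

theorem tiled_mem_nhds {s : LabelledShape} (h : s ∈ tiled) (hr : ¬ IsRegular s) :
    tiled ∈ nhds s := by
  obtain ⟨g, hg, hs⟩ := mem_tiled_iff.1 h
  have hr' : ¬ IsRegular (g s) := fun h' => hr (h'.of_map hg)
  have key : tiled ∈ nhds (g s) := by
    rcases mem_cell_or_arcs hs with h1 | h1
    · refine Filter.mem_of_superset (isOpen_cell.mem_nhds h1) fun u hu => ?_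
      exact mem_tiled_iff.2 ⟨1, one_mem _, cell_subset_tile hu⟩
    · obtain ⟨k, hk, -, hks⟩ := exists_symCurve_of_mem_arcs h1
      filter_upwards [eventually_mem_tile_or hs hr' hk (mem_symCurve_iff_fixed.1 hks)] with u hu
      rcases hu with hu | hu
      · exact mem_tiled_iff.2 ⟨1, one_mem _, hu⟩
      · exact mem_tiled_iff.2 ⟨_, involution_mem k, hu⟩
  have := (continuous_of_mem_D5plus hg).continuousAt.preimage_mem_nhds key
  refine Filter.mem_of_superset this fun u hu => ?_
  exact (map_mem_tiled_iff hg).1 hu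

/-- The plane points over which `α₃ < π`. -/
def lensInt : Set (ℝ × ℝ) :=
  {p | |p.1| < π ∧ |p.2| < π ∧ |cos (p.1 / 2) - cos (p.2 / 2)| < 1 / 2 ∧
    1 / 2 < cos (p.1 / 2) + cos (p.2 / 2)}

theorem lensInt_subset_lens : lensInt ⊆ lens := fun _ h => ⟨h.1, h.2.1, h.2.2.1.le, h.2.2.2⟩

theorem abs_cos_sub_cos_mul_le {r x y : ℝ} (h0 : 0 ≤ r) (h1 : r ≤ 1) (hx : |x| ≤ π)
    (hy : |y| ≤ π) :
    |cos (r * x / 2) - cos (r * y / 2)| ≤ |cos (x / 2) - cos (y / 2)| := by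
  have sin_le : ∀ z : ℝ, |z| ≤ π / 2 → |sin (r * z)| ≤ |sin z| := by
    intro z hz
    have e : ∀ z : ℝ, |z| ≤ π / 2 → |sin z| = sin |z| := by
      intro z hz
      rcases le_total 0 z with h | h
      · rw [abs_of_nonneg h] at hz ⊢
        exact abs_of_nonneg (sin_nonneg_of_nonneg_of_le_pi h (by linarith [pi_pos]))
      · rw [abs_of_nonpos h] at hz ⊢
        rw [sin_neg, abs_of_nonpos]
        rw [← neg_neg z, sin_neg]
        linarith [sin_nonneg_of_nonneg_of_le_pi (neg_nonneg.2 h) (by linarith [pi_pos])]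
    have h2 : |r * z| ≤ |z| := by
      rw [abs_mul, abs_of_nonneg h0]
      exact mul_le_of_le_one_left (abs_nonneg z) h1
    rw [e z hz, e _ (h2.trans hz)]
    exact sin_le_sin_of_le_of_le_pi_div_two (by linarith [pi_pos, abs_nonneg (r * z)]) hz h2
  obtain ⟨x1, x2⟩ := abs_le.1 hx
  obtain ⟨y1, y2⟩ := abs_le.1 hy
  rw [cos_sub_cos, cos_sub_cos, abs_mul, abs_mul, abs_mul, abs_mul]
  rw [show (r * x / 2 + r * y / 2) / 2 = r * ((x / 2 + y / 2) / 2) by ring,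
    show (r * x / 2 - r * y / 2) / 2 = r * ((x / 2 - y / 2) / 2) by ring]
  refine mul_le_mul (mul_le_mul_of_nonneg_left (sin_le _ ?_) (abs_nonneg _)) (sin_le _ ?_)
    (abs_nonneg _) (by positivity) <;> exact abs_le.2 ⟨by linarith, by linarith⟩

theorem cos_half_le_cos_mul {r x : ℝ} (h0 : 0 ≤ r) (h1 : r ≤ 1) (hx : |x| ≤ π) :
    cos (x / 2) ≤ cos (r * x / 2) := by
  rw [← cos_abs (x / 2), ← cos_abs (r * x / 2), abs_div, abs_div, abs_mul, abs_of_nonneg h0, abs_two]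
  have : r * |x| ≤ |x| := mul_le_of_le_one_left (abs_nonneg x) h1
  exact cos_le_cos_of_nonneg_of_le_pi (by positivity) (by linarith [pi_pos]) (by linarith)

/-- A difference of cosines is a product of two sines, and scaling towards 0 decreases both factors;
the sum of cosines increases. -/
theorem starConvex_lensInt : StarConvex ℝ 0 lensInt := by
  rw [starConvex_zero_iff]
  rintro ⟨x, y⟩ ⟨h1, h2, h3, h4⟩ r hr0 hr1
  simp only at h1 h2 h3 h4
  have le : ∀ z : ℝ, |r * z| ≤ |z| := fun z => by
    rw [abs_mul, abs_of_nonneg hr0]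
    exact mul_le_of_le_one_left (abs_nonneg z) hr1
  refine ⟨(le x).trans_lt h1, (le y).trans_lt h2, ?_, ?_⟩
  · exact (abs_cos_sub_cos_mul_le hr0 hr1 h1.le h2.le).trans_lt h3
  · show 1 / 2 < cos (r * x / 2) + cos (r * y / 2)
    linarith [cos_half_le_cos_mul hr0 hr1 h1.le, cos_half_le_cos_mul hr0 hr1 h2.le]

/-- The shapes over the interior of the lens. -/
def overLens : Set LabelledShape := {s | planeCoord s ∈ lensInt}

theorem isPreconnected_overLens : IsPreconnected overLens := by
  rw [overLens, ← image_ofPlane lensInt_subset_lens]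
  refine IsPreconnected.image ?_ _ continuous_ofPlane.continuousOn
  rw [← Topology.IsInducing.subtypeVal.isPreconnected_image]
  have : ((↑) : lens → ℝ × ℝ) '' {p : lens | p.1 ∈ lensInt} = lensInt := by
    ext q
    constructor
    · rintro ⟨x, hx, rfl⟩
      exact hx
    · intro hq
      exact ⟨⟨q, lensInt_subset_lens hq⟩, hq, rfl⟩
  rw [this]
  have h0 : (0 : ℝ × ℝ) ∈ lensInt := by
    refine ⟨?_, ?_, ?_, ?_⟩ <;> simp [pi_pos]
    norm_num
  exact (starConvex_lensInt.isPathConnected h0).isConnected.isPreconnected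

theorem not_isRegular_of_mem_overLens {s : LabelledShape} (h : s ∈ overLens) : ¬ IsRegular s := by
  intro hr
  have := abs_cos_sub_cos_of_mem (hr.mem_symCurve 0)
  exact h.2.2.1.ne this

/-- On this connected set without regular shapes, `tiled` is relatively open and closed, and it
contains `center`. -/
theorem overLens_subset_tiled : overLens ⊆ tiled := by
  have hu : overLens ⊆ interior tiled ∪ tiledᶜ := by
    intro s hs
    by_cases h : s ∈ tiled
    · exact Or.inl (mem_interior_iff_mem_nhds.2
        (tiled_mem_nhds h (not_isRegular_of_mem_overLens hs)))
    · exact Or.inr h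
  have hc : center ∈ overLens := by
    have h1 := center_mem_cell
    have h2 := quad_subset_lens (cell_subset_tile h1)
    refine ⟨h2.1, h2.2.1, lt_of_le_of_ne h2.2.2.1 fun h => ?_, h2.2.2.2⟩
    exact (abs_cos_sub_cos_le (cell_subset_tile h1)).2 h h1
  have hct : center ∈ tiled := mem_tiled_iff.2 ⟨1, one_mem _, cell_subset_tile center_mem_cell⟩
  have := isPreconnected_overLens.subset_left_of_subset_union isOpen_interior
    isClosed_tiled.isOpen_compl (disjoint_compl_right.mono_left interior_subset) hu
    ⟨center, hc, (hu hc).resolve_right fun h => h hct⟩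
  exact this.trans interior_subset

/-! ### Shapes outside the open lens -/

theorem HasAlpha.cos_red {s : LabelledShape} {a₁ a₂ a₃ : ℝ} (h : HasAlpha s a₁ a₂ a₃)
    (h3 : a₃ ∈ Ioc 0 π) : cos (red₁ s) = cos a₁ ∧ cos (red₂ s) = cos a₂ := by
  have e1 := Real.Angle.coe_toReal (a₁ : Real.Angle)
  have e2 := Real.Angle.coe_toReal (a₂ : Real.Angle)
  have hr : HasReducedAlpha s (a₁ : Real.Angle).toReal (a₂ : Real.Angle).toReal a₃ := by
    refine ⟨?_, Real.Angle.toReal_mem_Ioc _, Real.Angle.toReal_mem_Ioc _, h3⟩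
    obtain ⟨h2, h3, h4⟩ := h
    refine ⟨?_, ?_, ?_⟩
    · rw [h2, Real.Angle.coe_sub, Real.Angle.coe_neg, Real.Angle.coe_sub, Real.Angle.coe_sub,
        Real.Angle.coe_neg, Real.Angle.coe_sub, e2]
    · rw [h3, Real.Angle.coe_add, Real.Angle.coe_neg, Real.Angle.coe_sub, Real.Angle.coe_add,
        Real.Angle.coe_neg, Real.Angle.coe_sub, e1, e2]
    · rw [h4, Real.Angle.coe_add, Real.Angle.coe_neg, Real.Angle.coe_sub, Real.Angle.coe_add,
        Real.Angle.coe_neg, Real.Angle.coe_sub, e2]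
  obtain ⟨k1, k2, -⟩ := hr.eq_red
  rw [← k1, ← k2, Real.Angle.cos_toReal, Real.Angle.cos_toReal, Real.Angle.cos_coe,
    Real.Angle.cos_coe]
  exact ⟨rfl, rfl⟩

theorem cos_red_add (s : LabelledShape) : cos (red₁ s) + cos (red₂ s)
    = 2 * cos ((planeCoord s).1 / 2) * cos ((planeCoord s).2 / 2) :=
  cos_add_cos _ _

theorem abs_lt_pi_of_cos_pos {x : ℝ} (h : |x| ≤ 2 * π) (hc : 0 < cos (x / 2)) : |x| < π := by
  by_contra! hx
  rw [← cos_abs, abs_div, abs_two] at hc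
  linarith [cos_nonpos_of_pi_div_two_le_of_le (x := |x| / 2) (by linarith) (by linarith)]

theorem pi_lt_abs_of_cos_neg {x : ℝ} (hc : cos (x / 2) < 0) : π < |x| := by
  by_contra! hx
  obtain ⟨h1, h2⟩ := abs_le.1 hx
  linarith [cos_nonneg_of_neg_pi_div_two_le_of_le (x := x / 2) (by linarith) (by linarith)]

theorem mem_overLens {s : LabelledShape} (h : s ∉ symCurve 0)
    (hp : 0 < cos (red₁ s) + cos (red₂ s)) : s ∈ overLens := by
  have heq := planeCoord_equation s
  rw [cos_red_add] at hp
  obtain ⟨-, ⟨r1, r2⟩, ⟨r3, r4⟩, ⟨r5, -⟩⟩ := hasReducedAlpha_red s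
  have h3 := red₃_lt_pi_iff.2 h
  have hX : (planeCoord s).1 = red₁ s + red₂ s := rfl
  have hY : (planeCoord s).2 = red₁ s - red₂ s := rfl
  -- Two negative cosines would need |x| > π and |y| > π, which is incompatible with reduced α₁ and
  -- α₂.
  have ab : 0 < cos ((planeCoord s).1 / 2) ∧ 0 < cos ((planeCoord s).2 / 2) := by
    rcases pos_and_pos_or_neg_and_neg_of_mul_pos
      (show 0 < cos ((planeCoord s).1 / 2) * cos ((planeCoord s).2 / 2) by linarith) with h | h
    · exact h
    · exfalso
      have a := pi_lt_abs_of_cos_neg h.1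
      have b := pi_lt_abs_of_cos_neg h.2
      rw [hX] at a
      rw [hY] at b
      rcases lt_abs.1 a with a | a <;> rcases lt_abs.1 b with b | b <;> linarith
  have hc1 : -1 < cos (red₃ s) := by
    rw [← cos_pi]
    exact cos_lt_cos_of_nonneg_of_le_pi r5.le le_rfl h3
  have hc2 : cos (red₃ s) < 1 := by
    rw [← cos_zero]
    exact cos_lt_cos_of_nonneg_of_le_pi le_rfl h3.le r5
  have hab := mul_pos ab.1 ab.2
  refine ⟨abs_lt_pi_of_cos_pos (abs_le.2 ⟨?_, ?_⟩) ab.1, abs_lt_pi_of_cos_pos (abs_le.2 ⟨?_, ?_⟩) ab.2,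
    ?_, ?_⟩
  iterate 4 first | (rw [hX]; linarith) | (rw [hY]; linarith)
  · refine abs_lt_of_sq_lt_sq ?_ (by norm_num)
    nlinarith
  · refine lt_of_pow_lt_pow_left₀ 2 (by linarith) ?_
    nlinarith

theorem coe_eq_pi_of_cos_half {x : ℝ} (h : cos (x / 2) = 0) : (x : Real.Angle) = (π : ℝ) := by
  obtain ⟨k, hk⟩ := cos_eq_zero_iff.1 h
  exact Real.Angle.angle_eq_iff_two_pi_dvd_sub.2 ⟨k, by linarith⟩

/-- MV shifts α₁ and α₂ by π and so changes the sign of cos α₁ + cos α₂. The value zero means that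
one pair of edges cancels: ψ₃ = 0 or ψ₅ + ψ₁ = π. -/
theorem mem_tiled_of_generic {s : LabelledShape} (h : s ∉ symCurve 0) (h3 : s.1 3 ≠ 0)
    (h01 : s.1 0 + s.1 1 ≠ (π : ℝ)) : s ∈ tiled := by
  rcases lt_trichotomy 0 (cos (red₁ s) + cos (red₂ s)) with h0 | h0 | h0
  · exact overLens_subset_tiled (mem_overLens h h0)
  · exfalso
    obtain ⟨e2, e3, e4⟩ := (hasReducedAlpha_red s).1
    rw [cos_red_add, mul_assoc] at h0
    rcases mul_eq_zero.1 ((mul_eq_zero.1 h0.symm).resolve_left two_ne_zero) with ha | ha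
    · apply h01
      have hx := coe_eq_pi_of_cos_half ha
      have : s.1 2 + s.1 3 + s.1 4 = 0 := by
        rw [e2, e3, e4, ← Real.Angle.coe_add, ← Real.Angle.coe_add]
        rw [show -(red₂ s - π) - red₃ s + (-red₁ s + (red₂ s - π)) + (-(red₂ s - π) + red₃ s)
          = π - (red₁ s + red₂ s) by ring, Real.Angle.coe_sub]
        rw [planeCoord] at hx
        rw [hx, sub_self]
      have hs := sum_relAngle s
      rw [← hs]
      linear_combination (norm := module) (-1 : ℤ) • this
    · apply h3
      have hx := coe_eq_pi_of_cos_half ha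
      rw [planeCoord] at hx
      rw [e3, show -red₁ s + (red₂ s - π) = -((red₁ s - red₂ s) + π) by ring, Real.Angle.coe_neg,
        Real.Angle.coe_add, hx, Real.Angle.coe_pi_add_coe_pi, neg_zero]
  · rw [← map_mem_tiled_iff (involution_mem 0)]
    refine overLens_subset_tiled (mem_overLens ?_ ?_)
    · rw [mem_symCurve_iff_fixed, involution_involution]
      exact fun h' => h (mem_symCurve_iff_fixed.2 h'.symm)
    · have hr := hasReducedAlpha_red s
      have h3 := red₃_lt_pi_iff.2 h
      have ha := hr.1.involution_zero
      obtain ⟨c1, c2⟩ := ha.cos_red ⟨by linarith, by linarith [hr.2.2.2.1]⟩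
      rw [c1, c2, cos_add_pi, cos_add_pi]
      linarith

theorem mem_tiled_of_rot (k : ℕ) {s : LabelledShape} (h : s.1 (2 + k) ≠ s.1 (4 + k))
    (h3 : s.1 (3 + k) ≠ 0) (h01 : s.1 (0 + k) + s.1 (1 + k) ≠ (π : ℝ)) : s ∈ tiled := by
  have hg : vertexRot ^ k ∈ D5plus :=
    pow_mem (Subgroup.subset_closure (by simp)) k
  rw [← map_mem_tiled_iff hg]
  refine mem_tiled_of_generic ?_ ?_ ?_
  · rw [mem_symCurve_iff, Nat.cast_zero, sub_zero, sub_zero, vertexRot_pow_apply,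
      vertexRot_pow_apply]
    exact h
  · rwa [vertexRot_pow_apply]
  · rwa [vertexRot_pow_apply, vertexRot_pow_apply]

/-- Three unit vectors with sum zero enclose equal angles. -/
theorem equilateral_triangle {β γ : Real.Angle}
    (h : ∀ φ : Real.Angle, φ.cos = (φ + β).cos + (φ + γ).cos) : γ = -β ∧ β.cos = 1 / 2 := by
  have h0 := h 0
  have h1 := h ((π / 2 : ℝ) : Real.Angle)
  rw [zero_add, zero_add, Real.Angle.cos_zero] at h0
  rw [add_comm _ β, add_comm _ γ, Real.Angle.cos_add_pi_div_two, Real.Angle.cos_add_pi_div_two,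
    Real.Angle.cos_coe, cos_pi_div_two] at h1
  have s1 := Real.Angle.cos_sq_add_sin_sq β
  have s2 := Real.Angle.cos_sq_add_sin_sq γ
  have hs : γ.sin = -β.sin := by linarith
  rw [hs] at s2
  have hc : β.cos = γ.cos := by nlinarith
  refine ⟨?_, by linarith⟩
  rcases Real.Angle.cos_eq_iff_eq_or_eq_neg.1 hc with e | e
  · exfalso
    rw [← e] at hs h0
    have : β.sin = 0 := by linarith
    rw [this] at s1
    have : β.cos = 1 / 2 := by linarith
    rw [this] at s1
    norm_num at s1
  · rw [e, neg_neg]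

theorem third_turn {δ : Real.Angle} (h : δ.cos = 1 / 2) :
    δ + δ + δ = (π : ℝ) ∧ δ ≠ 0 ∧ δ + δ ≠ 0 ∧ δ ≠ (π : ℝ) := by
  have hp := Real.Angle.coe_pi_add_coe_pi
  have d0 : δ ≠ 0 := by
    rintro rfl
    rw [Real.Angle.cos_zero] at h
    norm_num at h
  have d1 : δ ≠ (π : ℝ) := by
    rintro rfl
    rw [Real.Angle.cos_coe_pi] at h
    norm_num at h
  refine ⟨?_, d0, fun h2 => ?_, d1⟩
  · have h3 : δ.cos = ((π / 3 : ℝ) : Real.Angle).cos := by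
      rw [h, Real.Angle.cos_coe, cos_pi_div_three]
    have e : (((π / 3 : ℝ) : Real.Angle)) + ((π / 3 : ℝ) : Real.Angle) + ((π / 3 : ℝ) : Real.Angle)
        = (π : ℝ) := by
      rw [← Real.Angle.coe_add, ← Real.Angle.coe_add]
      congr 1; ring
    rcases Real.Angle.cos_eq_iff_eq_or_eq_neg.1 h3 with rfl | rfl
    · exact e
    · linear_combination (norm := module) (-1 : ℤ) • e - hp
  · rw [← two_nsmul, Real.Angle.two_nsmul_eq_zero_iff] at h2
    exact h2.elim d0 d1

/-- The two edges at z₃ cancel and the other three form an equilateral triangle. All angles are then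
controlled by δ = ψ₂ + ψ₄ with cos δ = 1/2, and some rotated labelling is generic. -/
theorem mem_tiled_of_fold {s : LabelledShape} (h : s.1 3 = 0) : s ∈ tiled := by
  have hs := sum_relAngle s
  have hp := Real.Angle.coe_pi_add_coe_pi
  have hc := closing s
  obtain ⟨e, hd⟩ := equilateral_triangle (β := s.1 2 + s.1 4) (γ := -s.1 1) (by
    intro φ
    have := hc φ
    rw [h, add_zero, add_assoc, sub_eq_add_neg φ] at this
    linarith)
  have e1 : s.1 1 = s.1 2 + s.1 4 := by rw [← neg_neg (s.1 1), e, neg_neg]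
  set δ := s.1 2 + s.1 4 with hδ
  obtain ⟨d3, d0, d2, dp⟩ := third_turn hd
  have e0 : s.1 0 = δ := by
    rw [h, e1] at hs
    linear_combination (norm := module) hs - d3
  by_cases h4 : s.1 4 = 0
  · have h2 : s.1 2 = δ := by rw [hδ, h4, add_zero]
    refine mem_tiled_of_rot 4 ?_ ?_ ?_
    · show s.1 1 ≠ s.1 3
      rwa [e1, h]
    · show s.1 2 ≠ 0
      rwa [h2]
    · show s.1 4 + s.1 0 ≠ _
      rwa [h4, e0, zero_add]
  by_cases h12 : s.1 1 + s.1 2 = (π : ℝ)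
  · have h2 : s.1 2 = δ + δ := by
      rw [e1] at h12
      linear_combination (norm := module) h12 - d3
    have h4' : s.1 4 = -δ := by linear_combination (norm := module) -hδ - h2
    refine mem_tiled_of_rot 4 ?_ ?_ ?_
    · show s.1 1 ≠ s.1 3
      rwa [e1, h]
    · show s.1 2 ≠ 0
      rwa [h2]
    · show s.1 4 + s.1 0 ≠ _
      rw [h4', e0, neg_add_cancel]
      exact Real.Angle.pi_ne_zero.symm
  · refine mem_tiled_of_rot 1 ?_ h4 h12
    show s.1 3 ≠ s.1 0
    rw [h, e0]
    exact d0.symm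

/-- Here the edges z₁z₂ and z₄z₅ cancel, and the remaining three form an equilateral triangle with δ
= ψ₃. -/
theorem mem_tiled_of_triangle {s : LabelledShape} (h : s.1 0 + s.1 1 = (π : ℝ)) : s ∈ tiled := by
  have hs := sum_relAngle s
  have hp := Real.Angle.coe_pi_add_coe_pi
  have hc := closing s
  have h234 : s.1 2 + s.1 3 + s.1 4 = 0 := by linear_combination (norm := module) hs - h
  obtain ⟨e, hd⟩ := equilateral_triangle (β := -s.1 3) (γ := -s.1 1 - s.1 2 - s.1 3) (by
    intro φ
    have := hc (φ - s.1 2 - s.1 3)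
    rw [show φ - s.1 2 - s.1 3 + s.1 2 + s.1 3 + s.1 4 = φ - s.1 2 - s.1 3 + (s.1 2 + s.1 3 + s.1 4)
      by abel, h234, add_zero, show φ - s.1 2 - s.1 3 + s.1 2 + s.1 3 = φ by abel,
      show φ - s.1 2 - s.1 3 + s.1 2 = φ + -s.1 3 by abel,
      show φ - s.1 2 - s.1 3 - s.1 1 = φ + (-s.1 1 - s.1 2 - s.1 3) by abel] at this
    linarith)
  rw [Real.Angle.cos_neg] at hd
  obtain ⟨d3, d0, d2, dp⟩ := third_turn hd
  set δ := s.1 3 with hδ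
  have h12 : s.1 1 + s.1 2 = δ + (π : ℝ) := by
    linear_combination (norm := module) -e - d3 - hp
  have h40 : s.1 4 + s.1 0 = δ + (π : ℝ) := by
    linear_combination (norm := module) hs - h12 - d3 - hp
  have hdp : δ + (π : ℝ) ≠ (π : ℝ) := fun h => d0 (by linear_combination (norm := module) h)
  by_cases h4 : s.1 4 = 0
  · have h0 : s.1 0 = δ + (π : ℝ) := by rw [← h40, h4, zero_add]
    refine mem_tiled_of_rot 4 ?_ ?_ ?_
    · show s.1 1 ≠ s.1 3
      intro h'
      apply d2
      linear_combination (norm := module) h - h' - h0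
    · show s.1 2 ≠ 0
      intro h'
      apply d0
      linear_combination (norm := module) d3 - h + h0 + h12 - h' + hp
    · show s.1 4 + s.1 0 ≠ _
      rwa [h40]
  by_cases h30 : δ = s.1 0
  · refine mem_tiled_of_rot 4 ?_ ?_ ?_
    · show s.1 1 ≠ s.1 3
      intro h'
      apply d0
      linear_combination (norm := module) d3 - h + h' - h30
    · show s.1 2 ≠ 0
      intro h'
      apply d2
      linear_combination (norm := module) h + h30 - h12 + h'
    · show s.1 4 + s.1 0 ≠ _
      rwa [h40]
  · refine mem_tiled_of_rot 1 h30 h4 ?_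
    show s.1 1 + s.1 2 ≠ _
    rwa [h12]

theorem mem_tiled (s : LabelledShape) : s ∈ tiled := by
  have off : ∀ s : LabelledShape, s ∉ symCurve 0 → s ∈ tiled := by
    intro s h
    by_cases h3 : s.1 3 = 0
    · exact mem_tiled_of_fold h3
    by_cases h01 : s.1 0 + s.1 1 = (π : ℝ)
    · exact mem_tiled_of_triangle h01
    · exact mem_tiled_of_generic h h3 h01
  by_cases hr : IsRegular s
  · exact mem_tiled_iff.2 ⟨1, one_mem _, hr.mem_tile⟩
  by_cases h0 : s ∈ symCurve 0
  · have hg : vertexRot ^ 1 ∈ D5plus := pow_mem (Subgroup.subset_closure (by simp)) 1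
    rw [← map_mem_tiled_iff hg]
    -- If the rotated shape were still on curve 0, the original one would lie on curve 4 as well.
    refine off _ fun h => hr (isRegular_of_two_symCurves (k := 0) (l := 4) (by norm_num)
      (by norm_num) (by norm_num) h0 ?_)
    rw [mem_symCurve_iff, vertexRot_pow_apply, vertexRot_pow_apply] at h
    rw [mem_symCurve_iff]
    exact h
  · exact off s h0

theorem exists_mem_tile (s : LabelledShape) : ∃ g ∈ D5plus, g s ∈ tile :=
  mem_tiled_iff.1 (mem_tiled s)

/-! ### Uniqueness of representatives in the fundamental region -/

theorem perm_inv_apply {α : Type*} (g : Equiv.Perm α) (x : α) : g⁻¹ (g x) = x := by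
  rw [← Equiv.Perm.mul_apply, inv_mul_cancel, Equiv.Perm.one_apply]

theorem eq_one_or_eq_involution {g : Equiv.Perm LabelledShape} (hg : g ∈ D5plus)
    {s : LabelledShape} (h : s ∈ tile) (hr : ¬ IsRegular s) {k : ℕ} (hk : k < 5)
    (hs : involution k s = s) (h' : g s ∈ tile) : g = 1 ∨ g = involution k := by
  have ev := eventually_mem_tile_or h hr hk hs
  have ev' : ∀ᶠ v in nhds (g s), g⁻¹ v ∈ tile ∨ involution k (g⁻¹ v) ∈ tile := by
    have hc := (continuous_of_mem_D5plus (inv_mem hg)).tendsto (g s)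
    rw [perm_inv_apply] at hc
    exact hc.eventually ev
  -- The shape g s is a limit of shapes v in `cell`; for v close to it, g⁻¹ v lies in `tile` or in
  -- its reflection, and freeness on `cell` identifies g.
  rw [← closure_cell, mem_closure_iff_frequently] at h'
  obtain ⟨v, hv, hv'⟩ := (h'.and_eventually ev').exists
  have hoff := map_mem_offCurves (inv_mem hg) (cell_subset_offCurves hv)
  rcases hv' with h1 | h1
  · left
    have := eq_one_of_mem_cell (inv_mem hg) hv (mem_cell_of_mem_offCurves h1 hoff)
    rwa [inv_eq_one] at this
  · right
    have := eq_one_of_mem_cell (mul_mem (involution_mem k) (inv_mem hg)) hv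
      (mem_cell_of_mem_offCurves h1 (map_mem_offCurves (involution_mem k) hoff))
    rw [mul_inv_eq_one] at this
    exact this.symm

theorem map_eq_of_mem_tile {g : Equiv.Perm LabelledShape} (hg : g ∈ D5plus) {s : LabelledShape}
    (h : s ∈ tile) (h' : g s ∈ tile) : g s = s := by
  by_cases hr : IsRegular s
  · exact hr.fixed hg
  rcases mem_cell_or_arcs h with h1 | h1
  · have h2 := mem_cell_of_mem_offCurves h' (map_mem_offCurves hg (cell_subset_offCurves h1))
    rw [eq_one_of_mem_cell hg h1 h2, Equiv.Perm.one_apply]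
  · obtain ⟨k, hk, -, hks⟩ := exists_symCurve_of_mem_arcs h1
    rw [mem_symCurve_iff_fixed] at hks
    rcases eq_one_or_eq_involution hg h hr hk hks h' with rfl | rfl
    · rfl
    · exact hks

theorem toOriented_eq_iff {s t : LabelledShape} :
    toOriented s = toOriented t ↔ ∃ g ∈ D5plus, g t = s := by
  rw [toOriented, toOriented, Quotient.eq]
  constructor
  · rintro ⟨g, h⟩
    exact ⟨g, g.2, h⟩
  · rintro ⟨g, hg, h⟩
    exact ⟨⟨g, hg⟩, h⟩

theorem existsUnique_oriented (o : OrientedShape) : ∃! s, s ∈ tile ∧ toOriented s = o := by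
  induction o using Quotient.inductionOn with
  | h s =>
    obtain ⟨g, hg, h⟩ := exists_mem_tile s
    refine ⟨g s, ⟨h, toOriented_eq_iff.2 ⟨g, hg, rfl⟩⟩, ?_⟩
    rintro t ⟨ht, ht'⟩
    have : toOriented t = toOriented (g s) := by
      rw [show toOriented t = toOriented s from ht']
      exact (toOriented_eq_iff.2 ⟨g, hg, rfl⟩).symm
    obtain ⟨g', hg', rfl⟩ := toOriented_eq_iff.1 this
    exact map_eq_of_mem_tile hg' h ht

/-! ### The regions -/

theorem regions_eq : regions = range fun g : D5plus => (g : Equiv.Perm LabelledShape) '' cell := by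
  ext C
  constructor
  · rintro ⟨s, hs, rfl⟩
    obtain ⟨g, hg, h⟩ := exists_mem_tile s
    have h1 := mem_cell_of_mem_offCurves h (map_mem_offCurves hg hs)
    exact ⟨⟨g⁻¹, inv_mem hg⟩, (connectedComponentIn_offCurves (inv_mem hg)
      ⟨g s, h1, perm_inv_apply g s⟩).symm⟩
  · rintro ⟨g, rfl⟩
    exact ⟨g.1 center, map_mem_offCurves g.2 (cell_subset_offCurves center_mem_cell),
      (connectedComponentIn_offCurves g.2 (mem_image_of_mem _ center_mem_cell)).symm⟩

theorem injective_image_cell :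
    Function.Injective fun g : D5plus => (g : Equiv.Perm LabelledShape) '' cell := by
  intro g h hgh
  simp only at hgh
  have h1 : g.1 center ∈ h.1 '' cell := hgh ▸ mem_image_of_mem _ center_mem_cell
  obtain ⟨u, hu, hu'⟩ := h1
  have h2 : (g.1⁻¹ * h.1) u ∈ cell := by
    rw [Equiv.Perm.mul_apply, hu', perm_inv_apply]
    exact center_mem_cell
  have := eq_one_of_mem_cell (mul_mem (inv_mem g.2) h.2) hu h2
  exact Subtype.ext (inv_mul_eq_one.1 this)

theorem ncard_regions : regions.ncard = 10 := by
  rw [regions_eq, ← image_univ, ncard_image_of_injective _ injective_image_cell, ncard_univ,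
    card_D5plus]

theorem region_open_simplyConnected {C : Set LabelledShape} (hC : C ∈ regions) :
    IsOpen C ∧ SimplyConnectedSpace C := by
  rw [regions_eq] at hC
  obtain ⟨g, rfl⟩ := hC
  refine ⟨isOpen_image g.2 isOpen_cell, ?_⟩
  have : ContractibleSpace ((g : Equiv.Perm LabelledShape) '' cell) :=
    ((symmHomeo g).image cell).symm.contractibleSpace
  infer_instance

theorem closure_image_cell (g : D5plus) :
    closure ((g : Equiv.Perm LabelledShape) '' cell) = (g : Equiv.Perm LabelledShape) '' tile := by
  rw [← closure_cell]
  exact ((symmHomeo g).image_closure cell).symm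

theorem injective_image_tile :
    Function.Injective fun g : D5plus => (g : Equiv.Perm LabelledShape) '' tile := by
  have key : ∀ g : D5plus, (g : Equiv.Perm LabelledShape) '' tile ∩ offCurves
      = (g : Equiv.Perm LabelledShape) '' cell := by
    intro g
    ext s
    constructor
    · rintro ⟨⟨u, hu, rfl⟩, hs⟩
      exact ⟨u, mem_cell_of_mem_offCurves hu ((map_mem_offCurves_iff g.2).1 hs), rfl⟩
    · rintro ⟨u, hu, rfl⟩
      exact ⟨⟨u, cell_subset_tile hu, rfl⟩, map_mem_offCurves g.2 (cell_subset_offCurves hu)⟩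
  intro g h hgh
  apply injective_image_cell
  simp only at hgh ⊢
  rw [← key, ← key, hgh]

theorem existsUnique_closure {C : Set LabelledShape} (hC : C ∈ regions) :
    ∃! g : D5plus, closure C = (g : Equiv.Perm LabelledShape) '' tile := by
  rw [regions_eq] at hC
  obtain ⟨g, rfl⟩ := hC
  refine ⟨g, closure_image_cell g, fun h hh => ?_⟩
  have : closure ((g : Equiv.Perm LabelledShape) '' cell) = _ := closure_image_cell g
  exact injective_image_tile (hh.symm.trans this)

theorem not_mem_cell_of_mem_arcs {s : LabelledShape} (h : s ∈ arcs) : s ∉ cell := by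
  intro hc
  obtain ⟨k, hk, -, hks⟩ := exists_symCurve_of_mem_arcs h
  exact mem_offCurves_iff.1 (cell_subset_offCurves hc) k hk (mem_symCurve_iff_fixed.1 hks)

/-- A point of a side is a limit of `cell` and fixed by a reflection; were it interior, reflected
points of `cell` would fall into `tile`, against freeness. -/
theorem interior_tile : interior tile = cell := by
  apply subset_antisymm
  · intro s hs
    rcases mem_cell_or_arcs (interior_subset hs) with h | h
    · exact h
    exfalso
    obtain ⟨k, hk, -, hks⟩ := exists_symCurve_of_mem_arcs h
    rw [mem_symCurve_iff_fixed] at hks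
    have hcl : s ∈ closure cell := closure_cell ▸ interior_subset hs
    have hc := (continuous_of_mem_D5plus (involution_mem k)).tendsto s
    rw [hks] at hc
    have ev := hc.eventually (mem_interior_iff_mem_nhds.1 hs)
    rw [mem_closure_iff_frequently] at hcl
    obtain ⟨u, hu, hu'⟩ := (hcl.and_eventually ev).exists
    exact involution_ne_one hk (eq_one_of_mem_cell (involution_mem k) hu
      (mem_cell_of_mem_offCurves hu' (map_mem_offCurves (involution_mem k)
        (cell_subset_offCurves hu))))
  · exact interior_maximal cell_subset_tile isOpen_cell

theorem frontier_tile : frontier tile = arcs := by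
  rw [frontier, interior_tile, isClosed_tile.closure_eq]
  ext s
  constructor
  · rintro ⟨h1, h2⟩
    exact (mem_cell_or_arcs h1).resolve_left h2
  · intro h
    exact ⟨arcs_subset_tile h, not_mem_cell_of_mem_arcs h⟩

theorem IsRegular.planeCoord_ne_zero {s : LabelledShape} (h : IsRegular s) :
    (planeCoord s).1 ≠ 0 ∧ (planeCoord s).2 ≠ 0 := by
  have := pi_pos
  rcases h with h | h | h | h
  · rw [planeCoord_of_one h]
    constructor <;> simp only <;> positivity
  · rw [planeCoord_of_neg_one h]
    constructor <;> simp only <;> rw [neg_ne_zero] <;> positivity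
  · rw [planeCoord_of_three h]
    constructor <;> simp only
    · rw [neg_ne_zero]
      positivity
    · positivity
  · rw [planeCoord_of_neg_three h]
    constructor <;> simp only
    · positivity
    · rw [neg_ne_zero]
      positivity

theorem zero_mem_Icc : (0 : ℝ) ∈ Icc (-(2 * π / 5)) (4 * π / 5) :=
  ⟨by linarith [pi_pos], by positivity⟩

theorem exists_right_arc_not_isRegular : ∃ s ∈ ⇑(vertexRot ^ 1) '' b₄, ¬ IsRegular s := by
  obtain ⟨s, hs, -⟩ := exists_right_arc zero_mem_Icc
  refine ⟨s, mem_right_arc.2 ⟨0, zero_mem_Icc, ?_⟩, fun h => h.planeCoord_ne_zero.2 ?_⟩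
  all_goals rw [hs.planeCoord_eq]
  · ext <;> simp only <;> ring
  · simp only
    ring

theorem exists_top_arc_not_isRegular : ∃ s ∈ ⇑(vertexRot ^ 3) '' b₁, ¬ IsRegular s := by
  obtain ⟨s, hs, -⟩ := exists_top_arc zero_mem_Icc
  refine ⟨s, mem_top_arc.2 ⟨0, zero_mem_Icc, ?_⟩, fun h => h.planeCoord_ne_zero.1 ?_⟩
  all_goals rw [hs.planeCoord_eq]
  · ext <;> simp only <;> ring
  · simp only
    ring

theorem cell_mem_regions : cell ∈ regions := by
  rw [regions_eq]
  exact ⟨1, by simp⟩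

theorem isBoundedByArcs_tile : IsBoundedByArcs tile :=
  ⟨⟨cell, cell_mem_regions, closure_cell.symm⟩, frontier_tile⟩

/-- At a non-regular point of a side only `tile` and its reflection in that side meet. Two sides on
different curves allow different reflections, so only the identity is left. -/
theorem IsBoundedByArcs.eq_tile {φ : Set LabelledShape} (h : IsBoundedByArcs φ) : φ = tile := by
  obtain ⟨⟨C, hC, rfl⟩, hf⟩ := h
  rw [regions_eq] at hC
  obtain ⟨g, rfl⟩ := hC
  simp only at hf ⊢
  rw [closure_image_cell] at hf ⊢
  have hsub : arcs ⊆ (g : Equiv.Perm LabelledShape) '' tile := by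
    rw [← (isClosed_image g.2 isClosed_tile).closure_eq]
    rw [show arcs = _ from hf.symm]
    exact frontier_subset_closure
  have key : ∀ s ∈ arcs, ¬ IsRegular s → ∀ k < 5, s ∈ symCurve k →
      (g : Equiv.Perm LabelledShape)⁻¹ = 1 ∨ (g : Equiv.Perm LabelledShape)⁻¹ = involution k := by
    intro s hs hr k hk hks
    obtain ⟨u, hu, e⟩ := hsub hs
    refine eq_one_or_eq_involution (inv_mem g.2) (arcs_subset_tile hs) hr hk
      (mem_symCurve_iff_fixed.1 hks) ?_
    rwa [← e, perm_inv_apply]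
  obtain ⟨p, hp, hpr⟩ := exists_right_arc_not_isRegular
  obtain ⟨q, hq, hqr⟩ := exists_top_arc_not_isRegular
  have h1 := key p (Or.inl (Or.inl (Or.inl hp))) hpr 1 (by norm_num) (right_arc_subset hp)
  have h3 := key q (Or.inl (Or.inl (Or.inr hq))) hqr 3 (by norm_num) (top_arc_subset hq)
  have hg : (g : Equiv.Perm LabelledShape)⁻¹ = 1 := by
    rcases h1 with h1 | h1
    · exact h1
    rcases h3 with h3 | h3
    · exact h3
    have h13 := involution_injOn (show 1 < 5 by norm_num) (show 3 < 5 by norm_num) (h1.symm.trans h3)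
    norm_num at h13
  rw [inv_eq_one.1 hg, Equiv.Perm.coe_one, image_id]

/-! ### The arcs form a quadrilateral -/

/-- Points on two symmetry curves are regular, and the signs of x and y single out the corner. -/
theorem right_inter_top :
    ⇑(vertexRot ^ 1) '' b₄ ∩ ⇑(vertexRot ^ 3) '' b₁ = {s | HasConstAngle s (π / 5)} := by
  have := pi_pos
  ext s
  constructor
  · rintro ⟨h1, h2⟩
    obtain ⟨t, ht, e1⟩ := mem_right_arc.1 h1
    obtain ⟨u, hu, e2⟩ := mem_top_arc.1 h2
    have p1 : 0 < (planeCoord s).1 := by rw [e1]; exact (arc_mem_Icc ht).1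
    have p2 : 0 < (planeCoord s).2 := by rw [e2]; exact (arc_mem_Icc hu).1
    rcases isRegular_of_two_symCurves (by norm_num) (by norm_num) (by norm_num)
      (right_arc_subset h1) (top_arc_subset h2) with h | h | h | h
    · exact h
    · rw [planeCoord_of_neg_one h] at p1
      simp only at p1
      linarith
    · rw [planeCoord_of_three h] at p1
      simp only at p1
      linarith
    · rw [planeCoord_of_neg_three h] at p2
      simp only at p2
      linarith
  · intro h
    have e := planeCoord_of_one h
    refine ⟨mem_right_arc.2 ⟨_, right_end_mem, ?_⟩, mem_top_arc.2 ⟨_, left_end_mem, ?_⟩⟩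
    · rw [e, arc_end]
    · rw [e, arc_start, neg_neg]

theorem top_inter_left :
    ⇑(vertexRot ^ 3) '' b₁ ∩ ⇑(vertexRot ^ 4) '' b₂ = {s | HasConstAngle s (3 * π / 5)} := by
  have := pi_pos
  ext s
  constructor
  · rintro ⟨h1, h2⟩
    obtain ⟨t, ht, e1⟩ := mem_top_arc.1 h1
    obtain ⟨u, hu, e2⟩ := mem_left_arc.1 h2
    have p1 : 0 < (planeCoord s).2 := by rw [e1]; exact (arc_mem_Icc ht).1
    have p2 : (planeCoord s).1 < 0 := by rw [e2]; exact neg_neg_of_pos (arc_mem_Icc hu).1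
    rcases isRegular_of_two_symCurves (by norm_num) (by norm_num) (by norm_num)
      (top_arc_subset h1) (left_arc_subset h2) with h | h | h | h
    · rw [planeCoord_of_one h] at p2
      simp only at p2
      linarith
    · rw [planeCoord_of_neg_one h] at p1
      simp only at p1
      linarith
    · exact h
    · rw [planeCoord_of_neg_three h] at p2
      simp only at p2
      linarith
  · intro h
    have e := planeCoord_of_three h
    refine ⟨mem_top_arc.2 ⟨_, right_end_mem, ?_⟩, mem_left_arc.2 ⟨_, left_end_mem, ?_⟩⟩
    · rw [e, arc_end]
    · rw [e, arc_start, neg_neg]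

theorem vertexRefl_hasConstAngle {s : LabelledShape} {θ : ℝ} (h : HasConstAngle s θ) :
    HasConstAngle (vertexRefl s) (-θ) := fun i => by
  rw [vertexRefl_apply, h, Real.Angle.coe_neg]

theorem hasConstAngle_vertexRefl_iff {s : LabelledShape} {θ : ℝ} :
    HasConstAngle (vertexRefl s) θ ↔ HasConstAngle s (-θ) := by
  constructor
  · intro h
    simpa only [vertexRefl_vertexRefl] using vertexRefl_hasConstAngle h
  · intro h
    simpa only [neg_neg] using vertexRefl_hasConstAngle h

theorem left_inter_bottom :
    ⇑(vertexRot ^ 4) '' b₂ ∩ ⇑(vertexRot ^ 2) '' b₃ = {s | HasConstAngle s (-(π / 5))} := by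
  ext s
  rw [mem_inter_iff, left_arc_iff, bottom_arc_iff, ← mem_inter_iff, right_inter_top]
  exact hasConstAngle_vertexRefl_iff

theorem right_arc_iff {s : LabelledShape} :
    s ∈ ⇑(vertexRot ^ 1) '' b₄ ↔ vertexRefl s ∈ ⇑(vertexRot ^ 4) '' b₂ := by
  rw [left_arc_iff, vertexRefl_vertexRefl]

theorem bottom_inter_right :
    ⇑(vertexRot ^ 2) '' b₃ ∩ ⇑(vertexRot ^ 1) '' b₄ = {s | HasConstAngle s (-(3 * π / 5))} := by
  ext s
  rw [mem_inter_iff, bottom_arc_iff, right_arc_iff, ← mem_inter_iff, top_inter_left]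
  exact hasConstAngle_vertexRefl_iff

theorem right_inter_left : ⇑(vertexRot ^ 1) '' b₄ ∩ ⇑(vertexRot ^ 4) '' b₂ = ∅ := by
  rw [eq_empty_iff_forall_notMem]
  rintro s ⟨h1, h2⟩
  obtain ⟨t, ht, e1⟩ := mem_right_arc.1 h1
  obtain ⟨u, hu, e2⟩ := mem_left_arc.1 h2
  have := congrArg Prod.fst (e1.symm.trans e2)
  simp only at this
  linarith [(arc_mem_Icc ht).1, (arc_mem_Icc hu).1]

theorem top_inter_bottom : ⇑(vertexRot ^ 3) '' b₁ ∩ ⇑(vertexRot ^ 2) '' b₃ = ∅ := by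
  rw [eq_empty_iff_forall_notMem]
  rintro s ⟨h1, h2⟩
  obtain ⟨t, ht, e1⟩ := mem_top_arc.1 h1
  obtain ⟨u, hu, e2⟩ := mem_bottom_arc.1 h2
  have := congrArg Prod.snd (e1.symm.trans e2)
  simp only at this
  linarith [(arc_mem_Icc ht).1, (arc_mem_Icc hu).1]

/-! ### The symmetry curves -/

theorem symCurve_injective {k l : ℕ} (hk : k < 5) (hl : l < 5) (h : symCurve k = symCurve l) :
    k = l := by
  by_contra hkl
  obtain ⟨s, ⟨u, hu, rfl⟩, hr⟩ := exists_right_arc_not_isRegular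
  have hR : ∀ j, vertexRot ^ j ∈ D5plus := fun j => pow_mem (Subgroup.subset_closure (by simp)) j
  have hu0 : ¬ IsRegular u := fun h0 => hr (by rwa [h0.fixed (hR 1)])
  have hb : u ∈ {s | ∃ a₁ a₂ : ℝ, HasAlpha s a₁ a₂ 0} := by
    obtain ⟨t, -, h⟩ := hu
    exact ⟨_, _, h⟩
  have h1 : (vertexRot ^ k) u ∈ symCurve k := mem_image_of_mem _ hb
  have h2 : (vertexRot ^ k) u ∈ symCurve l := h ▸ h1
  exact hu0 ((isRegular_of_two_symCurves hk hl hkl h1 h2).of_map (hR k))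

theorem eq_bHeight {t u : ℝ} (h : (1 + cos t) * (1 + cos u) = 1 / 4) (hu : 0 ≤ u) (hu' : u ≤ π) :
    u = bHeight t := by
  have h0 : cos (t / 2) ≠ 0 := by
    intro h0
    have : cos t = -1 := by
      have := cos_sq (t / 2)
      rw [h0, show 2 * (t / 2) = t by ring] at this
      linarith
    rw [this] at h
    norm_num at h
  rw [bHeight, ← arccos_cos hu hu']
  congr 1
  have hc := cos_sq (t / 2)
  rw [show 2 * (t / 2) = t by ring] at hc
  have hc2 : cos t = 2 * cos (t / 2) ^ 2 - 1 := by linarith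
  rw [hc2] at h ⊢
  field_simp
  linarith

/-- The closing equation with α₃ = 0 is (1 + cos t)(1 + cos u) = 1/4, satisfied by the pair 2π/5,
4π/5. Monotonicity then tells which quarter takes over beyond an end of another. -/
theorem abs_lt_of_curve {t u : ℝ} (h : (1 + cos t) * (1 + cos u) = 1 / 4) (ht : |t| ≤ π)
    (hu : |u| ≤ π) : (4 * π / 5 < |t| → |u| < 2 * π / 5) ∧ (2 * π / 5 < |t| → |u| < 4 * π / 5) := by
  have hs := sqrt_five_bounds
  have hs5 := Real.sq_sqrt (show (0 : ℝ) ≤ 5 by norm_num)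
  rw [← cos_abs t, ← cos_abs u] at h
  constructor <;> intro ht' <;> by_contra! hu'
  · have a := cos_lt_cos_of_nonneg_of_le_pi (by positivity) ht ht'
    have b := cos_le_cos_of_nonneg_of_le_pi (by positivity) hu hu'
    rw [cos_four_pi_div_five] at a
    rw [cos_two_pi_div_five] at b
    have c := neg_one_le_cos |t|
    nlinarith
  · have a := cos_lt_cos_of_nonneg_of_le_pi (by positivity) ht ht'
    have b := cos_le_cos_of_nonneg_of_le_pi (by positivity) hu hu'
    rw [cos_two_pi_div_five] at a
    rw [cos_four_pi_div_five] at b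
    have c := neg_one_le_cos |t|
    have d := neg_one_le_cos |u|
    nlinarith

theorem hasAlpha_congr {s : LabelledShape} {a₁ a₂ a₃ b₁ b₂ b₃ : ℝ} (h : HasAlpha s a₁ a₂ a₃)
    (h1 : (b₁ : Real.Angle) = a₁) (h2 : (b₂ : Real.Angle) = a₂) (h3 : (b₃ : Real.Angle) = a₃) :
    HasAlpha s b₁ b₂ b₃ := by
  obtain ⟨e2, e3, e4⟩ := h
  refine ⟨?_, ?_, ?_⟩
  · rw [e2]
    simp only [Real.Angle.coe_sub, Real.Angle.coe_neg, h2, h3]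
  · rw [e3]
    simp only [Real.Angle.coe_sub, Real.Angle.coe_neg, Real.Angle.coe_add, h1, h2]
  · rw [e4]
    simp only [Real.Angle.coe_sub, Real.Angle.coe_neg, Real.Angle.coe_add, h2, h3]

theorem symCurve_zero_eq : symCurve 0 = b₁ ∪ b₂ ∪ b₃ ∪ b₄ := by
  have hsym : symCurve 0 = {s | ∃ a₁ a₂ : ℝ, HasAlpha s a₁ a₂ 0} := by
    rw [symCurve, pow_zero, Equiv.Perm.coe_one, image_id]
  rw [hsym]
  apply subset_antisymm
  · rintro s ⟨a₁, a₂, h⟩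
    set t := (a₁ : Real.Angle).toReal with ht
    set u := (a₂ : Real.Angle).toReal with hu
    have h' : HasAlpha s t u 0 :=
      hasAlpha_congr h (Real.Angle.coe_toReal _) (Real.Angle.coe_toReal _) rfl
    obtain ⟨t1, t2⟩ := Real.Angle.toReal_mem_Ioc (a₁ : Real.Angle)
    obtain ⟨u1, u2⟩ := Real.Angle.toReal_mem_Ioc (a₂ : Real.Angle)
    rw [← ht] at t1 t2
    rw [← hu] at u1 u2
    have e := h'.equation
    have hcu : (1 + cos t) * (1 + cos u) = 1 / 4 := by
      have c1 := cos_sq ((t + u) / 2)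
      have c2 := cos_sq ((t - u) / 2)
      have c3 := cos_add_cos t u
      have c4 := cos_add t u
      have c5 := cos_sub t u
      rw [show 2 * ((t + u) / 2) = t + u by ring] at c1
      rw [show 2 * ((t - u) / 2) = t - u by ring] at c2
      rw [cos_zero, c1, c2, c4, c5] at e
      linear_combination e / 4 + c3
    have hcu' : (1 + cos u) * (1 + cos t) = 1 / 4 := by rw [mul_comm]; exact hcu
    have at' : |t| ≤ π := abs_le.2 ⟨t1.le, t2⟩
    have au' : |u| ≤ π := abs_le.2 ⟨u1.le, u2⟩
    obtain ⟨k1, k2⟩ := abs_lt_of_curve hcu at' au'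
    have neg : ∀ {x y : ℝ}, (1 + cos x) * (1 + cos y) = 1 / 4 → |y| ≤ π → y ≤ 0 → y = -bHeight x := by
      intro x y hxy hy hy0
      have := eq_bHeight (t := x) (u := -y) (by rwa [cos_neg]) (by linarith) (by linarith [(abs_le.1 hy).1])
      linarith
    have even : ∀ x, bHeight (-x) = bHeight x := fun x => by
      rw [bHeight, bHeight, neg_div, cos_neg, cos_neg]
    have m₂ : 0 ≤ t → -(4 * π / 5) ≤ u → u ≤ 2 * π / 5 → s ∈ b₂ := by
      intro h1 h2 h3
      refine ⟨-u, ⟨by linarith, by linarith⟩, ?_⟩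
      rwa [even, neg_neg, ← eq_bHeight hcu' h1 t2]
    have m₄ : t ≤ 0 → -(2 * π / 5) ≤ u → u ≤ 4 * π / 5 → s ∈ b₄ := by
      intro h1 h2 h3
      refine ⟨u, ⟨h2, h3⟩, ?_⟩
      rwa [← neg hcu' at' h1]
    rcases le_total 0 u with h0 | h0
    · by_cases hr : 4 * π / 5 < t
      · have ht0 : 0 < t := by linarith [pi_pos]
        have := abs_lt.1 (k1 (by rwa [abs_of_pos ht0]))
        exact Or.inl (Or.inl (Or.inr (m₂ ht0.le (by linarith [pi_pos]) this.2.le)))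
      by_cases hl : t < -(2 * π / 5)
      · have ht0 : t < 0 := by linarith [pi_pos]
        have := abs_lt.1 (k2 (by rw [abs_of_neg ht0]; linarith))
        exact Or.inr (m₄ ht0.le (by linarith [pi_pos]) this.2.le)
      · refine Or.inl (Or.inl (Or.inl ⟨t, ⟨not_lt.1 hl, not_lt.1 hr⟩, ?_⟩))
        rwa [← eq_bHeight hcu h0 u2]
    · by_cases hr : 2 * π / 5 < t
      · have ht0 : 0 < t := by linarith [pi_pos]
        have := abs_lt.1 (k2 (by rwa [abs_of_pos ht0]))
        exact Or.inl (Or.inl (Or.inr (m₂ ht0.le this.1.le (by linarith [pi_pos]))))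
      by_cases hl : t < -(4 * π / 5)
      · have ht0 : t < 0 := by linarith [pi_pos]
        have := abs_lt.1 (k1 (by rw [abs_of_neg ht0]; linarith))
        exact Or.inr (m₄ ht0.le this.1.le (by linarith [pi_pos]))
      · refine Or.inl (Or.inr ⟨-t, ⟨by linarith [not_lt.1 hr], by linarith [not_lt.1 hl]⟩, ?_⟩)
        rwa [even, neg_neg, ← neg hcu au' h0]
  · rintro s (((⟨t, -, h⟩ | ⟨t, -, h⟩) | ⟨t, -, h⟩) | ⟨t, -, h⟩) <;> exact ⟨_, _, h⟩

/-! ### The full symmetry group -/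

theorem vertexRefl_mul_self : vertexRefl * vertexRefl = 1 :=
  Equiv.ext fun s => vertexRefl_vertexRefl s

theorem vertexRefl_conj_mem {g : Equiv.Perm LabelledShape} (hg : g ∈ D5plus) :
    vertexRefl * g * vertexRefl ∈ D5plus := by
  rcases mem_D5plus_cases hg with ⟨k, hk, rfl⟩ | ⟨k, hk, rfl⟩
  · have : vertexRefl * vertexRot ^ k * vertexRefl = vertexRot ^ (5 - k) := by
      refine Equiv.ext fun s => ?_
      rw [Equiv.Perm.mul_apply, Equiv.Perm.mul_apply,
        vertexRefl_vertexRot_pow k (5 - k) (by omega), vertexRefl_vertexRefl]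
    rw [this]
    exact pow_mem (Subgroup.subset_closure (by simp)) _
  · have : vertexRefl * involution k * vertexRefl = involution (5 - k) := by
      refine Equiv.ext fun s => ?_
      rw [Equiv.Perm.mul_apply, Equiv.Perm.mul_apply,
        ← involution_vertexRefl (show k + (5 - k) = 5 by omega), vertexRefl_vertexRefl]
    rw [this]
    exact involution_mem _

theorem D5plus_le_D10 : D5plus ≤ D10 := by
  rw [D5plus, Subgroup.closure_le]
  rintro g (rfl | rfl)
  · exact Subgroup.subset_closure (by simp)
  · exact mul_mem (Subgroup.subset_closure (by simp)) (Subgroup.subset_closure (by simp))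

theorem vertexRefl_mem_D10 : vertexRefl ∈ D10 := Subgroup.subset_closure (by simp)

theorem mem_D10_iff {g : Equiv.Perm LabelledShape} :
    g ∈ D10 ↔ g ∈ D5plus ∨ ∃ h ∈ D5plus, g = h * vertexRefl := by
  constructor
  · intro hg
    have hVV := vertexRefl_mul_self
    have hV : vertexRefl⁻¹ = vertexRefl := inv_eq_of_mul_eq_one_left hVV
    induction hg using Subgroup.closure_induction with
    | mem x hx =>
      rcases hx with rfl | rfl | rfl
      · exact Or.inl (Subgroup.subset_closure (by simp))
      · exact Or.inr ⟨1, one_mem _, (one_mul _).symm⟩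
      · refine Or.inr ⟨mirror * vertexRefl, Subgroup.subset_closure (by simp), ?_⟩
        rw [mul_assoc, hVV, mul_one]
    | one => exact Or.inl (one_mem _)
    | mul x y _ _ hx hy =>
      rcases hx with hx | ⟨x, hx, rfl⟩ <;> rcases hy with hy | ⟨y, hy, rfl⟩
      · exact Or.inl (mul_mem hx hy)
      · exact Or.inr ⟨x * y, mul_mem hx hy, (mul_assoc _ _ _).symm⟩
      · refine Or.inr ⟨x * (vertexRefl * y * vertexRefl), mul_mem hx (vertexRefl_conj_mem hy), ?_⟩
        simp only [mul_assoc, hVV, mul_one]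
      · refine Or.inl ?_
        have := mul_mem hx (vertexRefl_conj_mem hy)
        simpa only [mul_assoc] using this
    | inv x _ hx =>
      rcases hx with hx | ⟨x, hx, rfl⟩
      · exact Or.inl (inv_mem hx)
      · refine Or.inr ⟨vertexRefl * x⁻¹ * vertexRefl, vertexRefl_conj_mem (inv_mem hx), ?_⟩
        rw [mul_inv_rev, hV, mul_assoc, hVV, mul_one]
  · rintro (hg | ⟨h, hh, rfl⟩)
    · exact D5plus_le_D10 hg
    · exact mul_mem (D5plus_le_D10 hh) vertexRefl_mem_D10

theorem mem_orbit_iff {s t : LabelledShape} :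
    t ∈ MulAction.orbit D5plus s ↔ ∃ g ∈ D5plus, g s = t :=
  ⟨fun ⟨g, h⟩ => ⟨g, g.2, h⟩, fun ⟨g, hg, h⟩ => ⟨⟨g, hg⟩, h⟩⟩

theorem orbit_D10_eq (s : LabelledShape) : MulAction.orbit D10 s
    = MulAction.orbit D5plus s ∪ MulAction.orbit D5plus (vertexRefl s) := by
  ext t
  rw [mem_union, mem_orbit_iff, mem_orbit_iff]
  constructor
  · rintro ⟨g, rfl⟩
    rcases mem_D10_iff.1 g.2 with h | ⟨h, hh, e⟩
    · exact Or.inl ⟨g, h, rfl⟩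
    · refine Or.inr ⟨h, hh, ?_⟩
      show _ = (g : Equiv.Perm LabelledShape) s
      rw [e, Equiv.Perm.mul_apply]
  · rintro (⟨g, hg, rfl⟩ | ⟨g, hg, rfl⟩)
    · exact ⟨⟨g, D5plus_le_D10 hg⟩, rfl⟩
    · exact ⟨⟨g * vertexRefl, mul_mem (D5plus_le_D10 hg) vertexRefl_mem_D10⟩, rfl⟩

/-- The D₁₀-orbit is the union of the D₅⁺-orbits of s and V s. If these met, both shapes would be
representatives of one oriented shape in `tile`, hence equal. -/
theorem ncard_orbit_D10 {s : LabelledShape} (h : s ∈ tile) (hV : vertexRefl s ≠ s) :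
    (MulAction.orbit D10 s).ncard
      = (MulAction.orbit D5plus s).ncard + (MulAction.orbit D5plus (vertexRefl s)).ncard := by
  have fin : ∀ u : LabelledShape, (MulAction.orbit D5plus u).Finite := fun u => Set.finite_range _
  rw [orbit_D10_eq, ncard_union_eq _ (fin _) (fin _)]
  rw [disjoint_left]
  intro t h1 h2
  have h3 : vertexRefl s ∈ MulAction.orbit D5plus s := by
    rw [← MulAction.orbit_eq_iff.2 h1, MulAction.mem_orbit_symm]
    exact h2
  obtain ⟨g, hg, e⟩ := mem_orbit_iff.1 h3
  apply hV
  rw [← e]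
  exact map_eq_of_mem_tile hg h (e ▸ vertexRefl_mem_tile h)

theorem IsRegular.vertexRefl {s : LabelledShape} (h : IsRegular s) :
    IsRegular (vertexRefl s) := by
  rcases h with h | h | h | h
  · exact Or.inr (Or.inl (vertexRefl_hasConstAngle h))
  · exact Or.inl (by simpa only [neg_neg] using vertexRefl_hasConstAngle h)
  · exact Or.inr (Or.inr (Or.inr (vertexRefl_hasConstAngle h)))
  · exact Or.inr (Or.inr (Or.inl (by simpa only [neg_neg] using vertexRefl_hasConstAngle h)))

theorem not_isRegular_vertexRefl {s : LabelledShape} (h : ¬ IsRegular s) :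
    ¬ IsRegular (vertexRefl s) := fun h' => h (by simpa only [vertexRefl_vertexRefl] using h'.vertexRefl)

theorem vertexRefl_mem_cell {s : LabelledShape} (h : s ∈ cell) : vertexRefl s ∈ cell := by
  show planeCoord _ ∈ quadInt
  rw [planeCoord_vertexRefl (quad_subset_lens (cell_subset_tile h))]
  exact neg_mem_quadInt.2 h

theorem vertexRefl_mem_arcs {s : LabelledShape} (h : s ∈ arcs) : vertexRefl s ∈ arcs := by
  rcases mem_cell_or_arcs (vertexRefl_mem_tile (arcs_subset_tile h)) with h1 | h1
  · have := vertexRefl_mem_cell h1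
    rw [vertexRefl_vertexRefl] at this
    exact absurd this (not_mem_cell_of_mem_arcs h)
  · exact h1

theorem planeCoord_center : planeCoord center = 0 := by
  have h := planeCoord_vertexRefl (quad_subset_lens (cell_subset_tile center_mem_cell))
  rw [vertexRefl_center] at h
  exact self_eq_neg.1 h

theorem vertexRefl_eq_self_iff {s : LabelledShape} (h : s ∈ tile) :
    vertexRefl s = s ↔ s = center := by
  constructor
  · intro hs
    have h0 := planeCoord_vertexRefl (quad_subset_lens h)
    rw [hs] at h0
    exact eq_of_planeCoord_eq ((self_eq_neg.1 h0).trans planeCoord_center.symm)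
      (cos_mul_cos_pos (quad_subset_lens h)).ne'
  · rintro rfl
    exact vertexRefl_center

theorem eq_center_iff {s : LabelledShape} : s = center ↔ HasAlpha s 0 0 (π - arccos (7 / 8)) :=
  ⟨fun h => h ▸ hasAlpha_center, fun h => h.unique hasAlpha_center⟩

theorem isReflectionSymmetric_of_mem_arcs {s : LabelledShape} (h : s ∈ arcs) :
    IsReflectionSymmetric s := by
  obtain ⟨k, hk, -, hks⟩ := exists_symCurve_of_mem_arcs h
  exact isReflectionSymmetric_iff.2 ⟨k, hk, mem_symCurve_iff_fixed.1 hks⟩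

theorem ncard_orbit_of_mem_cell {s : LabelledShape} (h : s ∈ cell) :
    (MulAction.orbit D5plus s).ncard = 10 := by
  have hoff := cell_subset_offCurves h
  refine (isotropy_generic (fun h' => ?_) (not_isRegular_of_mem_offCurves hoff)).2
  obtain ⟨k, hk, hks⟩ := isReflectionSymmetric_iff.1 h'
  exact mem_offCurves_iff.1 hoff k hk hks

theorem vertexRefl_ne_of_mem_arcs {s : LabelledShape} (h : s ∈ arcs) : vertexRefl s ≠ s := by
  intro hs
  rw [vertexRefl_eq_self_iff (arcs_subset_tile h)] at hs
  exact not_mem_cell_of_mem_arcs h (hs ▸ center_mem_cell)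

theorem ncard_orbit_D10_regular {s : LabelledShape} (hr : IsRegular s) :
    (MulAction.orbit D10 s).ncard = 2 := by
  have h := hr.mem_tile
  have hV : vertexRefl s ≠ s := by
    rw [Ne, vertexRefl_eq_self_iff h]
    rintro rfl
    exact center_not_isRegular hr
  rw [ncard_orbit_D10 h hV, (isotropy_regular hr).2, (isotropy_regular hr.vertexRefl).2]

theorem ncard_orbit_D10_arcs {s : LabelledShape} (h : s ∈ arcs) (hr : ¬ IsRegular s) :
    (MulAction.orbit D10 s).ncard = 10 := by
  rw [ncard_orbit_D10 (arcs_subset_tile h) (vertexRefl_ne_of_mem_arcs h),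
    (isotropy_symmetric (isReflectionSymmetric_of_mem_arcs h) hr).2.2,
    (isotropy_symmetric (isReflectionSymmetric_of_mem_arcs (vertexRefl_mem_arcs h))
      (not_isRegular_vertexRefl hr)).2.2]

theorem ncard_orbit_D10_center : (MulAction.orbit D10 center).ncard = 10 := by
  rw [orbit_D10_eq, vertexRefl_center, union_self, ncard_orbit_of_mem_cell center_mem_cell]

theorem ncard_orbit_D10_cell {s : LabelledShape} (h : s ∈ cell) (hV : vertexRefl s ≠ s) :
    (MulAction.orbit D10 s).ncard = 20 := by
  rw [ncard_orbit_D10 (cell_subset_tile h) hV, ncard_orbit_of_mem_cell h,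
    ncard_orbit_of_mem_cell (vertexRefl_mem_cell h)]

/-! ### The half of the fundamental region -/

theorem mem_halfRegion {s : LabelledShape} {σ : ℝ} : s ∈ halfRegion tile σ ↔
    s ∈ tile ∧ (red₂ s < red₁ s ∨ red₁ s = red₂ s ∧ 0 ≤ σ * red₁ s) := by
  constructor
  · rintro ⟨h, a₁, a₂, a₃, hr, h'⟩
    obtain ⟨rfl, rfl, -⟩ := hr.eq_red
    exact ⟨h, h'⟩
  · rintro ⟨h, h'⟩
    exact ⟨h, _, _, _, hasReducedAlpha_red s, h'⟩

theorem red_vertexRefl {s : LabelledShape} (h : s ∈ tile) :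
    red₁ (vertexRefl s) = -red₁ s ∧ red₂ (vertexRefl s) = -red₂ s := by
  obtain ⟨h1, h2, -⟩ := (hasReducedAlpha_vertexRefl (quad_subset_lens h)).eq_red
  exact ⟨h1.symm, h2.symm⟩

theorem mem_halfRegion_or {s : LabelledShape} (h : s ∈ tile) (σ : ℝ) :
    s ∈ halfRegion tile σ ∨ vertexRefl s ∈ halfRegion tile σ := by
  rw [mem_halfRegion, mem_halfRegion]
  obtain ⟨e1, e2⟩ := red_vertexRefl h
  rw [e1, e2]
  rcases lt_trichotomy (red₁ s) (red₂ s) with h1 | h1 | h1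
  · exact Or.inr ⟨vertexRefl_mem_tile h, Or.inl (neg_lt_neg h1)⟩
  · rcases le_total 0 (σ * red₁ s) with h2 | h2
    · exact Or.inl ⟨h, Or.inr ⟨h1, h2⟩⟩
    · refine Or.inr ⟨vertexRefl_mem_tile h, Or.inr ⟨by rw [h1], ?_⟩⟩
      rw [mul_neg]
      linarith
  · exact Or.inl ⟨h, Or.inl h1⟩

theorem vertexRefl_eq_of_mem_halfRegion {s : LabelledShape} {σ : ℝ} (hσ : σ = 1 ∨ σ = -1)
    (h : s ∈ halfRegion tile σ) (h' : vertexRefl s ∈ halfRegion tile σ) : vertexRefl s = s := by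
  rw [mem_halfRegion] at h h'
  obtain ⟨ht, h⟩ := h
  obtain ⟨-, h'⟩ := h'
  obtain ⟨e1, e2⟩ := red_vertexRefl ht
  rw [e1, e2] at h'
  have hz : red₁ s = 0 ∧ red₂ s = 0 := by
    rcases h with h | ⟨h, hp⟩ <;> rcases h' with h' | ⟨h', hp'⟩
    · linarith
    · linarith
    · linarith
    · have h0 : σ * red₁ s = 0 := by linarith
      have hσ0 : σ ≠ 0 := by rcases hσ with rfl | rfl <;> norm_num
      have := (mul_eq_zero.1 h0).resolve_left hσ0
      exact ⟨this, by rw [← h, this]⟩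
  rw [vertexRefl_eq_self_iff ht]
  refine eq_of_planeCoord_eq ?_ (cos_mul_cos_pos (quad_subset_lens ht)).ne'
  rw [planeCoord_center, planeCoord, hz.1, hz.2]
  ext <;> simp

theorem toUnoriented_eq_iff {s t : LabelledShape} :
    toUnoriented s = toUnoriented t ↔ ∃ g ∈ D10, g t = s := by
  rw [toUnoriented, toUnoriented, Quotient.eq]
  constructor
  · rintro ⟨g, h⟩
    exact ⟨g, g.2, h⟩
  · rintro ⟨g, hg, h⟩
    exact ⟨⟨g, hg⟩, h⟩

theorem existsUnique_unoriented {σ : ℝ} (hσ : σ = 1 ∨ σ = -1) (o : UnorientedShape) :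
    ∃! s, s ∈ halfRegion tile σ ∧ toUnoriented s = o := by
  have uniq : ∀ s ∈ halfRegion tile σ, ∀ t ∈ halfRegion tile σ,
      toUnoriented s = toUnoriented t → s = t := by
    intro s hs t ht h
    have hs' := (mem_halfRegion.1 hs).1
    have ht' := (mem_halfRegion.1 ht).1
    obtain ⟨g, hg, rfl⟩ := toUnoriented_eq_iff.1 h
    rcases mem_D10_iff.1 hg with hg | ⟨h, hh, rfl⟩
    · exact map_eq_of_mem_tile hg ht' hs'
    · rw [Equiv.Perm.mul_apply] at hs hs' ⊢
      have := map_eq_of_mem_tile hh (vertexRefl_mem_tile ht') hs'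
      rw [this] at hs ⊢
      exact vertexRefl_eq_of_mem_halfRegion hσ ht hs
  have ex : ∃ s ∈ halfRegion tile σ, toUnoriented s = o := by
    induction o using Quotient.inductionOn with
    | h s =>
      obtain ⟨g, hg, h⟩ := exists_mem_tile s
      rcases mem_halfRegion_or h σ with h1 | h1
      · exact ⟨_, h1, toUnoriented_eq_iff.2 ⟨g, D5plus_le_D10 hg, rfl⟩⟩
      · exact ⟨_, h1, toUnoriented_eq_iff.2
          ⟨vertexRefl * g, mul_mem vertexRefl_mem_D10 (D5plus_le_D10 hg), rfl⟩⟩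
  obtain ⟨s, hs, rfl⟩ := ex
  exact ⟨s, ⟨hs, rfl⟩, fun t ht => uniq t ht.1 s hs ht.2⟩

theorem halfRegion_union (σ : ℝ) :
    halfRegion tile σ ∪ vertexRefl '' halfRegion tile σ = tile := by
  apply subset_antisymm
  · rintro s (h | ⟨u, hu, rfl⟩)
    · exact (mem_halfRegion.1 h).1
    · exact vertexRefl_mem_tile (mem_halfRegion.1 hu).1
  · intro s hs
    rcases mem_halfRegion_or hs σ with h | h
    · exact Or.inl h
    · exact Or.inr ⟨_, h, vertexRefl_vertexRefl s⟩

/-! ### The angle sum -/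

/-- By the closing equation, (cos α₁ + cos α₂)(cos α₂ - cos α₃) is the difference in `cos_sq_lt`,
hence positive. The bound fixes which representatives of ψ₂ and ψ₄ lie in (-π, π]. -/
theorem abs_red₂_lt_red₃ {s : LabelledShape} (h : s ∈ tile) : |red₂ s| < red₃ s := by
  obtain ⟨-, -, ⟨r3, r4⟩, ⟨r5, r6⟩⟩ := hasReducedAlpha_red s
  have hab := cos_mul_cos_pos (quad_subset_lens h)
  have heq := planeCoord_equation s
  have hsq := (cos_sq_lt (show ((planeCoord s).1, (planeCoord s).2) ∈ quad from h)).1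
  have c3 := cos_add_cos (red₁ s) (red₂ s)
  have c1 := cos_sq ((red₁ s + red₂ s) / 2)
  have c2 := cos_sq ((red₁ s - red₂ s) / 2)
  have c4 := cos_add (red₁ s) (red₂ s)
  have c5 := cos_sub (red₁ s) (red₂ s)
  rw [show 2 * ((red₁ s + red₂ s) / 2) = red₁ s + red₂ s by ring] at c1
  rw [show 2 * ((red₁ s - red₂ s) / 2) = red₁ s - red₂ s by ring] at c2
  simp only [planeCoord] at hab heq hsq
  rw [show (red₁ s + red₂ s + (red₁ s - red₂ s)) / 2 = red₁ s by ring] at hsq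
  rw [← strictAntiOn_cos.lt_iff_gt ⟨r5.le, r6⟩ ⟨abs_nonneg _, abs_le.2 ⟨r3.le, r4⟩⟩, cos_abs]
  have e : (cos (red₁ s) + cos (red₂ s)) * (cos (red₂ s) - cos (red₃ s))
      = 4 * (cos ((red₁ s + red₂ s) / 2) * cos ((red₁ s - red₂ s) / 2)) ^ 2 + 3 / 4
        - cos (red₁ s) ^ 2 := by
    have h1 : (1 / 4 : ℝ) = 1 + cos (red₁ s) * cos (red₂ s)
        + (cos (red₁ s) + cos (red₂ s)) * cos (red₃ s) := by
      rw [c1, c2, c4, c5] at heq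
      rw [c3]
      linear_combination -heq / 4
    have h2 : 4 * (cos ((red₁ s + red₂ s) / 2) * cos ((red₁ s - red₂ s) / 2)) ^ 2
        = (cos (red₁ s) + cos (red₂ s)) ^ 2 := by
      rw [c3]
      ring
    rw [h2]
    linear_combination h1
  have hpos : 0 < cos (red₁ s) + cos (red₂ s) := by linarith
  have : 0 < (cos (red₁ s) + cos (red₂ s)) * (cos (red₂ s) - cos (red₃ s)) := by linarith
  linarith [(pos_iff_pos_of_mul_pos this).1 hpos]

theorem toReal_eq_of_eq_coe {θ : Real.Angle} {x : ℝ} (h : θ = (x : Real.Angle))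
    (hx : x ∈ Ioc (-π) π) : θ.toReal = x := by
  rw [h]
  exact Real.Angle.toReal_coe_eq_self_iff_mem_Ioc.2 hx

theorem relAngle_zero_add_one (s : LabelledShape) :
    s.1 0 + s.1 1 = ((planeCoord s).1 : Real.Angle) := by
  have hs := sum_relAngle s
  obtain ⟨h2, h3, h4⟩ := (hasReducedAlpha_red s).1
  have e : s.1 2 + s.1 3 + s.1 4 = ((π - (planeCoord s).1 : ℝ) : Real.Angle) := by
    rw [h2, h3, h4, ← Real.Angle.coe_add, ← Real.Angle.coe_add, planeCoord]
    congr 1; ring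
  rw [Real.Angle.coe_sub] at e
  linear_combination (norm := module) hs - e

theorem cos_relAngle_zero_add_cos_one (s : LabelledShape) :
    (s.1 0).cos + (s.1 1).cos
      = 1 / 2 + 2 * cos ((planeCoord s).1 / 2) ^ 2 - 2 * cos ((planeCoord s).2 / 2) ^ 2 := by
  have hc := (hasReducedAlpha_red s).1.cos_closing
  have heq := planeCoord_equation s
  have h01 := relAngle_zero_add_one s
  have k1 := hc (-((planeCoord s).1 / 2 + red₃ s))
  have k2 := hc ((planeCoord s).1 / 2 - red₃ s)
  simp only [planeCoord] at heq h01 k1 k2 ⊢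
  rw [add_neg_cancel, Real.Angle.coe_zero, zero_sub, Real.Angle.cos_neg, cos_neg, neg_add,
    neg_add_cancel_right, cos_neg] at k1
  rw [sub_add_cancel, show (red₁ s + red₂ s) / 2 + red₃ s + ((red₁ s + red₂ s) / 2 - red₃ s)
    = red₁ s + red₂ s by ring, ← h01, add_sub_cancel_right] at k2
  rw [← k1, ← k2, cos_add, cos_sub ((red₁ s + red₂ s) / 2)]
  linear_combination heq / 2

/-- In this quadrant x ≤ kap 0, so cos x ≥ -1/4 and the right side is at least 1. -/
theorem cos_sq_lt_of_nonneg {x y : ℝ} (h : (x, y) ∈ quad) (hx : 0 ≤ x) (hy : 0 < y) :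
    cos (y / 2) ^ 2 < 1 / 4 + 2 * cos (x / 2) ^ 2 := by
  obtain ⟨-, h2, h3, -⟩ := h
  simp only at h2 h3
  rw [abs_of_pos hy] at h2
  have hk0 : |(0 : ℝ)| ≤ 4 * π / 5 := by
    rw [abs_zero]
    positivity
  have h4 : x ≤ kap 0 := by
    have := arc_le_kap_zero hy.le h2
    rw [arc] at this
    linarith [(abs_le.1 h3).2]
  have h5 : cos (kap 0) ≤ cos x :=
    cos_le_cos_of_nonneg_of_le_pi hx (by linarith [kap_le hk0, pi_pos]) h4
  rw [cos_kap hk0, zero_div, cos_zero] at h5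
  have h6 := cos_sq (x / 2)
  rw [show 2 * (x / 2) = x by ring] at h6
  have h7 : cos (y / 2) < 1 := by
    rw [← cos_zero]
    exact cos_lt_cos_of_nonneg_of_le_pi le_rfl (by linarith [pi_pos]) (by linarith)
  have h8 : 0 < cos (y / 2) := cos_half_pos (by rw [abs_of_pos hy]; linarith [pi_pos])
  nlinarith

/-- Modulo 2π, ψ₅ + ψ₁ = x. A wrap against the sign of y would give cos ψ₅ + cos ψ₁ ≤ -2 cos² (x/2),
contradicting `cos_relAngle_zero_add_cos_one` and `cos_sq_lt_of_nonneg`. -/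
theorem wrap_sum {s : LabelledShape} (h : s ∈ tile) : ∃ m : ℤ,
    (s.1 0).toReal + (s.1 1).toReal = (planeCoord s).1 + 2 * π * m ∧ -1 ≤ m ∧ m ≤ 1 ∧
      (m = -1 → ¬ 0 < (planeCoord s).2) ∧ (m = 1 → ¬ (planeCoord s).2 < 0) := by
  obtain ⟨a1, a2⟩ := Real.Angle.toReal_mem_Ioc (s.1 0)
  obtain ⟨b1, b2⟩ := Real.Angle.toReal_mem_Ioc (s.1 1)
  have h01 := relAngle_zero_add_one s
  have hcos := cos_relAngle_zero_add_cos_one s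
  rw [← Real.Angle.coe_toReal (s.1 0), ← Real.Angle.coe_toReal (s.1 1), ← Real.Angle.coe_add,
    Real.Angle.angle_eq_iff_two_pi_dvd_sub] at h01
  rw [← Real.Angle.cos_toReal (s.1 0), ← Real.Angle.cos_toReal (s.1 1), cos_add_cos] at hcos
  set p := (s.1 0).toReal
  set q := (s.1 1).toReal
  set x := (planeCoord s).1 with hx
  set y := (planeCoord s).2 with hy
  have hq : (x, y) ∈ quad := h
  obtain ⟨x1, x2⟩ := abs_le.1 hq.1
  simp only at x1 x2
  obtain ⟨m, hm⟩ := h01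
  have ha := cos_half_pos (x := x) (abs_lt.2 ⟨by linarith [pi_pos], by linarith [pi_pos]⟩)
  have m1 : -1 ≤ m := by
    by_contra! hlt
    have : (m : ℝ) ≤ -2 := by exact_mod_cast (show m ≤ -2 by omega)
    have := mul_le_mul_of_nonneg_left this (show 0 ≤ 2 * π by positivity)
    linarith [pi_pos]
  have m2 : m ≤ 1 := by
    by_contra! hlt
    have : (2 : ℝ) ≤ m := by exact_mod_cast (show 2 ≤ m by omega)
    have := mul_le_mul_of_nonneg_left this (show 0 ≤ 2 * π by positivity)
    linarith [pi_pos]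
  refine ⟨m, by linarith, m1, m2, ?_, ?_⟩
  · rintro rfl hy0
    push_cast at hm
    have hlt := cos_sq_lt_of_nonneg hq (by linarith) hy0
    have hd : cos (x / 2) ≤ cos ((p - q) / 2) := by
      rw [← cos_abs ((p - q) / 2)]
      exact cos_le_cos_of_nonneg_of_le_pi (abs_nonneg _) (by linarith [pi_pos])
        (abs_le.2 ⟨by linarith, by linarith⟩)
    rw [show (p + q) / 2 = x / 2 - π by linarith, cos_sub_pi] at hcos
    nlinarith
  · rintro rfl hy0
    push_cast at hm
    have hlt := cos_sq_lt_of_nonneg (neg_mem_quad.2 hq) (by linarith) (by linarith : 0 < -y)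
    rw [neg_div, cos_neg, neg_div, cos_neg] at hlt
    have hd : cos (x / 2) ≤ cos ((p - q) / 2) := by
      rw [← cos_abs ((p - q) / 2), ← cos_neg (x / 2)]
      exact cos_le_cos_of_nonneg_of_le_pi (abs_nonneg _) (by linarith [pi_pos])
        (abs_le.2 ⟨by linarith, by linarith⟩)
    rw [show (p + q) / 2 = x / 2 + π by linarith, cos_add_pi] at hcos
    nlinarith

theorem angleSum_pos_iff {s : LabelledShape} (h : s ∈ tile) (h0 : (planeCoord s).2 ≠ 0) :
    0 < angleSum s ↔ 0 < (planeCoord s).2 := by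
  obtain ⟨m, hm, m1, m2, m3, m4⟩ := wrap_sum h
  obtain ⟨e2, e3, e4⟩ := (hasReducedAlpha_red s).1
  obtain ⟨k1, k2⟩ := abs_lt.1 (abs_red₂_lt_red₃ h)
  obtain ⟨-, -, ⟨r3, r4⟩, ⟨r5, r6⟩⟩ := hasReducedAlpha_red s
  obtain ⟨y1, y2⟩ := abs_le.1 (show |(planeCoord s).2| ≤ 4 * π / 5 from h.2.1)
  have hp := pi_pos
  have hX : (planeCoord s).1 = red₁ s + red₂ s := rfl
  have hY : (planeCoord s).2 = red₁ s - red₂ s := rfl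
  rw [hX] at hm
  rw [hY] at h0 m3 m4 y1 y2 ⊢
  have t2 := toReal_eq_of_eq_coe e2 ⟨by linarith, by linarith⟩
  have t4 : (s.1 4).toReal = red₃ s - red₂ s - π := by
    refine toReal_eq_of_eq_coe ?_ ⟨by linarith, by linarith⟩
    rw [e4]
    exact Real.Angle.angle_eq_iff_two_pi_dvd_sub.2 ⟨1, by push_cast; ring⟩
  rw [angleSum, sum_univ_zmod_five, hm, t2, t4]
  -- All coordinates cancel in the sum: it equals 2πm - π for y < 0 and 2πm + π for y > 0, and
  -- `wrap_sum` gives m ≤ 0 and m ≥ 0 respectively.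
  rcases lt_or_gt_of_ne h0 with hneg | hpos
  · have t3 := toReal_eq_of_eq_coe e3 ⟨by linarith, by linarith⟩
    rw [t3]
    have : (m : ℝ) ≤ 0 := by
      have : m ≠ 1 := fun h => m4 h hneg
      exact_mod_cast (show m ≤ 0 by omega)
    have := mul_nonpos_of_nonneg_of_nonpos (show 0 ≤ 2 * π by positivity) this
    constructor <;> intro _ <;> linarith
  · have t3 : (s.1 3).toReal = π - (red₁ s - red₂ s) := by
      refine toReal_eq_of_eq_coe ?_ ⟨by linarith, by linarith⟩
      rw [e3]
      exact Real.Angle.angle_eq_iff_two_pi_dvd_sub.2 ⟨-1, by push_cast; ring⟩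
    rw [t3]
    have : (0 : ℝ) ≤ m := by
      have : m ≠ -1 := fun h => m3 h hpos
      exact_mod_cast (show 0 ≤ m by omega)
    have := mul_nonneg (show 0 ≤ 2 * π by positivity) this
    constructor <;> intro _ <;> linarith

theorem mem_halfRegion_iff_angleSum {s : LabelledShape} (h : s ∈ tile) {a₁ a₂ a₃ : ℝ}
    (hr : HasReducedAlpha s a₁ a₂ a₃) (hne : a₁ ≠ a₂) (σ : ℝ) :
    s ∈ halfRegion tile σ ↔ 0 < angleSum s := by
  obtain ⟨rfl, rfl, -⟩ := hr.eq_red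
  rw [mem_halfRegion, angleSum_pos_iff h (sub_ne_zero.2 hne), planeCoord, sub_pos]
  constructor
  · rintro ⟨-, h | ⟨h, -⟩⟩
    · exact h
    · exact absurd h hne
  · intro h'
    exact ⟨h, Or.inl h'⟩

theorem reduced_of_mem_tile {s : LabelledShape} (h : s ∈ tile) :
    ∃ a₁ a₂ a₃ : ℝ, HasReducedAlpha s a₁ a₂ a₃ ∧
      ∀ s' ∈ tile, ∀ a₃' : ℝ, HasReducedAlpha s' a₁ a₂ a₃' → s' = s := by
  refine ⟨_, _, _, hasReducedAlpha_red s, fun s' _ a₃' h' => ?_⟩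
  exact (eq_of_planeCoord_eq h'.planeCoord_eq.symm (cos_mul_cos_pos (quad_subset_lens h)).ne').symm

end EquilateralPentagon

end

open EquilateralPentagon in
theorem mainTheorem2 :
    -- the groups
    (vertexRot ^ 5 = 1 ∧ (mirror * vertexRefl) ^ 2 = 1 ∧
      (mirror * vertexRefl) * vertexRot = vertexRot⁻¹ * (mirror * vertexRefl) ∧
      Nonempty (D5plus ≃* DihedralGroup 5) ∧ Nonempty (D10 ≃* DihedralGroup 10)) ∧
    -- isotropy groups and orbit lengths of the action of `D₅⁺`
    ((∃ s, HasConstAngle s (π / 5)) ∧ (∃ s, HasConstAngle s (-(π / 5))) ∧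
      (∃ s, HasConstAngle s (3 * π / 5)) ∧ (∃ s, HasConstAngle s (-(3 * π / 5))) ∧
      (∀ s, IsRegular s →
        MulAction.stabilizer D5plus s = ⊤ ∧ (MulAction.orbit D5plus s).ncard = 1) ∧
      (∀ s, IsReflectionSymmetric s → ¬ IsRegular s →
        (∃ k < 5, ∃ g : D5plus, (g : Equiv.Perm LabelledShape) = involution k ∧
          MulAction.stabilizer D5plus s = Subgroup.zpowers g) ∧
        Nonempty (MulAction.stabilizer D5plus s ≃* Multiplicative (ZMod 2)) ∧
        (MulAction.orbit D5plus s).ncard = 5) ∧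
      (∀ s, ¬ IsReflectionSymmetric s → ¬ IsRegular s →
        MulAction.stabilizer D5plus s = ⊥ ∧ (MulAction.orbit D5plus s).ncard = 10)) ∧
    -- the five symmetry curves
    ((∀ k < 5, symCurve k = {s | involution k s = s}) ∧
      (∀ k < 5, ∀ l < 5, symCurve k = symCurve l → k = l) ∧
      (∀ s, IsReflectionSymmetric s ↔ ∃ k < 5, s ∈ symCurve k) ∧
      symCurve 0 = b₁ ∪ b₂ ∪ b₃ ∪ b₄) ∧
    -- the ten regions
    (regions.ncard = 10 ∧ ∀ C ∈ regions, IsOpen C ∧ SimplyConnectedSpace C) ∧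
    -- the four arcs form a quadrilateral, with the regular shapes as corners
    (⇑(vertexRot ^ 1) '' b₄ ∩ ⇑(vertexRot ^ 3) '' b₁ = {s | HasConstAngle s (π / 5)} ∧
      ⇑(vertexRot ^ 3) '' b₁ ∩ ⇑(vertexRot ^ 4) '' b₂ = {s | HasConstAngle s (3 * π / 5)} ∧
      ⇑(vertexRot ^ 4) '' b₂ ∩ ⇑(vertexRot ^ 2) '' b₃ = {s | HasConstAngle s (-(π / 5))} ∧
      ⇑(vertexRot ^ 2) '' b₃ ∩ ⇑(vertexRot ^ 1) '' b₄ = {s | HasConstAngle s (-(3 * π / 5))} ∧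
      ⇑(vertexRot ^ 1) '' b₄ ∩ ⇑(vertexRot ^ 4) '' b₂ = ∅ ∧
      ⇑(vertexRot ^ 3) '' b₁ ∩ ⇑(vertexRot ^ 2) '' b₃ = ∅) ∧
    -- the region `φ` bounded by these arcs
    ∃ φ : Set LabelledShape, IsBoundedByArcs φ ∧ (∀ φ', IsBoundedByArcs φ' → φ' = φ) ∧
      -- `φ` contains every oriented shape exactly once, and its images tile the surface
      (∀ o : OrientedShape, ∃! s, s ∈ φ ∧ toOriented s = o) ∧
      (∀ C ∈ regions, ∃! g : D5plus, closure C = (g : Equiv.Perm LabelledShape) '' φ) ∧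
      -- `φ` is parametrized by `(α₁, α₂)`
      (∀ s ∈ φ, ∃ a₁ a₂ a₃ : ℝ, HasReducedAlpha s a₁ a₂ a₃ ∧
        ∀ s' ∈ φ, ∀ a₃' : ℝ, HasReducedAlpha s' a₁ a₂ a₃' → s' = s) ∧
      -- the action of `V` on `φ`; orbit lengths under the full symmetry group
      vertexRefl '' φ = φ ∧
      (∀ s ∈ φ, vertexRefl s = s ↔ HasAlpha s 0 0 (π - arccos (7 / 8))) ∧
      (∃ s ∈ φ, vertexRefl s = s) ∧
      (∀ s ∈ φ, IsRegular s → (MulAction.orbit D10 s).ncard = 2) ∧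
      (∀ s ∈ φ, s ∈ frontier φ → ¬ IsRegular s → (MulAction.orbit D10 s).ncard = 10) ∧
      (∀ s ∈ φ, vertexRefl s = s → (MulAction.orbit D10 s).ncard = 10) ∧
      (∀ s ∈ φ, s ∉ frontier φ → vertexRefl s ≠ s → (MulAction.orbit D10 s).ncard = 20) ∧
      -- the half `φ⁺` of `φ`, for either choice of the half of the cut that is kept
      ∀ σ : ℝ, σ = 1 ∨ σ = -1 →
        (∀ o : UnorientedShape, ∃! s, s ∈ halfRegion φ σ ∧ toUnoriented s = o) ∧
        halfRegion φ σ ∪ vertexRefl '' halfRegion φ σ = φ ∧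
        (∀ s ∈ φ, ∀ a₁ a₂ a₃ : ℝ, HasReducedAlpha s a₁ a₂ a₃ → a₁ ≠ a₂ →
          (s ∈ halfRegion φ σ ↔ 0 < angleSum s)) := by
  refine ⟨⟨vertexRot_pow_five, axial_sq, axial_mul_vertexRot, nonempty_D5plus_mulEquiv,
      nonempty_D10_mulEquiv⟩,
    ⟨exists_const_one, exists_const_neg_one, exists_const_three, exists_const_neg_three,
      fun _ => isotropy_regular, fun _ => isotropy_symmetric, fun _ => isotropy_generic⟩,
    ⟨fun k _ => symCurve_eq k, fun _ hk _ hl => symCurve_injective hk hl,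
      fun _ => isReflectionSymmetric_iff_mem_symCurve, symCurve_zero_eq⟩,
    ⟨ncard_regions, fun _ => region_open_simplyConnected⟩,
    ⟨right_inter_top, top_inter_left, left_inter_bottom, bottom_inter_right, right_inter_left,
      top_inter_bottom⟩,
    tile, isBoundedByArcs_tile, fun _ => IsBoundedByArcs.eq_tile, existsUnique_oriented,
    fun _ => existsUnique_closure, fun _ => reduced_of_mem_tile, vertexRefl_image_tile,
    fun _ h => (vertexRefl_eq_self_iff h).trans eq_center_iff,
    ⟨center, cell_subset_tile center_mem_cell, vertexRefl_center⟩,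
    fun _ _ => ncard_orbit_D10_regular,
    fun _ _ hf => ncard_orbit_D10_arcs (frontier_tile ▸ hf), ?_, ?_,
    fun σ hσ => ⟨existsUnique_unoriented hσ, halfRegion_union σ,
      fun _ h _ _ _ hr hne => mem_halfRegion_iff_angleSum h hr hne σ⟩⟩
  · intro s h hV
    rw [(vertexRefl_eq_self_iff h).1 hV]
    exact ncard_orbit_D10_center
  · intro s h hf hV
    exact ncard_orbit_D10_cell
      ((mem_cell_or_arcs h).resolve_right fun ha => hf (frontier_tile ▸ ha)) hV
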